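/- Let $k$ be a field, $X$ a $k$-scheme, $L, L'$ line bundles on $X$, and $L'' := L\otimes L'$. Let $W\subset H^0(L)$ and $U\subset H^0(L')$ be nonzero finite-dimensional subspaces such that the multiplication $W\otimes U\to H^0(L'')$ is geometrically $1$-generic (after base change to $\overline k$, $a\otimes b$ has nonzero image for all nonzero $a$, $b$). Let $V\subset H^0(L'')$ be a finite-dimensional subspace containing $W\cdot U$, let $\mu: W\otimes U\to V$ be the multiplication, $w=\dim W$, $S=\mathrm{Sym}(V)$ with $V$ in degree $1$, and $\mathfrak m = VS$. **Notation.** Let $E=\wedge(V^*)$ with $V^*$ in degree $-1$, and let $Q=\bigoplus_{l\ge 0}Q_l$ with $Q_l=\wedge^{l+1}W^*\otimes \mathrm{Sym}_l(U^*)$ in degree $-l$, a graded $E$-module on which $\xi\in V^*$ acts as multiplication by $\mu^*(\xi)\in W^*\otimes U^*$. For a graded $E$-module $R=\bigoplus_{l\ge0}R_l$ ($R_l$ in degree $-l$) let $\mathbf L(R^*)$ be the complex of graded free $S$-modules with terms $S(-l)\otimes R_l^*$ and differentials $1\otimes p\mapsto\sum_j x_j\otimes e_jp$, where $x_j,e_j$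 are dual bases of $V,V^*$ and $(e_jp)(q)=p(e_jq)$. Put $F_\bullet(\mu)=\mathbf L(Q^*)$ and $F'_\bullet(\mu)=\mathbf L(Q'^*)$, where $Q'\subset Q$ is the $E$-submodule generated by $Q_0$; restriction of linear forms gives a map $\pi:F_\bullet(\mu)\to F'_\bullet(\mu)$. A complex $F_\bullet$ of graded free $S$-modules with $F_i$ generated in degree $i$ for all $i\ge0$ is called irredundant if the induced maps $F_{i+1}/\mathfrak mF_{i+1}\to\mathfrak mF_i/\mathfrak m^2F_i$ are injective for all $i\ge 0$. $D_m(U)$ denotes the degree $m$ piece of the divided power algebra of $U$. **Theorem.** Let $M\subset\bigoplus_{n\ge0}H^0(L\otimes L''^{\otimes n})$ be a finitely generated graded $S$-submodule with $W\subset M_0$. Then: 1. $F'_\bullet(\mu)$ is, via $\pi$, the maximal irredundant quotient of $F_\bullet(\mu)$: $\pi$ is surjective, $F'_\bullet(\mu)$ is irredundant, and every surjective map of complexes of graded $S$-modules from $F_\bullet(\mu)$ to an irredundant complex factors through $\pi$. 2. $F'_0(\mu)\cong W\otimes S$; the map $\pi$ is bijective in homological degree $w-1$, and $F'_{w-1}(\mu)\cong\wedge^wW\otimes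 D_{w-1}(U)\otimes S(-w+1)$ as graded $S$-modules; and $F'_i(\mu)=0$ for $i\ge w$. 3. For every minimal graded free resolution $G_\bullet$ of $M$ over $S$ there is a map of complexes of graded $S$-modules $\alpha_\bullet:F'_\bullet(\mu)\to G_\bullet$ such that every $\alpha_i$ is a split injection; that is, $F'_\bullet(\mu)$ is a degreewise direct summand of the minimal free resolution of $M$. -/

import Mathlib

open CategoryTheory AlgebraicGeometry TopologicalSpace
open scoped TensorProduct DirectSum

universe u v w

noncomputable section

namespace LinSyz

/-! ### Line bundles on a scheme, tensor products, and multiplication of sections -/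

section Geometry

variable {X : Scheme.{u}}

/-- The presheaf tensor product `U ↦ Γ(L, U) ⊗ Γ(N, U)` of two sheaves of modules. -/
def tensorPresheaf (L N : X.Modules) : X.PresheafOfModules :=
  PresheafOfModules.Monoidal.tensorObj (R := X.presheaf) L.val N.val

/-- The tensor product `L ⊗ N` of two `𝒪_X`-modules: the sheaf associated to the presheaf
tensor product. -/
def tensor (L N : X.Modules) : X.Modules :=
  (PresheafOfModules.sheafification (𝟙 X.ringCatSheaf.obj)).obj (tensorPresheaf L N)

/-- The canonical map from the presheaf tensor product to its sheafification. -/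
def toTensor (L N : X.Modules) : tensorPresheaf L N ⟶ (tensor L N).val :=
  PresheafOfModules.toSheafify (𝟙 X.ringCatSheaf.obj)
    (CategoryTheory.toSheafify _ (tensorPresheaf L N).presheaf)

/-- Multiplication of sections `Γ(L, U) × Γ(N, U) → Γ(L ⊗ N, U)`. -/
def mulSection (L N : X.Modules) (U : X.Opens) :
    Γ(L, U) →ₗ[Γ(X, U)] Γ(N, U) →ₗ[Γ(X, U)] Γ(tensor L N, U) :=
  (TensorProduct.mk Γ(X, U) Γ(L, U) Γ(N, U)).compr₂ ((toTensor L N).app (.op U)).hom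

/-- Restriction of sections of a sheaf of modules. -/
def res (L : X.Modules) {U V : X.Opens} (h : V ≤ U) : Γ(L, U) →+ Γ(L, V) :=
  (L.presheaf.map (homOfLE h).op).hom

/-- `L` is a line bundle: locally on `X` there is a section `e` over an open `U` such that
`𝒪_U → L|_U`, `a ↦ a e`, is an isomorphism (i.e. bijective over every open `V ⊆ U`). -/
def IsLineBundle (L : X.Modules) : Prop :=
  ∀ x : X, ∃ (U : X.Opens) (_ : x ∈ U) (e : Γ(L, U)), ∀ (V : X.Opens) (h : V ≤ U),
    Function.Bijective fun a : Γ(X, V) => a • res L h e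

theorem res_res (L : X.Modules) {U V W : X.Opens} (h : V ≤ U) (h' : W ≤ V) (s : Γ(L, U)) :
    res L h' (res L h s) = res L (h'.trans h) s := by
  have : (homOfLE (h'.trans h)).op = (homOfLE h).op ≫ (homOfLE h').op := rfl
  simp only [res, this, Functor.map_comp]
  rfl

theorem res_smul (L : X.Modules) {U V : X.Opens} (h : V ≤ U) (a : Γ(X, U)) (s : Γ(L, U)) :
    res L h (a • s) = X.presheaf.map (homOfLE h).op a • res L h s :=
  L.map_smul (homOfLE h) a s

theorem res_mul (L N : X.Modules) {U V : X.Opens} (h : V ≤ U) (s : Γ(L, U)) (t : Γ(N, U)) :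
    res _ h (mulSection L N U s t) = mulSection L N V (res L h s) (res N h t) := by
  exact (PresheafOfModules.naturality_apply (toTensor L N) (homOfLE h).op
    (s ⊗ₜ[Γ(X, U)] t : TensorProduct Γ(X, U) Γ(L, U) Γ(N, U))).symm

theorem section_ext (L : X.Modules) {U : X.Opens} (s t : Γ(L, U))
    (H : ∀ x ∈ U, ∃ (V : X.Opens) (h : V ≤ U), x ∈ V ∧ res L h s = res L h t) : s = t := by
  refine TopCat.Sheaf.eq_of_locally_eq' ⟨L.presheaf, L.isSheaf⟩
    (fun p : {V : X.Opens // ∃ h : V ≤ U, res L h s = res L h t} => p.1) U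
    (fun p => homOfLE p.2.choose) ?_ s t ?_
  · intro x hx
    obtain ⟨V, h, hxV, e⟩ := H x hx
    exact Opens.mem_iSup.2 ⟨⟨V, h, e⟩, hxV⟩
  · rintro ⟨V, h, e⟩
    exact e

theorem exists_tensor (L N : X.Modules) {U : X.Opens} (s : Γ(tensor L N, U)) (x : X) (hx : x ∈ U) :
    ∃ (V : X.Opens) (h : V ≤ U), x ∈ V ∧ ∃ t : TensorProduct Γ(X, V) Γ(L, V) Γ(N, V),
      TensorProduct.lift (mulSection L N V) t = res _ h s := by
  have : Presheaf.IsLocallySurjective (Opens.grothendieckTopology X) (CategoryTheory.toSheafify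
    (Opens.grothendieckTopology X) (tensorPresheaf L N).presheaf) := inferInstance
  obtain ⟨V, f, ⟨t, ht⟩, hV⟩ := this.imageSieve_mem (U := U) s x hx
  refine ⟨V, leOfHom f, hV, t, ?_⟩
  refine Eq.trans ?_ ht
  have : TensorProduct.lift (mulSection L N V) = ((toTensor L N).app (.op V)).hom := by
    ext a b
    rfl
  rw [this]
  rfl

theorem tensor_locally_cyclic {L N : X.Modules} (hL : IsLineBundle L) (hN : IsLineBundle N)
    (x : X) : ∃ (U : X.Opens) (_ : x ∈ U) (e : Γ(tensor L N, U)), ∀ (s : Γ(tensor L N, ⊤)),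
      ∃ (V : X.Opens) (h : V ≤ U) (_ : x ∈ V) (a : Γ(X, V)), res _ le_top s = a • res _ h e := by
  obtain ⟨U₁, h₁, e₁, H₁⟩ := hL x
  obtain ⟨U₂, h₂, e₂, H₂⟩ := hN x
  refine ⟨U₁ ⊓ U₂, ⟨h₁, h₂⟩, mulSection L N _ (res L inf_le_left e₁) (res N inf_le_right e₂),
    fun s => ?_⟩
  obtain ⟨V, hV, hxV, t, ht⟩ := exists_tensor L N s x trivial
  refine ⟨V ⊓ (U₁ ⊓ U₂), inf_le_right, ⟨hxV, h₁, h₂⟩, ?_⟩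
  rw [← res_res (tensor L N) le_top (inf_le_left : V ⊓ (U₁ ⊓ U₂) ≤ V), ← ht]
  clear ht
  induction t with
  | zero => exact ⟨0, by simp⟩
  | add t₁ t₂ ih₁ ih₂ =>
    obtain ⟨a, ha⟩ := ih₁
    obtain ⟨b, hb⟩ := ih₂
    exact ⟨a + b, by rw [map_add, map_add, ha, hb, add_smul]⟩
  | tmul p q =>
    obtain ⟨a, ha⟩ := (H₁ (V ⊓ (U₁ ⊓ U₂)) (inf_le_right.trans inf_le_left)).2 (res L inf_le_left p)
    obtain ⟨b, hb⟩ := (H₂ (V ⊓ (U₁ ⊓ U₂)) (inf_le_right.trans inf_le_right)).2 (res N inf_le_left q)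
    refine ⟨a * b, ?_⟩
    dsimp only at ha hb
    rw [TensorProduct.lift.tmul, res_mul, res_mul, res_res, res_res, ← ha, ← hb, map_smul,
      map_smul, LinearMap.smul_apply, smul_smul, mul_comm]

/-- Multiplication by two sections of the line bundle `L ⊗ N` can be interchanged. -/
theorem mulSection_right_comm {L N : X.Modules} (hL : IsLineBundle L) (hN : IsLineBundle N)
    (T : X.Modules) (m : Γ(T, ⊤)) (a b : Γ(tensor L N, ⊤)) :
    mulSection _ _ ⊤ (mulSection _ _ ⊤ m a) b = mulSection _ _ ⊤ (mulSection _ _ ⊤ m b) a := by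
  refine section_ext _ _ _ fun x _ => ?_
  obtain ⟨U, hxU, e, H⟩ := tensor_locally_cyclic hL hN x
  obtain ⟨V, hV, hxV, c, hc⟩ := H a
  obtain ⟨V', hV', hxV', c', hc'⟩ := H b
  refine ⟨V ⊓ V', le_top, ⟨hxV, hxV'⟩, ?_⟩
  have h1 := congrArg (res _ (inf_le_left : V ⊓ V' ≤ V)) hc
  have h2 := congrArg (res _ (inf_le_right : V ⊓ V' ≤ V')) hc'
  rw [res_smul, res_res, res_res] at h1 h2
  rw [res_mul, res_mul, res_mul, res_mul, h1, h2]
  simp only [map_smul, LinearMap.smul_apply]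
  rw [smul_comm]

/-- `L ⊗ N ⊗ ⋯ ⊗ N` with `n` factors `N`, that is, `L ⊗ N^{⊗ n}`. -/
def twist (L N : X.Modules) : ℕ → X.Modules
  | 0 => L
  | n + 1 => tensor (twist L N n) N

variable {k : Type u} [Field k] (f : X ⟶ Spec (CommRingCat.of k))

/-- The ring homomorphism `k → Γ(X, 𝒪_X)` of a `k`-scheme. -/
def structureHom : k →+* Γ(X, ⊤) :=
  ((Scheme.ΓSpecIso (CommRingCat.of k)).inv ≫ f.appTop).hom

/-- `H⁰(L)`, the `k`-vector space of global sections of a sheaf of modules on a `k`-scheme. -/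
def H0 (_ : X ⟶ Spec (CommRingCat.of k)) (L : X.Modules) : Type u := Γ(L, ⊤)

instance (L : X.Modules) : AddCommGroup (H0 f L) := inferInstanceAs (AddCommGroup Γ(L, ⊤))

instance (L : X.Modules) : Module k (H0 f L) :=
  Module.compHom (Γ(L, ⊤) : Type u) (structureHom f)

theorem H0_smul_def (L : X.Modules) (c : k) (s : H0 f L) :
    c • s = (show Γ(L, ⊤) from structureHom f c • (show Γ(L, ⊤) from s)) := rfl

/-- Multiplication of global sections `H⁰(L) × H⁰(N) → H⁰(L ⊗ N)`, as a `k`-bilinear map. -/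
def mulH0 (L N : X.Modules) : H0 f L →ₗ[k] H0 f N →ₗ[k] H0 f (tensor L N) :=
  LinearMap.mk₂ k (fun s t => mulSection L N ⊤ s t)
    (fun s s' t => LinearMap.map_add₂ (mulSection L N ⊤) s s' t)
    (fun c s t => LinearMap.map_smul₂ (mulSection L N ⊤) (structureHom f c) s t)
    (fun s t t' => map_add (mulSection L N ⊤ s) t t')
    (fun c s t => LinearMap.map_smul (mulSection L N ⊤ s) (structureHom f c) (show Γ(N, ⊤) from t))

end Geometry

/-! ### Graded modules over the symmetric algebra -/

section Graded

/-- The degree `n` part `Sym_n(V)` of the symmetric algebra. -/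
def symDeg (k : Type u) [Field k] (V : Type u) [AddCommGroup V] [Module k V] (n : ℕ) :
    Submodule k (SymmetricAlgebra k V) :=
  LinearMap.range (SymmetricAlgebra.ι k V) ^ n

/-- The ideal `𝔪` of `S = Sym(V)` generated by `V`. -/
def maxIdeal (k : Type u) [Field k] (V : Type u) [AddCommGroup V] [Module k V] :
    Ideal (SymmetricAlgebra k V) :=
  Ideal.span (Set.range (SymmetricAlgebra.ι k V))

/-- A `ℤ`-graded module over `S = Sym(V)`, where `V` is in degree `1`: an `S`-module which is the
direct sum of `k`-subspaces `deg n` such that `V · deg n ⊆ deg (n + 1)`. -/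
structure GrMod (k : Type u) [Field k] (V : Type u) [AddCommGroup V] [Module k V] where
  carrier : Type v
  [addCommGroup : AddCommGroup carrier]
  [moduleBase : Module k carrier]
  [moduleSym : Module (SymmetricAlgebra k V) carrier]
  [isScalarTower : IsScalarTower k (SymmetricAlgebra k V) carrier]
  deg : ℤ → Submodule k carrier
  isInternal : DirectSum.IsInternal deg
  smul_mem : ∀ (a : V) (n : ℤ), ∀ x ∈ deg n, SymmetricAlgebra.ι k V a • x ∈ deg (n + 1)

attribute [instance] GrMod.addCommGroup GrMod.moduleBase GrMod.moduleSym GrMod.isScalarTower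

variable {k : Type u} [Field k] {V : Type u} [AddCommGroup V] [Module k V]

instance : CoeSort (GrMod.{u, v} k V) (Type v) := ⟨GrMod.carrier⟩

/-- Homomorphisms of graded `S`-modules (of degree `0`). -/
structure GrHom (A : GrMod.{u, v} k V) (B : GrMod.{u, w} k V) where
  toLin : A →ₗ[SymmetricAlgebra k V] B
  map_deg : ∀ n, ∀ x ∈ A.deg n, toLin x ∈ B.deg n

/-- `A` and `B` are isomorphic as graded `S`-modules. -/
def GrMod.Isomorphic (A : GrMod.{u, v} k V) (B : GrMod.{u, w} k V) : Prop :=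
  ∃ (φ : GrHom A B) (ψ : GrHom B A),
    (∀ x, ψ.toLin (φ.toLin x) = x) ∧ ∀ y, φ.toLin (ψ.toLin y) = y

/-- A split injection of graded `S`-modules. -/
def GrHom.IsSplitInjection {A : GrMod.{u, v} k V} {B : GrMod.{u, w} k V} (φ : GrHom A B) : Prop :=
  ∃ ρ : GrHom B A, ∀ x, ρ.toLin (φ.toLin x) = x

/-- A graded `S`-module is graded free if it has an `S`-basis of homogeneous elements. -/
def GrMod.IsGradedFree (A : GrMod.{u, v} k V) : Prop :=
  ∃ (J : Type v) (b : Module.Basis J (SymmetricAlgebra k V) A) (e : J → ℤ), ∀ j, b j ∈ A.deg (e j)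

/-- A graded free `S`-module generated in degree `n`. -/
def GrMod.IsGradedFreeIn (A : GrMod.{u, v} k V) (n : ℤ) : Prop :=
  ∃ (J : Type v) (b : Module.Basis J (SymmetricAlgebra k V) A), ∀ j, b j ∈ A.deg n

/-- A graded (homogeneous) submodule `M` of `A`: it is spanned by its homogeneous elements. -/
def GrMod.IsHomogeneous (A : GrMod.{u, v} k V) (M : Submodule (SymmetricAlgebra k V) A) : Prop :=
  M.restrictScalars k ≤ ⨆ n, M.restrictScalars k ⊓ A.deg n

/-- The algebra map `S → S[T]` sending `a ∈ V` to `a T`; it separates the degrees. -/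
def gradeHom (k : Type u) [Field k] (V : Type u) [AddCommGroup V] [Module k V] :
    SymmetricAlgebra k V →ₐ[k] Polynomial (SymmetricAlgebra k V) :=
  SymmetricAlgebra.lift
    (((Polynomial.monomial (R := SymmetricAlgebra k V) 1).restrictScalars k) ∘ₗ
      SymmetricAlgebra.ι k V)

/-- The projection of `S` onto its degree `n` part. -/
def symProj (k : Type u) [Field k] (V : Type u) [AddCommGroup V] [Module k V] (n : ℕ) :
    SymmetricAlgebra k V →ₗ[k] SymmetricAlgebra k V :=
  ((Polynomial.lcoeff (SymmetricAlgebra k V) n).restrictScalars k) ∘ₗ (gradeHom k V).toLinearMap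

theorem gradeHom_of_mem {n : ℕ} {s : SymmetricAlgebra k V} (hs : s ∈ symDeg k V n) :
    gradeHom k V s = Polynomial.monomial n s := by
  induction n generalizing s with
  | zero =>
    obtain ⟨a, rfl⟩ := Submodule.mem_one.1 (by simpa [symDeg] using hs)
    rw [AlgHom.commutes]
    rfl
  | succ n ih =>
    rw [symDeg, pow_succ] at hs
    induction hs using Submodule.mul_induction_on' with
    | mem_mul_mem x hx y hy =>
      obtain ⟨w, rfl⟩ := hy
      rw [map_mul, ih hx]
      simp [gradeHom, Polynomial.monomial_mul_monomial]
    | add x _ y _ hx hy => rw [map_add, hx, hy, map_add]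

theorem iSup_symDeg : ⨆ n, symDeg k V n = ⊤ := by
  rw [eq_top_iff]
  rintro s -
  induction s using SymmetricAlgebra.induction with
  | algebraMap r =>
    exact Submodule.mem_iSup_of_mem 0 (by rw [symDeg, pow_zero]; exact ⟨r, by simp [Algebra.algebraMap_eq_smul_one]⟩)
  | ι x => exact Submodule.mem_iSup_of_mem 1 (by rw [symDeg, pow_one]; exact ⟨x, rfl⟩)
  | add a b ha hb => exact add_mem ha hb
  | mul a b ha hb =>
    have : a * b ∈ (⨆ n, symDeg k V n) * (⨆ n, symDeg k V n) := Submodule.mul_mem_mul ha hb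
    rw [Submodule.iSup_mul] at this
    refine (iSup_le fun i => ?_ : _ ≤ ⨆ n, symDeg k V n) this
    rw [Submodule.mul_iSup]
    refine iSup_le fun j => ?_
    rw [symDeg, symDeg, ← pow_add]
    exact le_iSup (symDeg k V) (i + j)

theorem symProj_of_mem {n m : ℕ} {s : SymmetricAlgebra k V} (hs : s ∈ symDeg k V n) :
    symProj k V m s = if n = m then s else 0 := by
  simp [symProj, gradeHom_of_mem hs, Polynomial.coeff_monomial]

theorem ι_mul_mem_symDeg (v : V) {n : ℕ} {s : SymmetricAlgebra k V} (hs : s ∈ symDeg k V n) :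
    SymmetricAlgebra.ι k V v * s ∈ symDeg k V (n + 1) := by
  rw [symDeg, pow_succ']
  exact Submodule.mul_mem_mul ⟨v, rfl⟩ hs

theorem isInternal_of_proj {M : Type v} [AddCommGroup M] [Module k M] (A : ℤ → Submodule k M)
    (p : ℤ → M →ₗ[k] M) (h1 : ∀ n, ∀ x ∈ A n, p n x = x)
    (h2 : ∀ n m, n ≠ m → ∀ x ∈ A n, p m x = 0) (h3 : ⨆ n, A n = ⊤) : DirectSum.IsInternal A := by
  rw [DirectSum.isInternal_submodule_iff_iSupIndep_and_iSup_eq_top]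
  refine ⟨fun n => ?_, h3⟩
  rw [Submodule.disjoint_def]
  intro x hx hx'
  have : (⨆ j, ⨆ (_ : j ≠ n), A j) ≤ LinearMap.ker (p n) :=
    iSup_le fun j => iSup_le fun hj y hy => h2 j n hj y hy
  rw [← h1 n x hx]
  exact this hx'

/-- The part of degree `n` of `S(-i) ⊗ P`. -/
def freeDeg (k : Type u) [Field k] (V : Type u) [AddCommGroup V] [Module k V] (P : Type u)
    [AddCommGroup P] [Module k P] (i n : ℤ) : Submodule k (SymmetricAlgebra k V ⊗[k] P) :=
  Submodule.span k {x | ∃ m : ℕ, (m : ℤ) + i = n ∧ ∃ s ∈ symDeg k V m, ∃ p : P, x = s ⊗ₜ[k] p}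

theorem freeDeg_isInternal (P : Type u) [AddCommGroup P] [Module k P] (i : ℤ) :
    DirectSum.IsInternal (freeDeg k V P i) := by
  refine isInternal_of_proj _
    (fun n => if 0 ≤ n - i then (symProj k V (n - i).toNat).rTensor P else 0) ?_ ?_ ?_
  · intro n x hx
    induction hx using Submodule.span_induction with
    | mem x hx =>
      obtain ⟨m, rfl, s, hs, p, rfl⟩ := hx
      simp [symProj_of_mem hs]
    | zero => simp
    | add x y _ _ hx hy => rw [map_add, hx, hy]
    | smul a x _ hx => rw [map_smul, hx]
  · intro n m hnm x hx
    induction hx using Submodule.span_induction with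
    | mem x hx =>
      obtain ⟨l, rfl, s, hs, p, rfl⟩ := hx
      split_ifs with h
      · have : l ≠ (m - i).toNat := by omega
        simp [symProj_of_mem hs, this]
      · simp
    | zero => simp
    | add x y _ _ hx hy => rw [map_add, hx, hy, add_zero]
    | smul a x _ hx => rw [map_smul, hx, smul_zero]
  · rw [eq_top_iff]
    rintro x -
    induction x with
    | zero => exact zero_mem _
    | add x y hx hy => exact add_mem hx hy
    | tmul s p =>
      have hs : s ∈ ⨆ n, symDeg k V n := by rw [iSup_symDeg]; trivial
      induction hs using Submodule.iSup_induction' with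
      | mem m s hs =>
        exact Submodule.mem_iSup_of_mem ((m : ℤ) + i)
          (Submodule.subset_span ⟨m, rfl, s, hs, p, rfl⟩)
      | zero => simp
      | add a b _ _ ha hb => rw [TensorProduct.add_tmul]; exact add_mem ha hb

theorem smul_mem_freeDeg (P : Type u) [AddCommGroup P] [Module k P] (i : ℤ) (v : V) (n : ℤ) :
    ∀ x ∈ freeDeg k V P i n, SymmetricAlgebra.ι k V v • x ∈ freeDeg k V P i (n + 1) := by
  intro x hx
  induction hx using Submodule.span_induction with
  | mem x hx =>
    obtain ⟨m, rfl, s, hs, p, rfl⟩ := hx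
    exact Submodule.subset_span ⟨m + 1, by push_cast; ring, _, ι_mul_mem_symDeg v hs, p, rfl⟩
  | zero => simp
  | add x y _ _ hx hy => rw [smul_add]; exact add_mem hx hy
  | smul a x _ hx => rw [smul_comm]; exact Submodule.smul_mem _ _ hx

/-- The graded free module `S(-i) ⊗ P`, generated by the vector space `P` placed in degree `i`. -/
abbrev freeGr (k : Type u) [Field k] (V : Type u) [AddCommGroup V] [Module k V] (P : Type u)
    [AddCommGroup P] [Module k P] (i : ℤ) : GrMod.{u, u} k V where
  carrier := SymmetricAlgebra k V ⊗[k] P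
  deg := freeDeg k V P i
  isInternal := freeDeg_isInternal P i
  smul_mem := smul_mem_freeDeg P i

theorem map_mem_freeDeg {P P' : Type u} [AddCommGroup P] [Module k P] [AddCommGroup P']
    [Module k P'] (φ : SymmetricAlgebra k V ⊗[k] P →ₗ[SymmetricAlgebra k V]
      SymmetricAlgebra k V ⊗[k] P') (i i' : ℤ)
    (h : ∀ m : ℕ, ∀ s ∈ symDeg k V m, ∀ p, φ (s ⊗ₜ p) ∈ freeDeg k V P' i' (m + i)) (n : ℤ) :
    ∀ x ∈ freeDeg k V P i n, φ x ∈ freeDeg k V P' i' n := by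
  intro x hx
  induction hx using Submodule.span_induction with
  | mem x hx =>
    obtain ⟨m, rfl, s, hs, p, rfl⟩ := hx
    exact h m s hs p
  | zero => rw [map_zero]; exact zero_mem _
  | add x y _ _ hx hy => rw [map_add]; exact add_mem hx hy
  | smul a x _ hx => rw [LinearMap.map_smul_of_tower]; exact Submodule.smul_mem _ _ hx

/-- The map `S(-i) ⊗ P → S(-i) ⊗ P'` induced by a linear map `P → P'`. -/
def freeGrMap {P P' : Type u} [AddCommGroup P] [Module k P] [AddCommGroup P'] [Module k P']
    (φ : P →ₗ[k] P') (i : ℤ) : GrHom (freeGr k V P i) (freeGr k V P' i) where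
  toLin := TensorProduct.AlgebraTensorModule.map LinearMap.id φ
  map_deg := map_mem_freeDeg _ i i fun m s hs p => Submodule.subset_span ⟨m, rfl, s, hs, φ p, rfl⟩

end Graded

/-! ### Complexes, irredundancy, minimal free resolutions -/

section Complexes

/-- A complex `⋯ → X 2 → X 1 → X 0` of graded `S`-modules, `S = Sym(V)`. -/
structure GrComplex (k : Type u) [Field k] (V : Type u) [AddCommGroup V] [Module k V] where
  X : ℕ → GrMod.{u, v} k V
  d : ∀ i, GrHom (X (i + 1)) (X i)
  d_comp_d : ∀ i x, (d i).toLin ((d (i + 1)).toLin x) = 0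

variable {k : Type u} [Field k] {V : Type u} [AddCommGroup V] [Module k V]

/-- Maps of complexes of graded `S`-modules. -/
structure GrComplexHom (F : GrComplex.{u, v} k V) (G : GrComplex.{u, w} k V) where
  app : ∀ i, GrHom (F.X i) (G.X i)
  comm : ∀ i x, (app i).toLin ((F.d i).toLin x) = (G.d i).toLin ((app (i + 1)).toLin x)

/-- A standard linear free complex: `F_i` is graded free, generated in degree `i`, for all `i`. -/
def GrComplex.IsStandardLinearFree (F : GrComplex.{u, v} k V) : Prop :=
  ∀ i : ℕ, (F.X i).IsGradedFreeIn i

/-- A standard linear free complex is irredundant if the maps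
`F_{i+1} / 𝔪 F_{i+1} → 𝔪 F_i / 𝔪² F_i` induced by the differentials are injective. -/
def GrComplex.IsIrredundant (F : GrComplex.{u, v} k V) : Prop :=
  ∀ (i : ℕ) (x : F.X (i + 1)),
    (F.d i).toLin x ∈ (maxIdeal k V ^ 2 • ⊤ : Submodule (SymmetricAlgebra k V) (F.X i)) →
    x ∈ (maxIdeal k V • ⊤ : Submodule (SymmetricAlgebra k V) (F.X (i + 1)))

/-- The map of complexes `F → G` given by `π` is surjective and `G` is an irredundant standard
linear free complex. -/
structure IsIrredundantQuotient {F G : GrComplex.{u, v} k V} (π : GrComplexHom F G) : Prop where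
  surjective : ∀ i, Function.Surjective (π.app i).toLin
  linear : G.IsStandardLinearFree
  irredundant : G.IsIrredundant

/-- The map `π : F → G` makes `G` the maximal irredundant quotient of `F`: every irredundant
quotient of `F` is a quotient of `G`, compatibly with the maps from `F`. -/
structure IsMaximalIrredundantQuotient {F G : GrComplex.{u, v} k V} (π : GrComplexHom F G) :
    Prop where
  isIrredundantQuotient : IsIrredundantQuotient π
  maximal : ∀ (H : GrComplex.{u, v} k V) (ρ : GrComplexHom F H), IsIrredundantQuotient ρ →
    ∃ τ : GrComplexHom G H, ∀ i x, (τ.app i).toLin ((π.app i).toLin x) = (ρ.app i).toLin x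

/-- `⋯ → G 2 → G 1 → G 0 → M → 0` (the last map being `ε`) is a minimal graded free resolution of
the submodule `M` of the graded `S`-module `A`: an exact sequence with all `G i` graded free
and all differentials of `G` having image in `𝔪 G`. -/
structure IsMinimalFreeResolution {A : GrMod.{u, w} k V} (M : Submodule (SymmetricAlgebra k V) A)
    (G : GrComplex.{u, v} k V) (ε : GrHom (G.X 0) A) : Prop where
  free : ∀ i, (G.X i).IsGradedFree
  minimal : ∀ i, LinearMap.range (G.d i).toLin ≤
    (maxIdeal k V • ⊤ : Submodule (SymmetricAlgebra k V) (G.X i))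
  exact : ∀ i, LinearMap.range (G.d (i + 1)).toLin = LinearMap.ker (G.d i).toLin
  exact_zero : LinearMap.range (G.d 0).toLin = LinearMap.ker ε.toLin
  range_augmentation : LinearMap.range ε.toLin = M

/-- `F` is a degreewise direct summand of `G`: there is a map of complexes `F → G` which is
a split injection in each homological degree. -/
def IsDegreewiseSummand (F : GrComplex.{u, v} k V) (G : GrComplex.{u, w} k V) : Prop :=
  ∃ α : GrComplexHom F G, ∀ i, (α.app i).IsSplitInjection

end Complexes

/-! ### Graded modules over the exterior algebra and the associated linear free complexes -/

section Exterior

/-- A graded module `Q = ⨁ Q_i` over the exterior algebra `E = ∧(V^*)`, with `V^*` in degree `-1`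
and `Q_i = piece i` in degree `-i`. By the universal property of the exterior algebra, an action
of `E` is the same thing as a linear action of the vectors `ξ ∈ V^*` with `ξ (ξ x) = 0`. -/
structure ExtMod (k : Type u) [Field k] (V : Type u) [AddCommGroup V] [Module k V] where
  piece : ℕ → Type u
  [addCommGroup : ∀ i, AddCommGroup (piece i)]
  [module : ∀ i, Module k (piece i)]
  act : ∀ i, Module.Dual k V →ₗ[k] piece i →ₗ[k] piece (i + 1)
  act_act : ∀ i ξ x, act (i + 1) ξ (act i ξ x) = 0

attribute [instance] ExtMod.addCommGroup ExtMod.module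

variable {k : Type u} [Field k] {V : Type u} [AddCommGroup V] [Module k V]

theorem ExtMod.act_anticomm (Q : ExtMod k V) (i : ℕ) (ξ η : Module.Dual k V) (x : Q.piece i) :
    Q.act (i + 1) ξ (Q.act i η x) = -Q.act (i + 1) η (Q.act i ξ x) := by
  have h := Q.act_act i (ξ + η) x
  simp only [map_add, LinearMap.add_apply, Q.act_act, zero_add, add_zero] at h
  exact eq_neg_of_add_eq_zero_right h

/-- The pieces `E_i · Q_0` of the `E`-submodule of `Q` generated by `Q_0`. -/
def ExtMod.gen (Q : ExtMod k V) : ∀ i, Submodule k (Q.piece i)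
  | 0 => ⊤
  | i + 1 => Submodule.span k {y | ∃ ξ : Module.Dual k V, ∃ x ∈ ExtMod.gen Q i, y = Q.act i ξ x}

theorem ExtMod.act_mem_gen (Q : ExtMod k V) (i : ℕ) (ξ : Module.Dual k V) {x : Q.piece i}
    (hx : x ∈ Q.gen i) : Q.act i ξ x ∈ Q.gen (i + 1) :=
  Submodule.subset_span ⟨ξ, x, hx, rfl⟩

/-- The `E`-submodule of `Q` generated by `Q_0`. -/
def ExtMod.generated (Q : ExtMod k V) : ExtMod k V where
  piece i := Q.gen i
  act i := LinearMap.mk₂ k (fun ξ x => ⟨Q.act i ξ x, Q.act_mem_gen i ξ x.2⟩)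
    (fun _ _ _ => Subtype.ext (LinearMap.map_add₂ _ _ _ _))
    (fun _ _ _ => Subtype.ext (LinearMap.map_smul₂ _ _ _ _))
    (fun _ _ _ => Subtype.ext (map_add _ _ _))
    (fun _ _ _ => Subtype.ext (map_smul _ _ _))
  act_act i ξ x := Subtype.ext (Q.act_act i ξ x)

/-- The differential `1 ⊗ p ↦ ∑ x_j ⊗ e_j p`, where `x_j`, `e_j` are dual bases of `V`, `V^*`, and
`(e_j p)(q) = p(e_j q)` is the action of `e_j` on the dual of `Q`. -/
def linDiff [FiniteDimensional k V] (Q : ExtMod k V) (i : ℕ) :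
    SymmetricAlgebra k V ⊗[k] Module.Dual k (Q.piece (i + 1)) →ₗ[SymmetricAlgebra k V]
      SymmetricAlgebra k V ⊗[k] Module.Dual k (Q.piece i) :=
  ∑ j, TensorProduct.AlgebraTensorModule.map
    (LinearMap.lsmul (SymmetricAlgebra k V) (SymmetricAlgebra k V)
      (SymmetricAlgebra.ι k V (Module.finBasis k V j)))
    (Q.act i ((Module.finBasis k V).coord j)).dualMap

theorem linDiff_tmul [FiniteDimensional k V] (Q : ExtMod k V) (i : ℕ) (s : SymmetricAlgebra k V)
    (p : Module.Dual k (Q.piece (i + 1))) :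
    linDiff Q i (s ⊗ₜ p) = ∑ j, (SymmetricAlgebra.ι k V (Module.finBasis k V j) * s) ⊗ₜ[k]
      (p ∘ₗ Q.act i ((Module.finBasis k V).coord j)) := by
  simp [linDiff, LinearMap.sum_apply]
  rfl

theorem linDiff_linDiff [FiniteDimensional k V] (Q : ExtMod k V) (i : ℕ)
    (x : SymmetricAlgebra k V ⊗[k] Module.Dual k (Q.piece (i + 1 + 1))) :
    linDiff Q i (linDiff Q (i + 1) x) = 0 := by
  induction x using TensorProduct.induction_on with
  | zero => simp
  | add x y hx hy => rw [map_add, map_add, hx, hy, add_zero]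
  | tmul s p =>
    rw [linDiff_tmul, map_sum]
    simp only [linDiff_tmul]
    rw [← Finset.sum_product', Finset.univ_product_univ]
    refine Finset.sum_involution (fun a _ => a.swap) ?_ ?_ (by simp) (by simp)
    · rintro ⟨j, l⟩ -
      have : (p ∘ₗ Q.act (i + 1) ((Module.finBasis k V).coord l)) ∘ₗ
          Q.act i ((Module.finBasis k V).coord j) =
          -((p ∘ₗ Q.act (i + 1) ((Module.finBasis k V).coord j)) ∘ₗ
            Q.act i ((Module.finBasis k V).coord l)) := by
        ext x
        simp [Q.act_anticomm i ((Module.finBasis k V).coord l)]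
      dsimp only [Prod.swap]
      rw [this, mul_left_comm, TensorProduct.tmul_neg, add_neg_cancel]
    · rintro ⟨j, l⟩ - h e
      apply h
      obtain rfl : l = j := congrArg Prod.fst e
      have : (p ∘ₗ Q.act (i + 1) ((Module.finBasis k V).coord l)) ∘ₗ
          Q.act i ((Module.finBasis k V).coord l) = 0 := by
        ext x
        simp [Q.act_act]
      dsimp only
      rw [this, TensorProduct.tmul_zero]

/-- The linear free complex `𝐋(Q^*)` of the dual of a graded `E`-module `Q`: its terms are
`S(-i) ⊗ (Q_i)^*`. -/
def linComplex [FiniteDimensional k V] (Q : ExtMod k V) : GrComplex.{u, u} k V where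
  X i := freeGr k V (Module.Dual k (Q.piece i)) i
  d i :=
    { toLin := linDiff Q i
      map_deg := map_mem_freeDeg _ _ _ fun m s hs p => by
        rw [linDiff_tmul]
        exact Submodule.sum_mem _ fun j _ => Submodule.subset_span
          ⟨m + 1, by push_cast; ring, _, ι_mul_mem_symDeg _ hs, _, rfl⟩ }
  d_comp_d := linDiff_linDiff Q

/-- The quotient map from `𝐋(Q^*)` to the linear free complex of the dual of the `E`-submodule of
`Q` generated by `Q_0`, induced by restriction of linear forms. -/
def linQuotient [FiniteDimensional k V] (Q : ExtMod k V) :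
    GrComplexHom (linComplex Q) (linComplex Q.generated) where
  app i := freeGrMap (Q.gen i).subtype.dualMap i
  comm i x := by
    change SymmetricAlgebra k V ⊗[k] Module.Dual k (Q.piece (i + 1)) at x
    change TensorProduct.AlgebraTensorModule.map LinearMap.id (Q.gen i).subtype.dualMap
      (linDiff Q i x) = linDiff Q.generated i
        (TensorProduct.AlgebraTensorModule.map LinearMap.id (Q.gen (i + 1)).subtype.dualMap x)
    induction x using TensorProduct.induction_on with
    | zero =>
      rw [map_zero, map_zero, map_zero]
      exact (map_zero (linDiff Q.generated i)).symm
    | add x y hx hy =>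
      rw [map_add, map_add, map_add, hx, hy]
      exact (map_add (linDiff Q.generated i) _ _).symm
    | tmul s p =>
      rw [linDiff_tmul, map_sum, TensorProduct.AlgebraTensorModule.map_tmul]
      erw [linDiff_tmul]
      rfl

end Exterior

/-! ### The complexes of a pairing -/

section Pairing

variable {k : Type u} [Field k]

/-- Left exterior multiplication `W × ∧^n W → ∧^{n+1} W`. -/
def wedgeLeft (k : Type u) [Field k] (W : Type u) [AddCommGroup W] [Module k W] (n : ℕ) :
    W →ₗ[k] ⋀[k]^n W →ₗ[k] ⋀[k]^(n + 1) W :=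
  LinearMap.mk₂ k (fun a x => ⟨ExteriorAlgebra.ι k a * x.1, by
      rw [ExteriorAlgebra.exteriorPower, pow_succ']
      exact Submodule.mul_mem_mul ⟨a, rfl⟩ x.2⟩)
    (fun _ _ _ => Subtype.ext (by simp [add_mul]))
    (fun _ _ _ => Subtype.ext (by simp))
    (fun _ _ _ => Subtype.ext (by simp [mul_add]))
    (fun _ _ _ => Subtype.ext (by simp))

/-- Multiplication `U × Sym_n(U) → Sym_{n+1}(U)`. -/
def symMul (k : Type u) [Field k] (U : Type u) [AddCommGroup U] [Module k U] (n : ℕ) :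
    U →ₗ[k] symDeg k U n →ₗ[k] symDeg k U (n + 1) :=
  LinearMap.mk₂ k (fun a x => ⟨SymmetricAlgebra.ι k U a * x.1, ι_mul_mem_symDeg a x.2⟩)
    (fun _ _ _ => Subtype.ext (by simp [add_mul]))
    (fun _ _ _ => Subtype.ext (by simp))
    (fun _ _ _ => Subtype.ext (by simp [mul_add]))
    (fun _ _ _ => Subtype.ext (by simp))

/-- The action `(a ⊗ b) · (ω ⊗ g) = (a ∧ ω) ⊗ (b g)` of `A ⊗ B` on `⨁ ∧^{l+1} A ⊗ Sym_l(B)`. -/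
def wedgeSym (k : Type u) [Field k] (A B : Type u) [AddCommGroup A] [Module k A]
    [AddCommGroup B] [Module k B] (l : ℕ) :
    A ⊗[k] B →ₗ[k] (⋀[k]^(l + 1) A ⊗[k] symDeg k B l) →ₗ[k]
      (⋀[k]^(l + 1 + 1) A ⊗[k] symDeg k B (l + 1)) :=
  TensorProduct.homTensorHomMap (.id k) _ _ _ _ ∘ₗ
    TensorProduct.map (wedgeLeft k A (l + 1)) (symMul k B l)

theorem wedgeSym_tmul {A B : Type u} [AddCommGroup A] [Module k A]
    [AddCommGroup B] [Module k B] (l : ℕ) (a : A) (b : B) (x : ⋀[k]^(l + 1) A)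
    (g : symDeg k B l) : wedgeSym k A B l (a ⊗ₜ b) (x ⊗ₜ g) =
      wedgeLeft k A (l + 1) a x ⊗ₜ symMul k B l b g := rfl

theorem wedgeSym_anticomm {A B : Type u} [AddCommGroup A] [Module k A]
    [AddCommGroup B] [Module k B] (l : ℕ) (s t : A ⊗[k] B)
    (y : ⋀[k]^(l + 1) A ⊗[k] symDeg k B l) :
    wedgeSym k A B (l + 1) s (wedgeSym k A B l t y) +
      wedgeSym k A B (l + 1) t (wedgeSym k A B l s y) = 0 := by
  induction y with
  | zero => simp
  | add y z hy hz =>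
    simp only [map_add]
    rw [add_add_add_comm, hy, hz, add_zero]
  | tmul x g =>
    induction s with
    | zero => simp
    | add s s' hs hs' =>
      simp only [map_add, LinearMap.add_apply]
      rw [add_add_add_comm, hs, hs', add_zero]
    | tmul a b =>
      induction t with
      | zero => simp
      | add t t' ht ht' =>
        simp only [map_add, LinearMap.add_apply]
        rw [add_add_add_comm, ht, ht', add_zero]
      | tmul a' b' =>
        simp only [wedgeSym_tmul]
        have h1 : wedgeLeft k A (l + 1 + 1) a (wedgeLeft k A (l + 1) a' x) =
            -wedgeLeft k A (l + 1 + 1) a' (wedgeLeft k A (l + 1) a x) := by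
          apply Subtype.ext
          change ExteriorAlgebra.ι k a * (ExteriorAlgebra.ι k a' * x.1) =
            -(ExteriorAlgebra.ι k a' * (ExteriorAlgebra.ι k a * x.1))
          have := ExteriorAlgebra.ι_add_mul_swap (R := k) a a'
          rw [← mul_assoc, ← mul_assoc, ← neg_mul, eq_neg_of_add_eq_zero_left this]
        have h2 : symMul k B (l + 1) b (symMul k B l b' g) =
            symMul k B (l + 1) b' (symMul k B l b g) := by
          apply Subtype.ext
          exact mul_left_comm _ _ _
        rw [h1, h2, TensorProduct.neg_tmul]
        exact neg_add_cancel (G := ⋀[k]^(l + 1 + 1 + 1) A ⊗[k] symDeg k B (l + 1 + 1)) _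

theorem wedgeSym_sq {A B : Type u} [AddCommGroup A] [Module k A]
    [AddCommGroup B] [Module k B] (l : ℕ) (t : A ⊗[k] B)
    (y : ⋀[k]^(l + 1) A ⊗[k] symDeg k B l) :
    wedgeSym k A B (l + 1) t (wedgeSym k A B l t y) = 0 := by
  induction t with
  | zero => simp
  | add s t hs ht =>
    simp only [map_add, LinearMap.add_apply]
    rw [hs, ht, zero_add, add_zero]
    exact wedgeSym_anticomm l t s y
  | tmul a b =>
    induction y with
    | zero => simp
    | add y z hy hz => simp only [map_add, hy, hz, add_zero]
    | tmul x g =>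
      simp only [wedgeSym_tmul]
      have h1 : wedgeLeft k A (l + 1 + 1) a (wedgeLeft k A (l + 1) a x) = 0 := by
        apply Subtype.ext
        change ExteriorAlgebra.ι k a * (ExteriorAlgebra.ι k a * x.1) = 0
        rw [← mul_assoc, ExteriorAlgebra.ι_sq_zero, zero_mul]
      rw [h1, TensorProduct.zero_tmul]

variable {V W U : Type u} [AddCommGroup V] [Module k V] [AddCommGroup W] [Module k W]
  [AddCommGroup U] [Module k U]

/-- The dual `μ^* : V^* → W^* ⊗ U^*` of a pairing `μ : W ⊗ U → V`. -/
def dualPairing [FiniteDimensional k W] [FiniteDimensional k U] (μ : W →ₗ[k] U →ₗ[k] V) :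
    Module.Dual k V →ₗ[k] Module.Dual k W ⊗[k] Module.Dual k U :=
  (TensorProduct.dualDistribEquiv k W U).symm.toLinearMap ∘ₗ (TensorProduct.lift μ).dualMap

/-- The graded `E`-module `Q = ⨁_l ∧^{l+1} W^* ⊗ Sym_l(U^*)`, on which `ξ ∈ V^*` acts as
multiplication by `μ^*(ξ) ∈ W^* ⊗ U^*`. -/
def pairingMod [FiniteDimensional k W] [FiniteDimensional k U] (μ : W →ₗ[k] U →ₗ[k] V) :
    ExtMod k V where
  piece l := ⋀[k]^(l + 1) (Module.Dual k W) ⊗[k] symDeg k (Module.Dual k U) l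
  act l := wedgeSym k (Module.Dual k W) (Module.Dual k U) l ∘ₗ dualPairing μ
  act_act l ξ y := wedgeSym_sq l (dualPairing μ ξ) y

/-- The linear free complex `F(μ) = 𝐋(Q^*)` of a pairing `μ : W ⊗ U → V`. -/
def pairingComplex [FiniteDimensional k V] [FiniteDimensional k W] [FiniteDimensional k U]
    (μ : W →ₗ[k] U →ₗ[k] V) : GrComplex.{u, u} k V :=
  linComplex (pairingMod μ)

/-- The linear free complex of the dual of the `E`-submodule of `Q` generated by `Q_0`. -/
def irredundantPairingComplex [FiniteDimensional k V] [FiniteDimensional k W]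
    [FiniteDimensional k U] (μ : W →ₗ[k] U →ₗ[k] V) : GrComplex.{u, u} k V :=
  linComplex (pairingMod μ).generated

/-- The natural map from `F(μ)` to the complex of the `E`-submodule generated by `Q_0`. -/
def pairingQuotient [FiniteDimensional k V] [FiniteDimensional k W] [FiniteDimensional k U]
    (μ : W →ₗ[k] U →ₗ[k] V) : GrComplexHom (pairingComplex μ) (irredundantPairingComplex μ) :=
  linQuotient (pairingMod μ)

/-- A pairing is `1`-generic if `μ(a ⊗ b) ≠ 0` for all nonzero `a`, `b`; it is geometrically
`1`-generic if its base change to the algebraic closure of `k` is `1`-generic. -/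
def IsGeometricallyOneGeneric (μ : W →ₗ[k] U →ₗ[k] V) : Prop :=
  ∀ (a : AlgebraicClosure k ⊗[k] W) (b : AlgebraicClosure k ⊗[k] U), a ≠ 0 → b ≠ 0 →
    (TensorProduct.lift μ).baseChange (AlgebraicClosure k)
      ((TensorProduct.AlgebraTensorModule.distribBaseChange k (AlgebraicClosure k) W U).symm
        (a ⊗ₜ[AlgebraicClosure k] b)) ≠ 0

/-- The graded piece `D_n(U)` of the divided power algebra of `U`: it is spanned by the products
`u_1^{(n_1)} ⋯ u_r^{(n_r)}` of divided powers with `n_1 + ⋯ + n_r = n`. -/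
def dividedPower (k : Type u) [Field k] (U : Type u) [AddCommGroup U] [Module k U] (n : ℕ) :
    Submodule k (DividedPowerAlgebra k U) :=
  Submodule.span k {x | ∃ s : Multiset (ℕ × U), (s.map Prod.fst).sum = n ∧
    x = (s.map fun q => DividedPowerAlgebra.dp k q.1 q.2).prod}

end Pairing

/-! ### The module of sections of `L ⊗ N^{⊗ n}`, `n ≥ 0` -/

section SectionModule

/-- Commuting operators `T a`, `a ∈ V`, on a vector space define an action of `Sym(V)`. -/
def symAction {k : Type u} [Field k] {V : Type u} [AddCommGroup V] [Module k V] {N : Type v}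
    [AddCommGroup N] [Module k N] (T : V →ₗ[k] Module.End k N)
    (h : ∀ a b, T a * T b = T b * T a) : SymmetricAlgebra k V →ₐ[k] Module.End k N :=
  letI A : Subalgebra k (Module.End k N) := Algebra.adjoin k (Set.range T)
  letI : CommSemiring A :=
    { A.toSemiring with
      mul_comm := (Algebra.isMulCommutative_adjoin k
        (by rintro _ ⟨a, rfl⟩ _ ⟨b, rfl⟩; exact h a b)).is_comm.comm }
  A.val.comp (SymmetricAlgebra.lift
    (LinearMap.codRestrict (Subalgebra.toSubmodule A) T fun a => Algebra.subset_adjoin ⟨a, rfl⟩))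

theorem symAction_ι {k : Type u} [Field k] {V : Type u} [AddCommGroup V] [Module k V]
    {N : Type v} [AddCommGroup N] [Module k N] (T : V →ₗ[k] Module.End k N)
    (h : ∀ a b, T a * T b = T b * T a) (a : V) :
    symAction T h (SymmetricAlgebra.ι k V a) = T a := by
  let A : Subalgebra k (Module.End k N) := Algebra.adjoin k (Set.range T)
  let _ : CommSemiring A :=
    { A.toSemiring with
      mul_comm := (Algebra.isMulCommutative_adjoin k
        (by rintro _ ⟨a, rfl⟩ _ ⟨b, rfl⟩; exact h a b)).is_comm.comm }
  let g : V →ₗ[k] A :=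
    LinearMap.codRestrict (Subalgebra.toSubmodule A) T fun a => Algebra.subset_adjoin ⟨a, rfl⟩
  have : SymmetricAlgebra.lift g (SymmetricAlgebra.ι k V a) = g a :=
    SymmetricAlgebra.lift_ι_apply g a
  exact congrArg Subtype.val this

variable {k : Type u} [Field k] {X : Scheme.{u}} (f : X ⟶ Spec (CommRingCat.of k))

/-- Multiplication by the sections in `V ⊆ H⁰(N)` on `⨁ₙ H⁰(L ⊗ N^{⊗ n})`. -/
def sectionMul (L N : X.Modules) (V : Submodule k (H0 f N)) :
    V →ₗ[k] Module.End k (⨁ n, H0 f (twist L N n)) :=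
  (DirectSum.toModule k ℕ (H0 f N →ₗ[k] ⨁ n, H0 f (twist L N n)) fun n =>
    (mulH0 f (twist L N n) N).compr₂
      (DirectSum.lof k ℕ (fun n => H0 f (twist L N n)) (n + 1))).flip ∘ₗ V.subtype

theorem sectionMul_lof (L N : X.Modules) (V : Submodule k (H0 f N)) (a : V) (n : ℕ)
    (x : H0 f (twist L N n)) :
    sectionMul f L N V a (DirectSum.lof k ℕ (fun n => H0 f (twist L N n)) n x) =
      DirectSum.lof k ℕ (fun n => H0 f (twist L N n)) (n + 1) (mulH0 f (twist L N n) N x a) := by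
  rw [sectionMul, LinearMap.comp_apply, LinearMap.flip_apply, DirectSum.toModule_lof]
  rfl

theorem sectionMul_comm {L₁ L₂ : X.Modules} (h₁ : IsLineBundle L₁) (h₂ : IsLineBundle L₂)
    (L : X.Modules) (V : Submodule k (H0 f (tensor L₁ L₂))) (a b : V) :
    sectionMul f L _ V a * sectionMul f L _ V b = sectionMul f L _ V b * sectionMul f L _ V a := by
  refine DirectSum.linearMap_ext _ fun n => LinearMap.ext fun x => ?_
  simp only [LinearMap.comp_apply, Module.End.mul_apply, sectionMul_lof]
  erw [sectionMul_lof, sectionMul_lof]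
  exact congrArg (DirectSum.lof k ℕ (fun n => H0 f (twist L (tensor L₁ L₂) n)) (n + 1 + 1))
    (mulSection_right_comm h₁ h₂ _ x b.1 a.1)

/-- The degree `i` part of `⨁ₙ H⁰(L ⊗ N^{⊗ n})`: the summand `n = i` (zero if `i < 0`). -/
def sectionDeg (L N : X.Modules) (i : ℤ) : Submodule k (⨁ n, H0 f (twist L N n)) :=
  ⨆ (n : ℕ) (_ : (n : ℤ) = i), LinearMap.range (DirectSum.lof k ℕ (fun n => H0 f (twist L N n)) n)

/-- The graded `Sym(V)`-module `⨁ₙ H⁰(L ⊗ (L₁ ⊗ L₂)^{⊗ n})`, `n ≥ 0`, for a linear series `V` in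
`H⁰(L₁ ⊗ L₂)`, on which `V` acts by multiplication of sections. -/
def sectionModule (L : X.Modules) {L₁ L₂ : X.Modules} (h₁ : IsLineBundle L₁)
    (h₂ : IsLineBundle L₂) (V : Submodule k (H0 f (tensor L₁ L₂))) : GrMod.{u, u} k V :=
  letI act := symAction (sectionMul f L _ V) (sectionMul_comm f h₁ h₂ L V)
  letI := Module.compHom (⨁ n, H0 f (twist L (tensor L₁ L₂) n)) act.toRingHom
  { carrier := ⨁ n, H0 f (twist L (tensor L₁ L₂) n)
    isScalarTower := ⟨fun c s x => by
      change act (c • s) x = c • act s x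
      rw [map_smul, LinearMap.smul_apply]⟩
    deg := sectionDeg f L (tensor L₁ L₂)
    isInternal := by
      refine isInternal_of_proj _ (fun i => if 0 ≤ i then
        DirectSum.lof k ℕ (fun n => H0 f (twist L (tensor L₁ L₂) n)) i.toNat ∘ₗ
          DirectSum.component k ℕ (fun n => H0 f (twist L (tensor L₁ L₂) n)) i.toNat else 0)
        ?_ ?_ ?_
      · intro i x hx
        refine (iSup₂_le fun n hn => ?_ : _ ≤ LinearMap.eqLocus _ LinearMap.id) hx
        rintro _ ⟨y, rfl⟩
        subst hn
        simp [DirectSum.component.lof_self]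
      · intro i j hij x hx
        refine (iSup₂_le fun n hn => ?_ : _ ≤ LinearMap.ker _) hx
        rintro _ ⟨y, rfl⟩
        subst hn
        rw [LinearMap.mem_ker]
        split_ifs with hj
        · rw [LinearMap.comp_apply, DirectSum.component.of, dif_neg (by omega), map_zero]
        · rfl
      · rw [eq_top_iff]
        rintro x -
        induction x using DirectSum.induction_on with
        | zero => exact zero_mem _
        | add x y hx hy => exact add_mem hx hy
        | of n y =>
          exact Submodule.mem_iSup_of_mem (n : ℤ) (Submodule.mem_iSup_of_mem n
            (Submodule.mem_iSup_of_mem rfl ⟨y, rfl⟩))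
    smul_mem := fun a i x hx => by
      change act (SymmetricAlgebra.ι k V a) x ∈ _
      rw [symAction_ι]
      refine (iSup₂_le fun n hn => ?_ : _ ≤ Submodule.comap (sectionMul f L _ V a)
        (sectionDeg f L _ (i + 1))) hx
      rintro _ ⟨y, rfl⟩
      subst hn
      rw [Submodule.mem_comap, sectionMul_lof]
      exact Submodule.mem_iSup_of_mem (n + 1) (Submodule.mem_iSup_of_mem (by push_cast; rfl)
        ⟨_, rfl⟩) }

/-- The pairing `W × U → V` given by multiplication of sections, for linear series `W ⊆ H⁰(L)` and
`U ⊆ H⁰(N)` and a linear series `V ⊆ H⁰(L ⊗ N)` containing `W · U`. -/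
def seriesPairing {L N : X.Modules} {W : Submodule k (H0 f L)} {U : Submodule k (H0 f N)}
    {V : Submodule k (H0 f (tensor L N))} (h : ∀ a ∈ W, ∀ b ∈ U, mulH0 f L N a b ∈ V) :
    W →ₗ[k] U →ₗ[k] V :=
  LinearMap.mk₂ k (fun a b => ⟨mulH0 f L N a b, h a a.2 b b.2⟩)
    (fun _ _ _ => Subtype.ext (LinearMap.map_add₂ _ _ _ _))
    (fun _ _ _ => Subtype.ext (LinearMap.map_smul₂ _ _ _ _))
    (fun _ _ _ => Subtype.ext (map_add _ _ _))
    (fun _ _ _ => Subtype.ext (map_smul _ _ _))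

end SectionModule

end LinSyz

end

open LinSyz

/-! The proof rests on three arguments.

Irredundancy. The differential of `linComplex Q` sends a linear form p on Q_{i+1} to ∑ x_j ⊗ (p ∘
e_j). Modulo 𝔪² this vanishes only if p vanishes on V^*·Q_i, so irredundancy expresses that Q is
generated by Q_0 (`ExtMod.IsGenerated.isIrredundant`). Conversely, by induction on the homological
degree, a map to an irredundant linear complex kills every form vanishing on the submodule generated
by Q_0 (`map_eq_zero_of_comp_eq_zero`), and hence factors through its linear complex.

The top term. Put r = w - 1. Since ∧^w W^* is a line, Q_r is a copy of Sym_r(U^*), the forms of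
degree r on U. Take a basis a_0, …, a_r of W and let α be the coordinate of a_0. Acting on α by ω in
∧^r V^* and then contracting with a_1, …, a_r yields α times a combination of the maximal minors of
the r-rowed matrix of linear forms on U with rows μ(a_i, ·), i ≥ 1. So it suffices that these minors
span all forms of degree r. By geometric 1-genericity the matrix has rank r at every nonzero point
over the algebraic closure, so by the Nullstellensatz the ideal of minors contains a power of each
variable (`IsGeometricallyOneGeneric.hasContractions`). To pass from this to all forms of degree r,
a complex of Eagon–Northcott type is used: its differential is linear, its augmentation produces the
minors, and a minor becomes a common denominator for contracting homotopies. Adding one variable at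
a time and cancelling it, a cycle without constant terms is a boundary
(`HasContractions.isBoundaryMod`), and the same descent at the augmentation shows that nothing of
degree at least r is missing (`HasContractions.exists_minorAug_eq`). The rank of the term then
follows from a monomial basis of the divided power algebra, and the vanishing for i ≥ w from ∧^{i+1}
W^* = 0.

The resolution. Generators of the i-th term of a minimal resolution of M have degree at least i. The
inclusion of W into M_0 lifts to a map of complexes: its first obstruction vanishes because a·(a'u)
= a'·(au) for sections a, a' of L and u of L'. Irredundancy keeps the lift injective on generators,
inductively. An injection into the lowest possible degree of a graded free module is split
(`exists_retraction`). -/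

noncomputable section

namespace LinSyz

/-! ### Degrees and augmentation of the symmetric algebra. -/

section SymmetricAlgebra

variable {k : Type u} [Field k] {V : Type u} [AddCommGroup V] [Module k V]

/-- Taking the coefficient of T⁰ is evaluation at T = 0, so both sides come from algebra maps, and
these agree on V. -/
theorem symProj_zero_apply (s : SymmetricAlgebra k V) :
    symProj k V 0 s =
      algebraMap k (SymmetricAlgebra k V) (SymmetricAlgebra.algebraMapInv s) := by
  have : ((Polynomial.aeval (R := SymmetricAlgebra k V) 0).restrictScalars k).comp (gradeHom k V) =
      (Algebra.ofId k (SymmetricAlgebra k V)).comp SymmetricAlgebra.algebraMapInv := by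
    apply SymmetricAlgebra.algHom_ext
    ext v
    simp [gradeHom, SymmetricAlgebra.algebraMapInv_ι]
  have h := DFunLike.congr_fun this s
  simp only [AlgHom.comp_apply, AlgHom.restrictScalars_apply] at h
  rw [symProj, LinearMap.comp_apply]
  change (gradeHom k V s).coeff 0 = _
  rw [Polynomial.coeff_zero_eq_aeval_zero]
  exact h

theorem algebraMapInv_of_mem_maxIdeal {s : SymmetricAlgebra k V} (hs : s ∈ maxIdeal k V) :
    SymmetricAlgebra.algebraMapInv s = 0 := by
  have : maxIdeal k V ≤ RingHom.ker (SymmetricAlgebra.algebraMapInv (R := k) (M := V)) := by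
    rw [maxIdeal, Ideal.span_le]
    rintro _ ⟨v, rfl⟩
    exact SymmetricAlgebra.algebraMapInv_ι v
  exact this hs

theorem symProj_zero_of_mem_maxIdeal {s : SymmetricAlgebra k V} (hs : s ∈ maxIdeal k V) :
    symProj k V 0 s = 0 := by
  rw [symProj_zero_apply, algebraMapInv_of_mem_maxIdeal hs, map_zero]

theorem sub_mem_maxIdeal (s : SymmetricAlgebra k V) :
    s - algebraMap k _ (SymmetricAlgebra.algebraMapInv s) ∈ maxIdeal k V := by
  induction s using SymmetricAlgebra.induction with
  | algebraMap r => simp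
  | ι x =>
    rw [SymmetricAlgebra.algebraMapInv_ι, map_zero, sub_zero]
    exact Ideal.subset_span ⟨x, rfl⟩
  | add a b ha hb =>
    rw [map_add, map_add, add_sub_add_comm]
    exact add_mem ha hb
  | mul a b ha hb =>
    rw [map_mul, map_mul]
    have : a * b - algebraMap k _ (SymmetricAlgebra.algebraMapInv a) *
        algebraMap k _ (SymmetricAlgebra.algebraMapInv b) =
        b * (a - algebraMap k _ (SymmetricAlgebra.algebraMapInv a)) +
        algebraMap k _ (SymmetricAlgebra.algebraMapInv a) *
          (b - algebraMap k _ (SymmetricAlgebra.algebraMapInv b)) := by ring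
    rw [this]
    exact add_mem (Ideal.mul_mem_left _ _ ha) (Ideal.mul_mem_left _ _ hb)

/-- The coefficient of T in a product is a₀b₁ + a₁b₀, and both constant terms vanish on 𝔪. This is
how the quotient 𝔪/𝔪² is detected in the proof of irredundancy. -/
theorem symProj_one_of_mem_maxIdeal_sq {s : SymmetricAlgebra k V} (hs : s ∈ maxIdeal k V ^ 2) :
    symProj k V 1 s = 0 := by
  rw [pow_two] at hs
  induction hs using Submodule.mul_induction_on' with
  | mem_mul_mem a ha b hb =>
    have h1 : (gradeHom k V a).coeff 0 = 0 := symProj_zero_of_mem_maxIdeal ha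
    have h2 : (gradeHom k V b).coeff 0 = 0 := symProj_zero_of_mem_maxIdeal hb
    change (gradeHom k V (a * b)).coeff 1 = 0
    rw [map_mul, Polynomial.mul_coeff_one, h1, h2, zero_mul, mul_zero, add_zero]
  | add x _ y _ hx hy => rw [map_add, hx, hy, add_zero]

theorem ι_mem_symDeg_one (v : V) : SymmetricAlgebra.ι k V v ∈ symDeg k V 1 := by
  rw [symDeg, pow_one]
  exact ⟨v, rfl⟩

theorem ι_mem_maxIdeal (v : V) : SymmetricAlgebra.ι k V v ∈ maxIdeal k V :=
  Ideal.subset_span ⟨v, rfl⟩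

/-- In the polynomial ring on a basis of V, the coefficient of X_i recovers the i-th coordinate of a
vector. -/
theorem ι_injective : Function.Injective (SymmetricAlgebra.ι k V) := by
  let b := Module.Basis.ofVectorSpace k V
  intro x y h
  apply b.repr.injective
  ext i
  have : (MvPolynomial.lcoeff k (Finsupp.single i 1) ∘ₗ
      (SymmetricAlgebra.equivMvPolynomial b).toLinearMap ∘ₗ SymmetricAlgebra.ι k V) = b.coord i := by
    refine b.ext fun j => ?_
    classical simp [MvPolynomial.X, MvPolynomial.coeff_monomial, Finsupp.single_apply,
      Finsupp.single_left_inj]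
  have hx := DFunLike.congr_fun this x
  have hy := DFunLike.congr_fun this y
  simp only [LinearMap.comp_apply, h] at hx hy
  exact hx.symm.trans hy

theorem one_mem_symDeg : (1 : SymmetricAlgebra k V) ∈ symDeg k V 0 := by
  rw [symDeg, pow_zero]
  exact Submodule.one_le.mp le_rfl

/-- The projection of `S` onto its degree `n` part, for an integer `n`. -/
def symProjInt (k : Type u) [Field k] (V : Type u) [AddCommGroup V] [Module k V] (n : ℤ) :
    SymmetricAlgebra k V →ₗ[k] SymmetricAlgebra k V :=
  if 0 ≤ n then symProj k V n.toNat else 0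

theorem symProjInt_of_mem {n : ℤ} {m : ℕ} {s : SymmetricAlgebra k V} (hs : s ∈ symDeg k V m) :
    symProjInt k V n s = if (m : ℤ) = n then s else 0 := by
  rw [symProjInt]
  split_ifs with h1 h2 h2
  · rw [symProj_of_mem hs, if_pos (by omega)]
  · rw [symProj_of_mem hs, if_neg (by omega)]
  · omega
  · rfl

end SymmetricAlgebra

/-! ### Homogeneous components and coordinates in graded free modules. -/

section GradedModules

variable {k : Type u} [Field k] {V : Type u} [AddCommGroup V] [Module k V]

theorem GrMod.bijective_coeLinearMap (A : GrMod.{u, v} k V) :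
    Function.Bijective (DirectSum.coeLinearMap A.deg) := A.isInternal

/-- The projection of a graded module onto its homogeneous component of degree `n`. -/
def GrMod.proj (A : GrMod.{u, v} k V) (n : ℤ) : A →ₗ[k] A :=
  (A.deg n).subtype ∘ₗ DirectSum.component k ℤ (fun i => A.deg i) n ∘ₗ
    (LinearEquiv.ofBijective (DirectSum.coeLinearMap A.deg)
      A.bijective_coeLinearMap).symm.toLinearMap

variable (A : GrMod.{u, v} k V)

theorem GrMod.proj_mem (n : ℤ) (x : A) : A.proj n x ∈ A.deg n := Subtype.property _

theorem GrMod.proj_of_mem {m : ℤ} (n : ℤ) {x : A} (hx : x ∈ A.deg m) :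
    A.proj n x = if m = n then x else 0 := by
  have : (LinearEquiv.ofBijective (DirectSum.coeLinearMap A.deg)
      A.bijective_coeLinearMap).symm x =
      DirectSum.lof k ℤ (fun i => A.deg i) m ⟨x, hx⟩ := by
    rw [LinearEquiv.symm_apply_eq, LinearEquiv.ofBijective_apply, DirectSum.coeLinearMap_lof]
  rw [GrMod.proj, LinearMap.comp_apply, LinearMap.comp_apply, LinearEquiv.coe_coe, this]
  split_ifs with h
  · subst h
    rw [DirectSum.component.lof_self]
    rfl
  · rw [DirectSum.component.of, dif_neg (by exact h)]
    rfl

theorem GrMod.induction {P : A → Prop} (x : A) (mem : ∀ n, ∀ x ∈ A.deg n, P x)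
    (zero : P 0) (add : ∀ x y, P x → P y → P (x + y)) : P x := by
  have hx : x ∈ ⨆ n, A.deg n := by rw [A.isInternal.submodule_iSup_eq_top]; trivial
  exact Submodule.iSup_induction A.deg (motive := P) hx mem zero add

theorem GrHom.map_proj {A : GrMod.{u, v} k V} {B : GrMod.{u, w} k V} (φ : GrHom A B) (n : ℤ)
    (x : A) : φ.toLin (A.proj n x) = B.proj n (φ.toLin x) := by
  induction x using A.induction with
  | mem m x hx =>
    rw [A.proj_of_mem n hx, B.proj_of_mem n (φ.map_deg m x hx)]
    split_ifs <;> simp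
  | zero => simp
  | add x y hx hy => simp only [map_add, hx, hy]

theorem GrMod.smul_mem_deg {m : ℕ} {n : ℤ} {s : SymmetricAlgebra k V} (hs : s ∈ symDeg k V m)
    {x : A} (hx : x ∈ A.deg n) : s • x ∈ A.deg (n + m) := by
  induction m generalizing s with
  | zero =>
    obtain ⟨a, rfl⟩ := Submodule.mem_one.1 (by simpa [symDeg] using hs)
    simpa using Submodule.smul_mem _ a hx
  | succ m ih =>
    rw [symDeg, pow_succ'] at hs
    induction hs using Submodule.mul_induction_on' with
    | mem_mul_mem a ha b hb =>
      obtain ⟨v, rfl⟩ := ha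
      rw [mul_smul]
      have := A.smul_mem v _ _ (ih hb)
      rwa [add_assoc] at this
    | add a _ b _ ha hb => rw [add_smul]; exact add_mem ha hb

variable {A} {J : Type*} (b : Module.Basis J (SymmetricAlgebra k V) A) {e : J → ℤ}

/-- By linearity only s • b l with s homogeneous has to be checked. The consequences below are used
throughout: a coordinate of a homogeneous element is zero at generators of larger degree and a
scalar at generators of equal degree. -/
theorem GrMod.repr_proj (he : ∀ j, b j ∈ A.deg (e j)) (n : ℤ) (x : A) (j : J) :
    b.repr (A.proj n x) j = symProjInt k V (n - e j) (b.repr x j) := by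
  rw [← b.repr.symm_apply_apply x]
  induction b.repr x using Finsupp.induction_linear with
  | zero => simp
  | add x y hx hy => simp only [map_add, Finsupp.add_apply, hx, hy]
  | single l s =>
    rw [b.repr_symm_single]
    have hs : s ∈ ⨆ n, symDeg k V n := by rw [iSup_symDeg]; trivial
    induction hs using Submodule.iSup_induction' with
    | mem m s hs =>
      rw [A.proj_of_mem n (A.smul_mem_deg hs (he l))]
      by_cases hlj : l = j
      · subst hlj
        have : b.repr (s • b l) l = s := by simp
        rw [this, symProjInt_of_mem hs]
        by_cases h : (m : ℤ) = n - e l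
        · rw [if_pos h, if_pos (by omega), this]
        · rw [if_neg h, if_neg (by omega)]; simp
      · have : b.repr (s • b l) j = 0 := by simp [hlj]
        rw [this, map_zero]
        split_ifs
        · exact this
        · simp
    | zero => simp
    | add s t _ _ hs ht => simp only [add_smul, map_add, Finsupp.add_apply, hs, ht]

theorem GrMod.repr_eq (he : ∀ j, b j ∈ A.deg (e j)) {n : ℤ} {x : A} (hx : x ∈ A.deg n) (j : J) :
    b.repr x j = symProjInt k V (n - e j) (b.repr x j) := by
  rw [← A.repr_proj b he n x j, A.proj_of_mem n hx, if_pos rfl]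

theorem GrMod.repr_eq_zero (he : ∀ j, b j ∈ A.deg (e j)) {n : ℤ} {x : A} (hx : x ∈ A.deg n) (j : J)
    (hj : n < e j) : b.repr x j = 0 := by
  rw [GrMod.repr_eq b he hx, symProjInt, if_neg (by omega)]
  rfl

theorem GrMod.repr_eq_algebraMap (he : ∀ j, b j ∈ A.deg (e j)) {n : ℤ} {x : A} (hx : x ∈ A.deg n)
    (j : J) (hj : e j = n) :
    b.repr x j = algebraMap k _ (SymmetricAlgebra.algebraMapInv (b.repr x j)) := by
  rw [← symProj_zero_apply]
  conv_lhs => rw [GrMod.repr_eq b he hx, symProjInt, if_pos (by omega)]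
  simp [hj]

theorem repr_mem_of_mem_smul_top {R M : Type*} [CommRing R] [AddCommGroup M] [Module R M]
    (b : Module.Basis J R M) (I : Ideal R) {x : M} (hx : x ∈ (I • ⊤ : Submodule R M)) (j : J) :
    b.repr x j ∈ I := by
  induction hx using Submodule.smul_induction_on' with
  | smul r hr y _ =>
    rw [map_smul, Finsupp.smul_apply, smul_eq_mul]
    exact Ideal.mul_mem_right _ _ hr
  | add x _ y _ hx hy => rw [map_add]; exact add_mem hx hy

theorem basis_notMem_maxIdeal_smul {M : Type*} [AddCommGroup M] [Module (SymmetricAlgebra k V) M]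
    (b : Module.Basis J (SymmetricAlgebra k V) M) (j : J) :
    b j ∉ (maxIdeal k V • ⊤ : Submodule (SymmetricAlgebra k V) M) := fun h => by
  have := algebraMapInv_of_mem_maxIdeal (repr_mem_of_mem_smul_top b _ h j)
  simp at this

/-- Nakayama in the lowest degree: each coordinate of x is zero or a scalar lying in 𝔪, hence zero.
-/
theorem GrMod.eq_zero_of_mem_maxIdeal_smul (he : ∀ j, b j ∈ A.deg (e j)) {n : ℤ}
    (hn : ∀ j, n ≤ e j) {x : A} (hx : x ∈ A.deg n)
    (hm : x ∈ (maxIdeal k V • ⊤ : Submodule (SymmetricAlgebra k V) A)) : x = 0 := by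
  apply b.repr.injective
  ext j
  rw [map_zero, Finsupp.zero_apply]
  rcases (hn j).lt_or_eq with h | h
  · exact GrMod.repr_eq_zero b he hx j h
  · rw [GrMod.repr_eq_algebraMap b he hx j h.symm,
      algebraMapInv_of_mem_maxIdeal (repr_mem_of_mem_smul_top b _ hm j), map_zero]

end GradedModules

/-! ### The free modules S(-i) ⊗ P. -/

section FreeModules

variable {k : Type u} [Field k] {V : Type u} [AddCommGroup V] [Module k V]
  {P : Type u} [AddCommGroup P] [Module k P]

theorem symProj_rTensor_of_mem (n : ℕ) (I : Ideal (SymmetricAlgebra k V))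
    (hI : ∀ s ∈ I, symProj k V n s = 0) {y : SymmetricAlgebra k V ⊗[k] P}
    (hy : y ∈ (I • ⊤ : Submodule (SymmetricAlgebra k V) (SymmetricAlgebra k V ⊗[k] P))) :
    (symProj k V n).rTensor P y = 0 := by
  induction hy using Submodule.smul_induction_on' with
  | smul r hr y h =>
    clear h
    induction y with
    | zero => simp
    | add y z hy hz => rw [smul_add, map_add, hy, hz, add_zero]
    | tmul s p =>
      rw [TensorProduct.smul_tmul', LinearMap.rTensor_tmul, smul_eq_mul,
        hI _ (Ideal.mul_mem_right s I hr), TensorProduct.zero_tmul]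
  | add x _ y _ hx hy => rw [map_add, hx, hy, add_zero]

theorem exists_sub_mem_maxIdeal_smul (x : SymmetricAlgebra k V ⊗[k] P) : ∃ p : P,
    x - (1 : SymmetricAlgebra k V) ⊗ₜ[k] p ∈
      (maxIdeal k V • ⊤ : Submodule (SymmetricAlgebra k V) (SymmetricAlgebra k V ⊗[k] P)) := by
  induction x with
  | zero => exact ⟨0, by simp⟩
  | add x y hx hy =>
    obtain ⟨p, hp⟩ := hx
    obtain ⟨q, hq⟩ := hy
    refine ⟨p + q, ?_⟩
    rw [TensorProduct.tmul_add, add_sub_add_comm]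
    exact add_mem hp hq
  | tmul s p =>
    refine ⟨SymmetricAlgebra.algebraMapInv s • p, ?_⟩
    have h := Submodule.smul_mem_smul (sub_mem_maxIdeal s)
      (Submodule.mem_top (x := (1 : SymmetricAlgebra k V) ⊗ₜ[k] p))
    rw [TensorProduct.smul_tmul', smul_eq_mul, mul_one, TensorProduct.sub_tmul,
      Algebra.algebraMap_eq_smul_one, TensorProduct.smul_tmul] at h
    exact h

theorem tmul_mem_freeDeg (i : ℤ) (p : P) :
    (1 : SymmetricAlgebra k V) ⊗ₜ[k] p ∈ freeDeg k V P i i :=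
  Submodule.subset_span ⟨0, by simp, 1, one_mem_symDeg, p, rfl⟩

theorem freeGr_isGradedFreeIn (P : Type u) [AddCommGroup P] [Module k P] (i : ℤ) :
    (freeGr k V P i).IsGradedFreeIn i := by
  let b := Module.Basis.ofVectorSpace k P
  refine ⟨_, Algebra.TensorProduct.basis (SymmetricAlgebra k V) b, fun j => ?_⟩
  rw [Algebra.TensorProduct.basis_apply]
  exact tmul_mem_freeDeg i (b j)

theorem freeGr_isomorphic {P' : Type u} [AddCommGroup P'] [Module k P'] (φ : P ≃ₗ[k] P') (i : ℤ) :
    GrMod.Isomorphic (freeGr k V P i) (freeGr k V P' i) := by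
  refine ⟨freeGrMap φ.toLinearMap i, freeGrMap φ.symm.toLinearMap i, fun x => ?_, fun x => ?_⟩
  · change SymmetricAlgebra k V ⊗[k] P at x
    change TensorProduct.AlgebraTensorModule.map LinearMap.id φ.symm.toLinearMap
      (TensorProduct.AlgebraTensorModule.map LinearMap.id φ.toLinearMap x) = x
    induction x with
    | zero => simp
    | add x y hx hy => simp only [map_add, hx, hy]
    | tmul s p => simp
  · change SymmetricAlgebra k V ⊗[k] P' at x
    change TensorProduct.AlgebraTensorModule.map LinearMap.id φ.toLinearMap
      (TensorProduct.AlgebraTensorModule.map LinearMap.id φ.symm.toLinearMap x) = x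
    induction x with
    | zero => simp
    | add x y hx hy => simp only [map_add, hx, hy]
    | tmul s p => simp

end FreeModules

/-! ### Linear free complexes: irredundancy, and embedding into minimal resolutions. -/

section LinearComplexes

variable {k : Type u} [Field k] {V : Type u} [AddCommGroup V] [Module k V]

theorem symProj_mem (n : ℕ) (s : SymmetricAlgebra k V) : symProj k V n s ∈ symDeg k V n := by
  have hs : s ∈ ⨆ n, symDeg k V n := by rw [iSup_symDeg]; trivial
  induction hs using Submodule.iSup_induction' with
  | mem m s hs =>
    rw [symProj_of_mem hs]
    split_ifs with h
    · exact h ▸ hs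
    · exact zero_mem _
  | zero => simp
  | add s t _ _ hs ht => rw [map_add]; exact add_mem hs ht

theorem smul_one_tmul {P : Type*} [AddCommGroup P] [Module k P] (s : SymmetricAlgebra k V) (p : P) :
    s • ((1 : SymmetricAlgebra k V) ⊗ₜ[k] p) = s ⊗ₜ[k] p := by
  rw [TensorProduct.smul_tmul', smul_eq_mul, mul_one]

/-- The generators of the `i`-th term of a minimal free resolution of a module without elements
of negative degree have degree at least `i`. -/
theorem IsMinimalFreeResolution.le_degree {A : GrMod.{u, w} k V}
    {M : Submodule (SymmetricAlgebra k V) A} {G : GrComplex.{u, v} k V} {ε : GrHom (G.X 0) A}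
    (hG : IsMinimalFreeResolution M G ε) (hM : ∀ n < 0, ∀ x ∈ A.deg n, x ∈ M → x = 0)
    {J : ℕ → Type*} (b : ∀ i, Module.Basis (J i) (SymmetricAlgebra k V) (G.X i))
    (e : ∀ i, J i → ℤ) (he : ∀ i j, b i j ∈ (G.X i).deg (e i j)) (i : ℕ) (j : J i) :
    (i : ℤ) ≤ e i j := by
  induction i with
  | zero =>
    by_contra hlt
    -- A generator of negative degree has image zero in M, so it is a boundary and lies in 𝔪G_0,
    -- which a basis element cannot do.
    have h1 : ε.toLin (b 0 j) = 0 := hM (e 0 j) (by simpa using hlt) _ (ε.map_deg _ _ (he 0 j))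
      (hG.range_augmentation ▸ LinearMap.mem_range_self ε.toLin _)
    have h2 : b 0 j ∈ LinearMap.range (G.d 0).toLin := hG.exact_zero ▸ LinearMap.mem_ker.2 h1
    exact basis_notMem_maxIdeal_smul (b 0) j (hG.minimal 0 h2)
  | succ i ih =>
    by_contra hlt
    push_cast at hlt
    have h1 : (G.d i).toLin (b (i + 1) j) = 0 :=
      -- If the generator had degree at most i, its differential would lie in 𝔪G_i in a degree not
      -- above that of any generator of G_i, and so would vanish.
      GrMod.eq_zero_of_mem_maxIdeal_smul (b i) (he i) (n := e (i + 1) j)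
        (fun l => by have := ih l; omega) ((G.d i).map_deg _ _ (he (i + 1) j))
        (hG.minimal i (LinearMap.mem_range_self _ _))
    have h2 : b (i + 1) j ∈ LinearMap.range (G.d (i + 1)).toLin :=
      hG.exact i ▸ LinearMap.mem_ker.2 h1
    exact basis_notMem_maxIdeal_smul (b (i + 1)) j (hG.minimal (i + 1) h2)

theorem exists_linearMap_comp_eq {P N N' : Type*} [AddCommGroup P] [Module k P] [AddCommGroup N]
    [Module k N] [AddCommGroup N'] [Module k N'] (f : N →ₗ[k] N') (t : P →ₗ[k] N')
    (h : ∀ p, t p ∈ LinearMap.range f) : ∃ s : P →ₗ[k] N, ∀ p, f (s p) = t p := by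
  obtain ⟨g, hg⟩ := LinearMap.exists_rightInverse_of_surjective f.rangeRestrict
    f.range_rangeRestrict
  refine ⟨g ∘ₗ t.codRestrict _ h, fun p => ?_⟩
  exact congrArg Subtype.val (DFunLike.congr_fun hg (t.codRestrict _ h p))

/-- Elements of degree n have scalar coordinates supported on the generators of degree n. A k-linear
retraction r of `a`, applied to these generators and extended by zero to those of higher degree, is
therefore a graded retraction over S. -/
theorem exists_retraction {P : Type u} [AddCommGroup P] [Module k P] {A : GrMod.{u, v} k V}
    {J : Type*} (b : Module.Basis J (SymmetricAlgebra k V) A) {e : J → ℤ}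
    (he : ∀ j, b j ∈ A.deg (e j)) {n : ℤ} (hn : ∀ j, n ≤ e j) (a : P →ₗ[k] A)
    (hinj : Function.Injective a) (hdeg : ∀ p, a p ∈ A.deg n) :
    ∃ ρ : GrHom A (freeGr k V P n), ∀ p, ρ.toLin (a p) = (1 : SymmetricAlgebra k V) ⊗ₜ[k] p := by
  classical
  obtain ⟨r, hr⟩ := LinearMap.exists_leftInverse_of_injective a (LinearMap.ker_eq_bot.2 hinj)
  let c (j : J) : SymmetricAlgebra k V ⊗[k] P := if e j = n then 1 ⊗ₜ r (b j) else 0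
  refine ⟨⟨b.constr (SymmetricAlgebra k V) c, fun m x hx => ?_⟩, fun p => ?_⟩
  · rw [b.constr_apply]
    refine Submodule.sum_mem _ fun j _ => ?_
    change b.repr x j • c j ∈ freeDeg k V P n m
    by_cases hj : e j = n
    · rw [GrMod.repr_eq b he hx, symProjInt]
      split_ifs with h
      · have hc : c j = 1 ⊗ₜ r (b j) := if_pos hj
        rw [hc, smul_one_tmul]
        exact Submodule.subset_span ⟨(m - e j).toNat, by omega, _, symProj_mem _ _, _, rfl⟩
      · rw [LinearMap.zero_apply, zero_smul]
        exact zero_mem _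
    · have hc : c j = 0 := if_neg hj
      rw [hc, smul_zero]
      exact zero_mem _
  · have h1 : (1 : SymmetricAlgebra k V) ⊗ₜ[k] p =
        TensorProduct.mk k (SymmetricAlgebra k V) P 1 (r (a p)) := by
      rw [show r (a p) = p from DFunLike.congr_fun hr p, TensorProduct.mk_apply]
    change b.constr (SymmetricAlgebra k V) c (a p) = _
    rw [b.constr_apply, h1]
    conv_rhs => rw [← b.linearCombination_repr (a p), Finsupp.linearCombination_apply, Finsupp.sum,
      map_sum, map_sum]
    refine Finset.sum_congr rfl fun j _ => ?_
    dsimp only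
    by_cases hj : e j = n
    · have hc : c j = 1 ⊗ₜ r (b j) := if_pos hj
      rw [hc, GrMod.repr_eq_algebraMap b he (hdeg p) j hj, algebraMap_smul, algebraMap_smul,
        map_smul, map_smul, TensorProduct.mk_apply]
    · rw [GrMod.repr_eq_zero b he (hdeg p) j (lt_of_le_of_ne (hn j) (Ne.symm hj)), zero_smul,
        zero_smul, map_zero, map_zero]

variable [FiniteDimensional k V]

theorem sum_ι_tmul_eq_zero {P : Type*} [AddCommGroup P] [Module k P]
    (q : Fin (Module.finrank k V) → P)
    (h : ∑ j, SymmetricAlgebra.ι k V (Module.finBasis k V j) ⊗ₜ[k] q j = 0) (j) : q j = 0 := by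
  obtain ⟨g, hg⟩ := LinearMap.exists_leftInverse_of_injective (SymmetricAlgebra.ι k V)
    (LinearMap.ker_eq_bot.2 ι_injective)
  have hg' : ∀ v, g (SymmetricAlgebra.ι k V v) = v := fun v => DFunLike.congr_fun hg v
  have := congrArg ((TensorProduct.lid k P).toLinearMap ∘ₗ
    ((Module.finBasis k V).coord j ∘ₗ g).rTensor P) h
  simpa [hg', Finsupp.single_apply] using this

/-- The `E`-module `Q` is generated by `Q_0`: a linear form on `Q_{i+1}` which vanishes on
`V^* Q_i` is zero. -/
def ExtMod.IsGenerated (Q : ExtMod k V) : Prop :=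
  ∀ i (p : Module.Dual k (Q.piece (i + 1))),
    (∀ j, p ∘ₗ Q.act i ((Module.finBasis k V).coord j) = 0) → p = 0

theorem ExtMod.comp_act_eq_zero (Q : ExtMod k V) {i : ℕ} {p : Module.Dual k (Q.piece (i + 1))}
    (h : ∀ j, p ∘ₗ Q.act i ((Module.finBasis k V).coord j) = 0) (ξ : Module.Dual k V) :
    p ∘ₗ Q.act i ξ = 0 := by
  refine LinearMap.ext fun x => ?_
  rw [← (Module.finBasis k V).sum_dual_apply_smul_coord ξ, map_sum, LinearMap.comp_apply,
    LinearMap.sum_apply, map_sum]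
  refine Finset.sum_eq_zero fun j _ => ?_
  rw [map_smul, LinearMap.smul_apply, map_smul]
  exact (congrArg _ (DFunLike.congr_fun (h j) x)).trans (smul_zero _)

theorem ExtMod.generated_isGenerated (Q : ExtMod k V) : Q.generated.IsGenerated := by
  intro i p h
  have h' := Q.generated.comp_act_eq_zero h
  refine LinearMap.ext fun y => ?_
  obtain ⟨y, hy⟩ := y
  change p ⟨y, hy⟩ = 0
  refine Submodule.span_induction (p := fun y hy => p ⟨y, hy⟩ = 0) ?_ ?_ ?_ ?_ hy
  · rintro _ ⟨ξ, x, hx, rfl⟩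
    exact DFunLike.congr_fun (h' ξ) ⟨x, hx⟩
  · exact map_zero p
  · intro x y hx hy h1 h2
    refine (map_add p ⟨x, hx⟩ ⟨y, hy⟩).trans ?_
    rw [h1, h2, add_zero]
  · intro a x hx h1
    refine (map_smul p a ⟨x, hx⟩).trans ?_
    rw [h1, smul_zero]

theorem linDiff_one_tmul (Q : ExtMod k V) (i : ℕ) (p : Module.Dual k (Q.piece (i + 1))) :
    linDiff Q i (1 ⊗ₜ p) = ∑ j, SymmetricAlgebra.ι k V (Module.finBasis k V j) ⊗ₜ[k]
      (p ∘ₗ Q.act i ((Module.finBasis k V).coord j)) := by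
  simp only [linDiff_tmul, mul_one]

theorem linDiff_mem (Q : ExtMod k V) (i : ℕ)
    (x : SymmetricAlgebra k V ⊗[k] Module.Dual k (Q.piece (i + 1))) :
    linDiff Q i x ∈ (maxIdeal k V • ⊤ : Submodule (SymmetricAlgebra k V)
      (SymmetricAlgebra k V ⊗[k] Module.Dual k (Q.piece i))) := by
  induction x with
  | zero => rw [map_zero]; exact zero_mem _
  | add x y hx hy => rw [map_add]; exact add_mem hx hy
  | tmul s p =>
    rw [linDiff_tmul]
    refine Submodule.sum_mem _ fun j _ => ?_
    have := Submodule.smul_mem_smul (ι_mem_maxIdeal (k := k) (Module.finBasis k V j))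
      (Submodule.mem_top (x := s ⊗ₜ[k] (p ∘ₗ Q.act i ((Module.finBasis k V).coord j))))
    exact this

/-- Modulo 𝔪 an element of F_{i+1} is 1 ⊗ p. The degree one part of its differential is ∑ x_j ⊗ (p ∘
e_j), which determines each p ∘ e_j, and generation in degree zero then forces p = 0. -/
theorem ExtMod.IsGenerated.isIrredundant {Q : ExtMod k V} (hQ : Q.IsGenerated) :
    (linComplex Q).IsIrredundant := by
  intro i x hx
  change SymmetricAlgebra k V ⊗[k] Module.Dual k (Q.piece (i + 1)) at x
  change linDiff Q i x ∈ _ at hx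
  obtain ⟨p, hp⟩ := exists_sub_mem_maxIdeal_smul x
  -- The differential maps F_{i+1} into 𝔪F_i, hence 𝔪F_{i+1} into 𝔪²F_i.
  have h1 : linDiff Q i (x - 1 ⊗ₜ p) ∈ (maxIdeal k V ^ 2 • ⊤ : Submodule (SymmetricAlgebra k V)
      (SymmetricAlgebra k V ⊗[k] Module.Dual k (Q.piece i))) := by
    rw [pow_two, Submodule.mul_smul]
    refine Submodule.smul_induction_on hp ?_ ?_
    · intro r hr y _
      rw [map_smul]
      exact Submodule.smul_mem_smul hr (linDiff_mem Q i y)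
    · intro x y hx hy
      rw [map_add]
      exact add_mem hx hy
  have h2 : linDiff Q i (1 ⊗ₜ p) ∈ (maxIdeal k V ^ 2 • ⊤ : Submodule (SymmetricAlgebra k V)
      (SymmetricAlgebra k V ⊗[k] Module.Dual k (Q.piece i))) := by
    have := sub_mem (show linDiff Q i x ∈ _ from hx) h1
    rwa [← map_sub, sub_sub_cancel] at this
  have h3 := symProj_rTensor_of_mem 1 _ (fun s hs => symProj_one_of_mem_maxIdeal_sq hs) h2
  rw [linDiff_one_tmul, map_sum] at h3
  simp only [LinearMap.rTensor_tmul, symProj_of_mem (ι_mem_symDeg_one _), if_true] at h3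
  have hp0 : p = 0 := hQ i p fun j => sum_ι_tmul_eq_zero _ h3 j
  rw [hp0, TensorProduct.tmul_zero, sub_zero] at hp
  exact hp

theorem linComplex_isStandardLinearFree (Q : ExtMod k V) :
    (linComplex Q).IsStandardLinearFree := fun _ => freeGr_isGradedFreeIn _ _

theorem linQuotient_surjective (Q : ExtMod k V) (i : ℕ) :
    Function.Surjective ((linQuotient Q).app i).toLin := by
  have h := LinearMap.dualMap_surjective_of_injective (Q.gen i).injective_subtype
  exact TensorProduct.map_surjective (g := (LinearMap.id : SymmetricAlgebra k V →ₗ[k] _))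
    (g' := (Q.gen i).subtype.dualMap) Function.surjective_id h

/-- An irredundant quotient of `𝐋(Q^*)` kills the linear forms vanishing on the submodule of `Q`
generated by `Q_0`. -/
theorem map_eq_zero_of_comp_eq_zero {Q : ExtMod k V} {H : GrComplex.{u, w} k V}
    (r : ∀ i, SymmetricAlgebra k V ⊗[k] Module.Dual k (Q.piece i) →ₗ[SymmetricAlgebra k V] H.X i)
    (hdeg : ∀ i p, r i (1 ⊗ₜ p) ∈ (H.X i).deg i)
    (hcomm : ∀ i x, r i (linDiff Q i x) = (H.d i).toLin (r (i + 1) x))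
    (hlin : H.IsStandardLinearFree) (hirr : H.IsIrredundant)
    (i : ℕ) (p : Module.Dual k (Q.piece i)) (hp : p ∘ₗ (Q.gen i).subtype = 0) :
    r i (1 ⊗ₜ p) = 0 := by
  induction i with
  | zero =>
    have : p = 0 := LinearMap.ext fun x => DFunLike.congr_fun hp ⟨x, trivial⟩
    rw [this, TensorProduct.tmul_zero, map_zero]
  | succ i ih =>
    -- Since p vanishes on the generated submodule, each p ∘ e_j vanishes on it one step lower, and
    -- the induction hypothesis applies.
    have h0 : r i (linDiff Q i (1 ⊗ₜ p)) = 0 := by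
      rw [linDiff_one_tmul, map_sum]
      refine Finset.sum_eq_zero fun j _ => ?_
      rw [← smul_one_tmul, map_smul, ih _ (by
        ext x
        exact DFunLike.congr_fun hp ⟨_, Q.act_mem_gen i _ x.2⟩), smul_zero]
    obtain ⟨J, b, hb⟩ := hlin (i + 1)
    -- Irredundancy places the image of 1 ⊗ p in 𝔪H_{i+1}; its degree i + 1 is the degree of the
    -- generators, so it is zero.
    refine GrMod.eq_zero_of_mem_maxIdeal_smul b hb (n := ((i + 1 : ℕ) : ℤ)) (fun j => le_rfl)
      (hdeg _ _) (hirr i _ ?_)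
    rw [← hcomm, h0]
    exact zero_mem _

/-- The factorization is ρ composed with a k-linear section σ of the restriction of forms. It does
not depend on σ: the difference of two extensions of a form vanishes on the generated submodule and
is killed by ρ. -/
theorem linQuotient_isMaximalIrredundantQuotient (Q : ExtMod k V) :
    IsMaximalIrredundantQuotient (linQuotient Q) where
  isIrredundantQuotient :=
    { surjective := linQuotient_surjective Q
      linear := linComplex_isStandardLinearFree _
      irredundant := Q.generated_isGenerated.isIrredundant }
  maximal H ρ hρ := by
    have hsec (i : ℕ) : ∃ σ : Module.Dual k (Q.gen i) →ₗ[k] Module.Dual k (Q.piece i),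
        (Q.gen i).subtype.dualMap ∘ₗ σ = LinearMap.id :=
      LinearMap.exists_rightInverse_of_surjective _ (LinearMap.range_eq_top.2
        (LinearMap.dualMap_surjective_of_injective (Q.gen i).injective_subtype))
    choose σ hσ using hsec
    let r (i : ℕ) : SymmetricAlgebra k V ⊗[k] Module.Dual k (Q.piece i) →ₗ[SymmetricAlgebra k V]
      H.X i := (ρ.app i).toLin
    let q (i : ℕ) : SymmetricAlgebra k V ⊗[k] Module.Dual k (Q.piece i) →ₗ[SymmetricAlgebra k V]
      SymmetricAlgebra k V ⊗[k] Module.Dual k (Q.gen i) :=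
        TensorProduct.AlgebraTensorModule.map LinearMap.id (Q.gen i).subtype.dualMap
    let t (i : ℕ) : SymmetricAlgebra k V ⊗[k] Module.Dual k (Q.gen i) →ₗ[SymmetricAlgebra k V]
      H.X i := r i ∘ₗ TensorProduct.AlgebraTensorModule.map LinearMap.id (σ i)
    have key (i : ℕ) (x) : t i (q i x) = r i x := by
      induction x with
      | zero => simp only [map_zero]
      | add x y hx hy => simp only [map_add, hx, hy]
      | tmul s p =>
        have h1 := map_eq_zero_of_comp_eq_zero r
          (fun i p => (ρ.app i).map_deg _ _ (tmul_mem_freeDeg _ p)) ρ.comm hρ.linear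
          hρ.irredundant i (σ i ((Q.gen i).subtype.dualMap p) - p) (by
            have h2 := DFunLike.congr_fun (hσ i) ((Q.gen i).subtype.dualMap p)
            exact (map_sub (Q.gen i).subtype.dualMap _ _).trans (sub_eq_zero.2 h2))
        change r i (s ⊗ₜ[k] σ i ((Q.gen i).subtype.dualMap p)) = _
        rw [← sub_eq_zero, ← map_sub, ← TensorProduct.tmul_sub, ← smul_one_tmul, map_smul, h1,
          smul_zero]
    let τ (i : ℕ) : GrHom ((linComplex Q.generated).X i) (H.X i) :=
      { toLin := t i
        map_deg := fun n x hx => (ρ.app i).map_deg n _ ((freeGrMap (V := V) (σ i) i).map_deg n x hx) }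
    refine ⟨⟨τ, fun i x => ?_⟩, key⟩
    -- Compatibility with the differentials is inherited from ρ because the quotient map is
    -- surjective.
    obtain ⟨y, rfl⟩ := linQuotient_surjective Q (i + 1) x
    refine Eq.trans ?_ ((ρ.comm i y).trans (congrArg _ (key (i + 1) y).symm))
    refine Eq.trans (congrArg _ ((linQuotient Q).comm i y).symm) ?_
    exact key i _

/-- At generators of degree n the coordinates of the g j are scalars, so each coordinate of the
relation is a linear relation among the basis vectors of V. This replaces independence of the x_j
over a free module generated in a single degree. -/
theorem sum_ι_smul_eq_zero {A : GrMod.{u, v} k V} {J : Type*}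
    (b : Module.Basis J (SymmetricAlgebra k V) A) {e : J → ℤ} (he : ∀ j, b j ∈ A.deg (e j)) {n : ℤ}
    (hn : ∀ j, n ≤ e j) (g : Fin (Module.finrank k V) → A) (hg : ∀ j, g j ∈ A.deg n)
    (h : ∑ j, SymmetricAlgebra.ι k V (Module.finBasis k V j) • g j = 0) (j) : g j = 0 := by
  apply b.repr.injective
  ext l
  rw [map_zero, Finsupp.zero_apply]
  rcases (hn l).lt_or_eq with h' | h'
  · exact GrMod.repr_eq_zero b he (hg j) l h'
  · have h1 := DFunLike.congr_fun (congrArg b.repr h) l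
    simp only [map_sum, map_smul, Finsupp.coe_finsetSum, Finset.sum_apply, Finsupp.smul_apply,
      map_zero, Finsupp.zero_apply, smul_eq_mul] at h1
    have h2 : SymmetricAlgebra.ι k V (∑ j, SymmetricAlgebra.algebraMapInv (b.repr (g j) l) •
        Module.finBasis k V j) = 0 := by
      rw [map_sum, ← h1]
      refine Finset.sum_congr rfl fun i _ => ?_
      rw [map_smul, GrMod.repr_eq_algebraMap b he (hg i) l h'.symm, Algebra.smul_def, mul_comm,
        SymmetricAlgebra.algebraMap_leftInverse]
    rw [← map_zero (SymmetricAlgebra.ι k V)] at h2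
    have h3 := Fintype.linearIndependent_iff.1 (Module.finBasis k V).linearIndependent _
      (ι_injective h2) j
    rw [GrMod.repr_eq_algebraMap b he (hg j) l h'.symm, h3, map_zero]

/-- The linear free complex of an `E`-module generated in degree zero is a degreewise summand of
the minimal free resolution of a module whose degree zero part contains its generators. -/
theorem ExtMod.IsGenerated.isDegreewiseSummand {Q : ExtMod k V} (hQ : Q.IsGenerated)
    {A : GrMod.{u, w} k V} {M : Submodule (SymmetricAlgebra k V) A} {G : GrComplex.{u, v} k V}
    {ε : GrHom (G.X 0) A} (hG : IsMinimalFreeResolution M G ε)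
    (hM : ∀ n < 0, ∀ x ∈ A.deg n, x ∈ M → x = 0) (φ : Module.Dual k (Q.piece 0) →ₗ[k] A)
    (hinj : Function.Injective φ) (hdeg : ∀ p, φ p ∈ A.deg 0) (hmem : ∀ p, φ p ∈ M)
    (hφ : ∀ p : Module.Dual k (Q.piece 1), ∑ j, SymmetricAlgebra.ι k V (Module.finBasis k V j) •
      φ (p ∘ₗ Q.act 0 ((Module.finBasis k V).coord j)) = 0) :
    IsDegreewiseSummand (linComplex Q) G := by
  choose J b e he using hG.free
  have hle := hG.le_degree hM b e he
  let α (i : ℕ) (a : Module.Dual k (Q.piece i) →ₗ[k] G.X i) :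
      SymmetricAlgebra k V ⊗[k] Module.Dual k (Q.piece i) →ₗ[SymmetricAlgebra k V] G.X i :=
    a.liftBaseChange (SymmetricAlgebra k V)
  have hα (i a s p) : α i a (s ⊗ₜ p) = s • a p := by simp [α]
  have hα1 (i a p) : α i a (1 ⊗ₜ p) = a p := by simp [α]
  -- Inductive invariant: the generators go to degree i, injectively, and the images of the
  -- differentials of the next generators are boundaries, so the next lift exists.
  let P (i : ℕ) (a : Module.Dual k (Q.piece i) →ₗ[k] G.X i) : Prop :=
    (∀ p, a p ∈ (G.X i).deg i) ∧ Function.Injective a ∧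
      ∀ q : Module.Dual k (Q.piece (i + 1)), ∃ y, (G.d i).toLin y = α i a (linDiff Q i (1 ⊗ₜ q))
  have hdegα (i) (a : Module.Dual k (Q.piece i) →ₗ[k] G.X i) (ha : ∀ p, a p ∈ (G.X i).deg i) (q : Module.Dual k (Q.piece (i + 1))) :
      α i a (linDiff Q i (1 ⊗ₜ q)) ∈ (G.X i).deg ((i + 1 : ℕ) : ℤ) := by
    rw [linDiff_one_tmul, map_sum]
    refine Submodule.sum_mem _ fun j _ => ?_
    rw [← smul_one_tmul, map_smul, hα1]
    push_cast
    exact (G.X i).smul_mem _ _ _ (ha _)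
  have hinjα (i) (a : Module.Dual k (Q.piece i) →ₗ[k] G.X i) (ha : ∀ p, a p ∈ (G.X i).deg i) (hai : Function.Injective a)
      (q : Module.Dual k (Q.piece (i + 1))) (h : α i a (linDiff Q i (1 ⊗ₜ q)) = 0) : q = 0 := by
    rw [linDiff_one_tmul, map_sum] at h
    simp only [hα] at h
    refine hQ i q fun j => ?_
    have := sum_ι_smul_eq_zero (b i) (he i) (hle i) _ (fun j => ha _) h j
    exact hai (this.trans (map_zero a).symm)
  have hbase : ∃ a, P 0 a := by
    obtain ⟨a, ha⟩ := exists_linearMap_comp_eq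
      ((ε.toLin.restrictScalars k) ∘ₗ ((G.X 0).deg 0).subtype) φ (fun p => by
        obtain ⟨y, hy⟩ : φ p ∈ LinearMap.range ε.toLin := hG.range_augmentation ▸ hmem p
        -- A preimage need not be homogeneous; its component of the right degree is again a preimage
        -- because ε is graded.
        refine ⟨⟨(G.X 0).proj 0 y, (G.X 0).proj_mem 0 y⟩, ?_⟩
        refine (ε.map_proj 0 y).trans ?_
        rw [hy, A.proj_of_mem 0 (hdeg p), if_pos rfl])
    let a' := ((G.X 0).deg 0).subtype ∘ₗ a
    have ha' (p) : ε.toLin (a' p) = φ p := ha p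
    refine ⟨a', fun p => (a p).2, fun p q h => hinj ?_, fun q => ?_⟩
    · rw [← ha', ← ha', h]
    · have : α 0 a' (linDiff Q 0 (1 ⊗ₜ q)) ∈ LinearMap.ker ε.toLin := by
        rw [LinearMap.mem_ker, ← hφ q, linDiff_one_tmul, map_sum, map_sum]
        refine Finset.sum_congr rfl fun j _ => ?_
        rw [← smul_one_tmul, map_smul, hα1, map_smul, ha']
      rw [← hG.exact_zero] at this
      exact this
  have hstep (i : ℕ) (a : {a // P i a}) : ∃ a' : {a // P (i + 1) a}, ∀ q,
      (G.d i).toLin (a'.1 q) = α i a.1 (linDiff Q i (1 ⊗ₜ q)) := by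
    obtain ⟨a, ha1, ha2, ha3⟩ := a
    obtain ⟨c, hc⟩ := exists_linearMap_comp_eq
      (((G.d i).toLin.restrictScalars k) ∘ₗ ((G.X (i + 1)).deg ((i + 1 : ℕ) : ℤ)).subtype)
      (((α i a ∘ₗ linDiff Q i).restrictScalars k) ∘ₗ
        TensorProduct.mk k (SymmetricAlgebra k V) (Module.Dual k (Q.piece (i + 1))) 1) (fun q => by
        obtain ⟨y, hy⟩ := ha3 q
        refine ⟨⟨(G.X (i + 1)).proj _ y, (G.X (i + 1)).proj_mem _ y⟩, ?_⟩
        refine ((G.d i).map_proj _ y).trans ?_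
        rw [hy, (G.X i).proj_of_mem _ (hdegα i a ha1 q), if_pos rfl]
        rfl)
    let a' := ((G.X (i + 1)).deg ((i + 1 : ℕ) : ℤ)).subtype ∘ₗ c
    have ha' (q) : (G.d i).toLin (a' q) = α i a (linDiff Q i (1 ⊗ₜ q)) := hc q
    have hcomm (x) : (G.d i).toLin (α (i + 1) a' x) = α i a (linDiff Q i x) := by
      induction x with
      | zero => simp only [map_zero]
      | add x y hx hy => simp only [map_add, hx, hy]
      | tmul s p => rw [← smul_one_tmul, map_smul, map_smul, map_smul, map_smul, hα1, ha']
    refine ⟨⟨a', fun p => (c p).2, ?_, fun q => ?_⟩, ha'⟩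
    · rw [← LinearMap.ker_eq_bot, LinearMap.ker_eq_bot']
      intro q hq
      -- If the lift of q vanishes, so does the image of its differential, and irredundancy gives q
      -- = 0.
      refine hinjα i a ha1 ha2 q ?_
      rw [← ha', hq, map_zero]
    · have : α (i + 1) a' (linDiff Q (i + 1) (1 ⊗ₜ q)) ∈ LinearMap.ker (G.d i).toLin := by
        rw [LinearMap.mem_ker, hcomm, linDiff_linDiff, map_zero]
      rw [← hG.exact i] at this
      exact this
  choose next hnext using hstep
  let s (i : ℕ) : {a // P i a} := Nat.rec ⟨hbase.choose, hbase.choose_spec⟩ (fun i a => next i a) i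
  have hs (i : ℕ) (q) : (G.d i).toLin ((s (i + 1)).1 q) = α i (s i).1 (linDiff Q i (1 ⊗ₜ q)) :=
    hnext i (s i) q
  have hcomm (i) (x) : α i (s i).1 (linDiff Q i x) = (G.d i).toLin (α (i + 1) (s (i + 1)).1 x) := by
    induction x with
    | zero => simp only [map_zero]
    | add x y hx hy => simp only [map_add, hx, hy]
    | tmul t p => rw [← smul_one_tmul, map_smul, map_smul, map_smul, map_smul, hα1, hs]
  have hgr (i : ℕ) (n : ℤ) (x) (hx : x ∈ freeDeg k V (Module.Dual k (Q.piece i)) i n) :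
      α i (s i).1 x ∈ (G.X i).deg n := by
    induction hx using Submodule.span_induction with
    | mem x hx =>
      obtain ⟨m, rfl, t, ht, p, rfl⟩ := hx
      rw [hα, add_comm]
      exact (G.X i).smul_mem_deg ht ((s i).2.1 p)
    | zero => rw [map_zero]; exact zero_mem _
    | add x y _ _ hx hy => rw [map_add]; exact add_mem hx hy
    | smul a x _ hx => rw [LinearMap.map_smul_of_tower]; exact Submodule.smul_mem _ _ hx
  refine ⟨⟨fun i => ⟨α i (s i).1, hgr i⟩, hcomm⟩, fun i => ?_⟩
  obtain ⟨ρ, hρ⟩ := exists_retraction (b i) (he i) (hle i) (s i).1 (s i).2.2.1 (s i).2.1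
  refine ⟨ρ, fun x => ?_⟩
  change SymmetricAlgebra k V ⊗[k] Module.Dual k (Q.piece i) at x
  change ρ.toLin (α i (s i).1 x) = x
  induction x with
  | zero => simp only [map_zero]
  | add x y hx hy => simp only [map_add, hx, hy]
  | tmul t p => rw [← smul_one_tmul, map_smul, map_smul, hα1, hρ]

end LinearComplexes

/-! ### Polynomials with coefficients in a vector space -/

section PolynomialCoefficients

variable {k : Type*} [Field k] {n : ℕ} {E : Type*} [AddCommGroup E] [Module k E]

/-- The endomorphism of a polynomial ring which sets the variables `X l`, `l ≥ j`, to zero. -/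
def truncVars (k : Type*) [Field k] (n j : ℕ) :
    MvPolynomial (Fin n) k →ₐ[k] MvPolynomial (Fin n) k :=
  MvPolynomial.aeval fun l => if l.1 < j then MvPolynomial.X l else 0

theorem truncVars_X (j : ℕ) (l : Fin n) : truncVars k n j (MvPolynomial.X l) =
    if l.1 < j then MvPolynomial.X l else 0 := by
  rw [truncVars, MvPolynomial.aeval_X]

theorem truncVars_truncVars {i j : ℕ} (h : i ≤ j) (p : MvPolynomial (Fin n) k) :
    truncVars k n i (truncVars k n j p) = truncVars k n i p := by
  have : (truncVars k n i).comp (truncVars k n j) = truncVars k n i := by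
    refine MvPolynomial.algHom_ext fun l => ?_
    rw [AlgHom.comp_apply, truncVars_X, truncVars_X]
    by_cases h1 : l.1 < j
    · rw [if_pos h1, truncVars_X]
    · rw [if_neg h1, if_neg (by omega), map_zero]
  exact DFunLike.congr_fun this p

theorem truncVars_self (p : MvPolynomial (Fin n) k) : truncVars k n n p = p := by
  have : truncVars k n n = AlgHom.id k _ := by
    refine MvPolynomial.algHom_ext fun l => ?_
    rw [truncVars_X, if_pos l.2]
    rfl
  rw [this, AlgHom.id_apply]

theorem truncVars_zero (p : MvPolynomial (Fin n) k) :
    truncVars k n 0 p = MvPolynomial.homogeneousComponent 0 p := by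
  rw [MvPolynomial.homogeneousComponent_zero, ← MvPolynomial.constantCoeff_eq]
  have : truncVars k n 0 = (MvPolynomial.aeval fun _ => 0) := by
    simp [truncVars]
  rw [this, MvPolynomial.aeval_zero']
  rfl

/-- Restoring the variable X j changes a truncated polynomial only by a multiple of X j. This is
what allows induction on the number of variables. -/
theorem exists_truncVars_succ (j : Fin n) (p : MvPolynomial (Fin n) k) :
    ∃ q, truncVars k n (j + 1) p = MvPolynomial.X j * q + truncVars k n j p := by
  induction p using MvPolynomial.induction_on with
  | C a => exact ⟨0, by simp [truncVars]⟩
  | add p q hp hq =>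
    obtain ⟨a, ha⟩ := hp
    obtain ⟨b, hb⟩ := hq
    exact ⟨a + b, by rw [map_add, map_add, ha, hb]; ring⟩
  | mul_X p l hp =>
    obtain ⟨a, ha⟩ := hp
    rw [map_mul, map_mul, ha, truncVars_X, truncVars_X]
    rcases lt_trichotomy l.1 j.1 with h | h | h
    · rw [if_pos (by omega), if_pos h]
      exact ⟨a * MvPolynomial.X l, by ring⟩
    · rw [if_pos (by omega), if_neg (by omega), Fin.ext h]
      exact ⟨MvPolynomial.X j * a + truncVars k n j p, by ring⟩
    · rw [if_neg (by omega), if_neg (by omega)]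
      exact ⟨0, by ring⟩

theorem truncVars_homogeneousComponent (j m : ℕ) (p : MvPolynomial (Fin n) k) :
    truncVars k n j (MvPolynomial.homogeneousComponent m p) =
      MvPolynomial.homogeneousComponent m (truncVars k n j p) := by
  have key (i : ℕ) (q : MvPolynomial (Fin n) k) (hq : q.IsHomogeneous i) :
      (truncVars k n j q).IsHomogeneous i := by
    have := hq.aeval (S := k) (fun l : Fin n => if l.1 < j then MvPolynomial.X l else 0) (n := 1)
      (fun l => by
        split_ifs
        · exact MvPolynomial.isHomogeneous_X _ _
        · exact MvPolynomial.isHomogeneous_zero _ _ _)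
    rwa [one_mul] at this
  conv_rhs => rw [← MvPolynomial.sum_homogeneousComponent p, map_sum, map_sum]
  have h2 (i : ℕ) : MvPolynomial.homogeneousComponent m
      (truncVars k n j (MvPolynomial.homogeneousComponent i p)) =
      if i = m then truncVars k n j (MvPolynomial.homogeneousComponent i p) else 0 := by
    rw [MvPolynomial.homogeneousComponent_of_mem
      (key i _ (MvPolynomial.homogeneousComponent_isHomogeneous i p))]
    simp only [eq_comm]
  simp only [h2]
  rw [Finset.sum_ite_eq']
  split_ifs with h
  · rfl
  · rw [MvPolynomial.homogeneousComponent_eq_zero, map_zero]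
    simpa using h

theorem homogeneousComponent_succ_X_mul (m : ℕ) (l : Fin n) (p : MvPolynomial (Fin n) k) :
    MvPolynomial.homogeneousComponent (m + 1) (MvPolynomial.X l * p) =
      MvPolynomial.X l * MvPolynomial.homogeneousComponent m p := by
  conv_lhs => rw [← MvPolynomial.sum_homogeneousComponent p, Finset.mul_sum, map_sum]
  have h2 (i : ℕ) : MvPolynomial.homogeneousComponent (m + 1)
      (MvPolynomial.X l * MvPolynomial.homogeneousComponent i p) =
      if i = m then MvPolynomial.X l * MvPolynomial.homogeneousComponent i p else 0 := by
    rw [MvPolynomial.homogeneousComponent_of_mem (n := 1 + i)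
      ((MvPolynomial.isHomogeneous_X k l).mul (MvPolynomial.homogeneousComponent_isHomogeneous i p))]
    by_cases h : i = m
    · rw [if_pos h, if_pos (by omega)]
    · rw [if_neg h, if_neg (by omega)]
  simp only [h2]
  rw [Finset.sum_ite_eq']
  split_ifs with h
  · rfl
  · rw [MvPolynomial.homogeneousComponent_eq_zero, mul_zero]
    simpa using h

/-- Setting the variables `X l`, `l ≥ j`, to zero in a polynomial with coefficients in `E`. -/
def trunc (k : Type*) [Field k] (n : ℕ) (E : Type*) [AddCommGroup E] [Module k E] (j : ℕ) :
    MvPolynomial (Fin n) k ⊗[k] E →ₗ[k] MvPolynomial (Fin n) k ⊗[k] E :=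
  (truncVars k n j).toLinearMap.rTensor E

/-- The homogeneous component of degree `m` of a polynomial with coefficients in `E`. -/
def homComp (k : Type*) [Field k] (n : ℕ) (E : Type*) [AddCommGroup E] [Module k E] (m : ℕ) :
    MvPolynomial (Fin n) k ⊗[k] E →ₗ[k] MvPolynomial (Fin n) k ⊗[k] E :=
  (MvPolynomial.homogeneousComponent m).rTensor E

theorem trunc_tmul (j : ℕ) (a : MvPolynomial (Fin n) k) (x : E) :
    trunc k n E j (a ⊗ₜ x) = truncVars k n j a ⊗ₜ x := rfl

theorem homComp_tmul (m : ℕ) (a : MvPolynomial (Fin n) k) (x : E) :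
    homComp k n E m (a ⊗ₜ x) = MvPolynomial.homogeneousComponent m a ⊗ₜ x := rfl

theorem trunc_smul (j : ℕ) (a : MvPolynomial (Fin n) k) (z : MvPolynomial (Fin n) k ⊗[k] E) :
    trunc k n E j (a • z) = truncVars k n j a • trunc k n E j z := by
  induction z with
  | zero => simp
  | add x y hx hy => simp only [smul_add, map_add, hx, hy]
  | tmul b x => simp only [TensorProduct.smul_tmul', smul_eq_mul, trunc_tmul, map_mul]

theorem trunc_trunc {i j : ℕ} (h : i ≤ j) (z : MvPolynomial (Fin n) k ⊗[k] E) :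
    trunc k n E i (trunc k n E j z) = trunc k n E i z := by
  induction z with
  | zero => simp
  | add x y hx hy => simp only [map_add, hx, hy]
  | tmul b x => simp only [trunc_tmul, truncVars_truncVars h]

theorem trunc_self (z : MvPolynomial (Fin n) k ⊗[k] E) : trunc k n E n z = z := by
  induction z with
  | zero => simp
  | add x y hx hy => simp only [map_add, hx, hy]
  | tmul b x => simp only [trunc_tmul, truncVars_self]

theorem trunc_zero (z : MvPolynomial (Fin n) k ⊗[k] E) : trunc k n E 0 z = homComp k n E 0 z := by
  induction z with
  | zero => simp
  | add x y hx hy => simp only [map_add, hx, hy]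
  | tmul b x => simp only [trunc_tmul, homComp_tmul, truncVars_zero]

theorem trunc_homComp (j m : ℕ) (z : MvPolynomial (Fin n) k ⊗[k] E) :
    trunc k n E j (homComp k n E m z) = homComp k n E m (trunc k n E j z) := by
  induction z with
  | zero => simp
  | add x y hx hy => simp only [map_add, hx, hy]
  | tmul b x => simp only [trunc_tmul, homComp_tmul, truncVars_homogeneousComponent]

theorem homComp_succ_X_smul (m : ℕ) (l : Fin n) (z : MvPolynomial (Fin n) k ⊗[k] E) :
    homComp k n E (m + 1) ((MvPolynomial.X l : MvPolynomial (Fin n) k) • z) =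
      (MvPolynomial.X l : MvPolynomial (Fin n) k) • homComp k n E m z := by
  induction z with
  | zero => simp
  | add x y hx hy => simp only [smul_add, map_add, hx, hy]
  | tmul b x =>
    simp only [TensorProduct.smul_tmul', smul_eq_mul, homComp_tmul, homogeneousComponent_succ_X_mul]

/-- The kernel of `trunc` consists of the polynomials with coefficients in the ideal of the X l, l ≥
j, and a map linear over the polynomial ring preserves it. Congruences can thus be expressed by
`trunc` without passing to a quotient ring. -/
theorem trunc_map_eq_zero {j : ℕ} (h : MvPolynomial (Fin n) k ⊗[k] E →ₗ[MvPolynomial (Fin n) k]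
    MvPolynomial (Fin n) k ⊗[k] E) {z : MvPolynomial (Fin n) k ⊗[k] E} (hz : trunc k n E j z = 0) :
    trunc k n E j (h z) = 0 := by
  have key (y : MvPolynomial (Fin n) k ⊗[k] E) : trunc k n E j (h y) =
      trunc k n E j (h (trunc k n E j y)) := by
    induction y with
    | zero => simp
    | add x y hx hy => rw [map_add, map_add, hx, hy, ← map_add, ← map_add, ← map_add]
    | tmul a x =>
      have h1 (b : MvPolynomial (Fin n) k) : b ⊗ₜ[k] x = b • ((1 : MvPolynomial (Fin n) k) ⊗ₜ[k] x) := by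
        rw [TensorProduct.smul_tmul', smul_eq_mul, mul_one]
      rw [trunc_tmul, h1 a, h1 (truncVars k n j a), h.map_smul, h.map_smul, trunc_smul, trunc_smul,
        truncVars_truncVars le_rfl]
  rw [key, hz, map_zero, map_zero]

/-- X j survives the truncation at j + 1, and multiplication by it is injective on the free module.
-/
theorem eq_zero_of_trunc_X_smul {j : Fin n} {z : MvPolynomial (Fin n) k ⊗[k] E}
    (hz : trunc k n E (j + 1) ((MvPolynomial.X j : MvPolynomial (Fin n) k) • z) = 0) :
    trunc k n E (j + 1) z = 0 := by
  rw [trunc_smul, truncVars_X, if_pos (by omega)] at hz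
  exact (smul_eq_zero.1 hz).resolve_left (MvPolynomial.X_ne_zero j)

theorem exists_trunc_succ {j : Fin n} {z : MvPolynomial (Fin n) k ⊗[k] E}
    (hz : trunc k n E j z = 0) :
    ∃ g, trunc k n E (j + 1) (z - (MvPolynomial.X j : MvPolynomial (Fin n) k) • g) = 0 := by
  have key (y : MvPolynomial (Fin n) k ⊗[k] E) : ∃ g, trunc k n E (j + 1) y =
      (MvPolynomial.X j : MvPolynomial (Fin n) k) • g + trunc k n E j y := by
    induction y with
    | zero => exact ⟨0, by simp⟩
    | add x y hx hy =>
      obtain ⟨a, ha⟩ := hx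
      obtain ⟨b, hb⟩ := hy
      exact ⟨a + b, by rw [map_add, map_add, ha, hb, smul_add]; abel⟩
    | tmul a x =>
      obtain ⟨q, hq⟩ := exists_truncVars_succ j a
      exact ⟨q ⊗ₜ x, by rw [trunc_tmul, hq, TensorProduct.add_tmul, TensorProduct.smul_tmul']; rfl⟩
  obtain ⟨g, hg⟩ := key z
  rw [hz, add_zero] at hg
  refine ⟨g, ?_⟩
  rw [map_sub, ← trunc_trunc le_rfl z, hg, sub_self]

theorem exists_homComp_zero_eq (z : MvPolynomial (Fin n) k ⊗[k] E) :
    ∃ x : E, homComp k n E 0 z = 1 ⊗ₜ x := by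
  induction z with
  | zero => exact ⟨0, by simp⟩
  | add x y hx hy =>
    obtain ⟨a, ha⟩ := hx
    obtain ⟨b, hb⟩ := hy
    exact ⟨a + b, by rw [map_add, ha, hb, TensorProduct.tmul_add]⟩
  | tmul a x =>
    refine ⟨MvPolynomial.coeff 0 a • x, ?_⟩
    rw [homComp_tmul, MvPolynomial.homogeneousComponent_zero, ← TensorProduct.smul_tmul,
      MvPolynomial.C_eq_smul_one]

/-- The operator `∑ X l ⊗ θ l` on polynomials with coefficients in `E`. -/
def linOp (θ : Fin n → Module.End k E) :
    Module.End (MvPolynomial (Fin n) k) (MvPolynomial (Fin n) k ⊗[k] E) :=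
  ∑ l, TensorProduct.AlgebraTensorModule.map
    (LinearMap.lsmul (MvPolynomial (Fin n) k) (MvPolynomial (Fin n) k) (MvPolynomial.X l)) (θ l)

theorem linOp_tmul (θ : Fin n → Module.End k E) (a : MvPolynomial (Fin n) k) (x : E) :
    linOp θ (a ⊗ₜ x) = ∑ l, (MvPolynomial.X l * a) ⊗ₜ θ l x := by
  simp [linOp, LinearMap.sum_apply]

theorem homComp_succ_linOp (θ : Fin n → Module.End k E) (m : ℕ)
    (z : MvPolynomial (Fin n) k ⊗[k] E) :
    homComp k n E (m + 1) (linOp θ z) = linOp θ (homComp k n E m z) := by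
  induction z with
  | zero => simp
  | add x y hx hy => simp only [map_add, hx, hy]
  | tmul a x => simp only [linOp_tmul, homComp_tmul, map_sum, homogeneousComponent_succ_X_mul]

end PolynomialCoefficients

/-! ### Products of anticommuting elements -/

section Anticommuting

variable {R : Type*} [Ring R]

theorem mul_list_prod_of_anticomm (x : R) (l : List R) (h : ∀ y ∈ l, x * y = -(y * x)) :
    x * l.prod = (-1) ^ l.length * (l.prod * x) := by
  induction l with
  | nil => simp
  | cons a l ih =>
    rw [List.prod_cons, ← mul_assoc, h a (by simp), neg_mul, mul_assoc,
      ih fun y hy => h y (by simp [hy]), List.length_cons, pow_succ]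
    have : a * ((-1) ^ l.length * (l.prod * x)) = (-1) ^ l.length * (a * (l.prod * x)) := by
      rw [← mul_assoc, ((Commute.one_right a).neg_right.pow_right l.length).eq, mul_assoc]
    rw [this, mul_neg_one, neg_mul, mul_assoc]

theorem list_prod_mul_of_anticomm (x : R) (l : List R) (h : ∀ y ∈ l, x * y = -(y * x)) :
    l.prod * x = (-1) ^ l.length * (x * l.prod) := by
  rw [mul_list_prod_of_anticomm x l h, ← mul_assoc, ← pow_add, ← two_mul, pow_mul,
    neg_one_sq, one_pow, one_mul]

variable {J : Type*} {ι e : J → R}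

theorem list_map_prod_mul_eq_zero (hsq : ∀ i, ι i * ι i = 0)
    (hanti : ∀ i j, ι i * ι j = -(ι j * ι i)) {l : List J} {i : J} (hi : i ∈ l) :
    (l.map ι).prod * ι i = 0 := by
  induction l with
  | nil => simp at hi
  | cons a l ih =>
    rw [List.map_cons, List.prod_cons, mul_assoc]
    by_cases h : i ∈ l
    · rw [ih h, mul_zero]
    · obtain rfl : i = a := by simpa [h] using hi
      rw [list_prod_mul_of_anticomm (ι i) _ (by simpa using fun j _ => hanti i j), ← mul_assoc,
        ((Commute.one_right (ι i)).neg_right.pow_right _).eq, mul_assoc, ← mul_assoc (ι i), hsq,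
        zero_mul, mul_zero]

/-- Only pairs with distinct indices need to be interchanged, so the factors ι move to the right at
the cost of a sign. -/
theorem list_prod_mul_pairs [DecidableEq J] (hei : ∀ i j, i ≠ j → ι i * e j = -(e j * ι i))
    {l : List J} (hl : l.Nodup) :
    ∃ r : R, (l.map fun i => e i * ι i).prod = r * (l.map ι).prod := by
  suffices ∃ m : ℕ, (l.map fun i => e i * ι i).prod =
      (-1) ^ m * ((l.map e).prod * (l.map ι).prod) by
    obtain ⟨m, hm⟩ := this
    exact ⟨_, hm.trans (mul_assoc _ _ _).symm⟩
  induction l with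
  | nil => exact ⟨0, by simp⟩
  | cons a l ih =>
    obtain ⟨m, hm⟩ := ih hl.of_cons
    refine ⟨m + l.length, ?_⟩
    have h1 := mul_list_prod_of_anticomm (ι a) (l.map e) (by
      simpa using fun j hj => hei a j (fun h => (List.nodup_cons.1 hl).1 (h ▸ hj)))
    have hc (x : R) (j : ℕ) : x * (-1) ^ j = (-1) ^ j * x :=
      ((Commute.one_right x).neg_right.pow_right j).eq
    rw [List.map_cons, List.prod_cons, hm, List.map_cons, List.prod_cons, List.map_cons,
      List.prod_cons, ← mul_assoc, hc, mul_assoc, mul_assoc, ← mul_assoc (ι a), h1,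
      List.length_map, mul_assoc ((-1) ^ l.length), ← mul_assoc (e a), hc, pow_add]
    simp only [mul_assoc]

end Anticommuting

/-! ### The complex resolving the maximal minors -/

section MinorComplex

variable {k : Type*} [Field k] {n : ℕ} {E : Type*} [AddCommGroup E] [Module k E] {r : ℕ}

/-- The differential `(∂c)(a) = ∑ ι_i c(a + ε_i)`. -/
def minorDiff (ι : Fin r → Module.End (MvPolynomial (Fin n) k) (MvPolynomial (Fin n) k ⊗[k] E)) (c : (Fin r → ℕ) → MvPolynomial (Fin n) k ⊗[k] E) (a : Fin r → ℕ) : MvPolynomial (Fin n) k ⊗[k] E :=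
  ∑ i, ι i (c (a + Pi.single i 1))

/-- The product of the operators `ι_i`. -/
def minorAug (ι : Fin r → Module.End (MvPolynomial (Fin n) k) (MvPolynomial (Fin n) k ⊗[k] E)) : Module.End (MvPolynomial (Fin n) k) (MvPolynomial (Fin n) k ⊗[k] E) := ((List.finRange r).map ι).prod

variable (ι : Fin r → Module.End (MvPolynomial (Fin n) k) (MvPolynomial (Fin n) k ⊗[k] E))

theorem minorDiff_sub (c c' : (Fin r → ℕ) → MvPolynomial (Fin n) k ⊗[k] E) :
    minorDiff ι (c - c') = minorDiff ι c - minorDiff ι c' := by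
  funext a
  simp [minorDiff, Finset.sum_sub_distrib]

theorem minorDiff_add (c c' : (Fin r → ℕ) → MvPolynomial (Fin n) k ⊗[k] E) :
    minorDiff ι (c + c') = minorDiff ι c + minorDiff ι c' := by
  funext a
  simp [minorDiff, Finset.sum_add_distrib]

theorem minorDiff_smul (p : MvPolynomial (Fin n) k) (c : (Fin r → ℕ) → MvPolynomial (Fin n) k ⊗[k] E) :
    minorDiff ι (p • c) = p • minorDiff ι c := by
  funext a
  simp [minorDiff, Finset.smul_sum]

theorem trunc_minorDiff {j : ℕ} {c : (Fin r → ℕ) → MvPolynomial (Fin n) k ⊗[k] E} (hc : ∀ a, trunc k n E j (c a) = 0)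
    (a : Fin r → ℕ) : trunc k n E j (minorDiff ι c a) = 0 := by
  rw [minorDiff, map_sum]
  exact Finset.sum_eq_zero fun i _ => trunc_map_eq_zero _ (hc _)

variable {ι}

/-- The terms (i, j) and (j, i) cancel by anticommutation; the diagonal terms vanish separately,
which matters in characteristic 2. -/
theorem minorDiff_minorDiff (hsq : ∀ i, ι i * ι i = 0) (hanti : ∀ i j, ι i * ι j = -(ι j * ι i))
    (c : (Fin r → ℕ) → MvPolynomial (Fin n) k ⊗[k] E) : minorDiff ι (minorDiff ι c) = 0 := by
  funext a
  simp only [minorDiff, map_sum]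
  rw [← Finset.sum_product', Finset.univ_product_univ, Pi.zero_apply]
  refine Finset.sum_involution (fun p _ => p.swap) ?_ ?_ (by simp) (by simp)
  · rintro ⟨i, j⟩ -
    change ι i (ι j (c (a + Pi.single i 1 + Pi.single j 1))) +
      ι j (ι i (c (a + Pi.single j 1 + Pi.single i 1))) = 0
    rw [add_right_comm a (Pi.single j 1)]
    have := DFunLike.congr_fun (hanti i j) (c (a + Pi.single i 1 + Pi.single j 1))
    rw [LinearMap.neg_apply, Module.End.mul_apply, Module.End.mul_apply] at this
    rw [this, neg_add_cancel]
  · rintro ⟨i, j⟩ - h e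
    obtain rfl : j = i := congrArg Prod.fst e
    exact h (DFunLike.congr_fun (hsq j) _)

theorem minorAug_ι (hsq : ∀ i, ι i * ι i = 0) (hanti : ∀ i j, ι i * ι j = -(ι j * ι i))
    (i : Fin r) (z : MvPolynomial (Fin n) k ⊗[k] E) : minorAug ι (ι i z) = 0 :=
  DFunLike.congr_fun (list_map_prod_mul_eq_zero (R := Module.End (MvPolynomial (Fin n) k) (MvPolynomial (Fin n) k ⊗[k] E))
    hsq hanti (List.mem_finRange i)) z

theorem minorAug_minorDiff (hsq : ∀ i, ι i * ι i = 0) (hanti : ∀ i j, ι i * ι j = -(ι j * ι i))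
    (c : (Fin r → ℕ) → MvPolynomial (Fin n) k ⊗[k] E) (a) : minorAug ι (minorDiff ι c a) = 0 := by
  rw [minorDiff, map_sum]
  exact Finset.sum_eq_zero fun i _ => minorAug_ι hsq hanti _ _

/-- Each of the r factors raises the polynomial degree by one, so the part of degree r comes from
the constants. -/
theorem homComp_minorAug (hdeg : ∀ i m z, homComp k n E (m + 1) (ι i z) = ι i (homComp k n E m z))
    (z : MvPolynomial (Fin n) k ⊗[k] E) : homComp k n E r (minorAug ι z) = minorAug ι (homComp k n E 0 z) := by
  have (l : List (Fin r)) : homComp k n E l.length ((l.map ι).prod z) =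
      (l.map ι).prod (homComp k n E 0 z) := by
    induction l with
    | nil => rfl
    | cons i l ih =>
      rw [List.map_cons, List.prod_cons, Module.End.mul_apply, Module.End.mul_apply, ← ih,
        List.length_cons, hdeg]
  have h := this (List.finRange r)
  rwa [List.length_finRange] at h

/-- `δ` is a common denominator: `e` contracts the complex after inverting `δ`. -/
def IsContraction (ι : Fin r → Module.End (MvPolynomial (Fin n) k) (MvPolynomial (Fin n) k ⊗[k] E)) (δ : MvPolynomial (Fin n) k) (e : Fin r → Module.End (MvPolynomial (Fin n) k) (MvPolynomial (Fin n) k ⊗[k] E)) : Prop :=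
  ∀ i j, ι i * e j + e j * ι i = if i = j then algebraMap (MvPolynomial (Fin n) k) (Module.End (MvPolynomial (Fin n) k) (MvPolynomial (Fin n) k ⊗[k] E)) δ else 0

theorem IsContraction.anticomm {δ : MvPolynomial (Fin n) k} {e : Fin r → Module.End (MvPolynomial (Fin n) k) (MvPolynomial (Fin n) k ⊗[k] E)} (he : IsContraction ι δ e)
    {i j : Fin r} (h : i ≠ j) : ι i * e j = -(e j * ι i) := by
  refine LinearMap.ext fun z => ?_
  have := DFunLike.congr_fun (he i j) z
  rw [if_neg h] at this
  exact eq_neg_of_add_eq_zero_left this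

/-- The homotopy `(h c)(a) = e_i c(a - ε_i)`. -/
def minorHomotopy (e : Fin r → Module.End (MvPolynomial (Fin n) k) (MvPolynomial (Fin n) k ⊗[k] E)) (i : Fin r) (c : (Fin r → ℕ) → MvPolynomial (Fin n) k ⊗[k] E) (a : Fin r → ℕ) :
    MvPolynomial (Fin n) k ⊗[k] E := if a i = 0 then 0 else e i (c (a - Pi.single i 1))

/-- The i-th term of the sums is ι_i e_i + e_i ι_i = δ, and the terms with x ≠ i cancel by
anticommutation. On the face a_i = 0 the homotopy of the differential is set to zero, so e_i ι_i
c(a) has to be added as a correction. -/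
theorem IsContraction.homotopy {δ : MvPolynomial (Fin n) k} {e : Fin r → Module.End (MvPolynomial (Fin n) k) (MvPolynomial (Fin n) k ⊗[k] E)} (he : IsContraction ι δ e)
    (i : Fin r) (c : (Fin r → ℕ) → MvPolynomial (Fin n) k ⊗[k] E) (a : Fin r → ℕ) :
    δ • c a = minorDiff ι (minorHomotopy e i c) a + minorHomotopy e i (minorDiff ι c) a +
      if a i = 0 then e i (ι i (c a)) else 0 := by
  have h1 : ι i (e i (c a)) + e i (ι i (c a)) = δ • c a := by
    have := DFunLike.congr_fun (he i i) (c a)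
    rwa [if_pos rfl] at this
  have h2 : minorHomotopy e i c (a + Pi.single i 1) = e i (c a) := by
    rw [minorHomotopy, if_neg (by simp), add_tsub_cancel_right]
  rw [minorDiff, ← Finset.add_sum_erase _ _ (Finset.mem_univ i), h2]
  by_cases ha : a i = 0
  · have h3 : ∑ x ∈ Finset.univ.erase i, ι x (minorHomotopy e i c (a + Pi.single x 1)) = 0 := by
      refine Finset.sum_eq_zero fun x hx => ?_
      rw [minorHomotopy, if_pos (by simp [ha, Ne.symm (Finset.ne_of_mem_erase hx)]), map_zero]
    rw [h3, minorHomotopy, if_pos ha, if_pos ha, ← h1]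
    abel
  · have hle : Pi.single i 1 ≤ a := by
      intro x
      by_cases hx : x = i
      · subst hx; simpa using Nat.one_le_iff_ne_zero.2 ha
      · simp [hx]
    rw [minorHomotopy, if_neg ha, if_neg ha, minorDiff,
      ← Finset.add_sum_erase _ _ (Finset.mem_univ i), tsub_add_cancel_of_le hle, map_add, ← h1,
      map_sum]
    have h3 : ∑ x ∈ Finset.univ.erase i, ι x (minorHomotopy e i c (a + Pi.single x 1)) +
        ∑ x ∈ Finset.univ.erase i, e i (ι x (c (a - Pi.single i 1 + Pi.single x 1))) = 0 := by
      rw [← Finset.sum_add_distrib]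
      refine Finset.sum_eq_zero fun x hx => ?_
      have hx' := Finset.ne_of_mem_erase hx
      rw [minorHomotopy, if_neg (by simp [ha]), tsub_add_eq_add_tsub hle]
      have := DFunLike.congr_fun (he x i) (c (a + Pi.single x 1 - Pi.single i 1))
      rwa [if_neg hx'] at this
    rw [eq_neg_of_add_eq_zero_left h3]
    abel

theorem trunc_minorHomotopy (e : Fin r → Module.End (MvPolynomial (Fin n) k) (MvPolynomial (Fin n) k ⊗[k] E)) (i : Fin r) {j : ℕ} {c : (Fin r → ℕ) → MvPolynomial (Fin n) k ⊗[k] E}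
    (hc : ∀ a, trunc k n E j (c a) = 0) (a : Fin r → ℕ) :
    trunc k n E j (minorHomotopy e i c a) = 0 := by
  rw [minorHomotopy]
  split_ifs
  · exact map_zero _
  · exact trunc_map_eq_zero _ (hc _)

/-- Modulo the variables `X l`, `l ≥ j`, the chain `c` is a boundary. -/
def IsBoundaryMod (ι : Fin r → Module.End (MvPolynomial (Fin n) k) (MvPolynomial (Fin n) k ⊗[k] E)) (j : ℕ) (c : (Fin r → ℕ) → MvPolynomial (Fin n) k ⊗[k] E) : Prop :=
  ∃ b, ∀ a, trunc k n E j (c a - minorDiff ι b a) = 0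

/-- Modulo the variables `X l`, `l ≥ j`, the chain `c` is a cycle of the augmented complex. -/
def IsCycleMod (ι : Fin r → Module.End (MvPolynomial (Fin n) k) (MvPolynomial (Fin n) k ⊗[k] E)) (j : ℕ) (c : (Fin r → ℕ) → MvPolynomial (Fin n) k ⊗[k] E) : Prop :=
  (∀ a, trunc k n E j (minorDiff ι c a) = 0) ∧ trunc k n E j (minorAug ι (c 0)) = 0

theorem IsBoundaryMod.add {j : ℕ} {c c' : (Fin r → ℕ) → MvPolynomial (Fin n) k ⊗[k] E} (h : IsBoundaryMod ι j c)
    (h' : IsBoundaryMod ι j c') : IsBoundaryMod ι j (c + c') := by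
  obtain ⟨b, hb⟩ := h
  obtain ⟨b', hb'⟩ := h'
  refine ⟨b + b', fun a => ?_⟩
  rw [minorDiff_add, Pi.add_apply, Pi.add_apply, add_sub_add_comm, map_add, hb, hb', add_zero]

theorem IsBoundaryMod.smul {j : ℕ} {c : (Fin r → ℕ) → MvPolynomial (Fin n) k ⊗[k] E} (h : IsBoundaryMod ι j c) (p : MvPolynomial (Fin n) k) :
    IsBoundaryMod ι j (p • c) := by
  obtain ⟨b, hb⟩ := h
  refine ⟨p • b, fun a => ?_⟩
  rw [minorDiff_smul, Pi.smul_apply, Pi.smul_apply]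
  refine (congrArg _ (smul_sub p (c a) (minorDiff ι b a)).symm).trans ?_
  rw [trunc_smul, hb, smul_zero]

/-- Applying the homotopies for i = 1, …, r in turn, each step costs a factor δ and replaces the
cycle by one supported on a further face a_i = 0. At the end only a = 0 remains, with value ∏ e_i
ι_i applied to c(0). This is a multiple of the augmentation of c(0), which vanishes modulo the
truncated variables. -/
theorem IsContraction.isBoundaryMod (hsq : ∀ i, ι i * ι i = 0)
    (hanti : ∀ i j, ι i * ι j = -(ι j * ι i)) {δ : MvPolynomial (Fin n) k} {e : Fin r → Module.End (MvPolynomial (Fin n) k) (MvPolynomial (Fin n) k ⊗[k] E)}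
    (he : IsContraction ι δ e) {j : ℕ} {c : (Fin r → ℕ) → MvPolynomial (Fin n) k ⊗[k] E} (hc : IsCycleMod ι j c) :
    IsBoundaryMod ι j (δ ^ r • c) := by
  classical
  -- The chain obtained from c by the correction terms of the homotopies with indices in l.
  let q (l : List (Fin r)) (a : Fin r → ℕ) : MvPolynomial (Fin n) k ⊗[k] E :=
    if ∀ i ∈ l, a i = 0 then (l.map fun i => e i * ι i).prod (c a) else 0
  have key (l : List (Fin r)) : IsBoundaryMod ι j (δ ^ l.length • c - q l) := by
    induction l with
    | nil => exact ⟨0, fun a => by simp [q, minorDiff]⟩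
    | cons i l ih =>
      obtain ⟨b, hb⟩ := ih
      -- q l differs from a multiple of the cycle c by a boundary, so it is again a cycle and the
      -- term h∂ drops out.
      have hcyc (a) : trunc k n E j (minorDiff ι (q l) a) = 0 := by
        have h1 := trunc_minorDiff ι hb a
        have h2 : minorDiff ι (fun a => (δ ^ l.length • c - q l) a - minorDiff ι b a) =
            δ ^ l.length • minorDiff ι c - minorDiff ι (q l) := by
          change minorDiff ι (δ ^ l.length • c - q l - minorDiff ι b) = _
          rw [minorDiff_sub, minorDiff_minorDiff hsq hanti, minorDiff_sub, minorDiff_smul, sub_zero]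
        rw [h2, Pi.sub_apply, Pi.smul_apply, map_sub, trunc_smul, hc.1, smul_zero, zero_sub,
          neg_eq_zero] at h1
        exact h1
      have hq (a) : q (i :: l) a = if a i = 0 then e i (ι i (q l a)) else 0 := by
        by_cases h1 : a i = 0
        · by_cases h2 : ∀ x ∈ l, a x = 0
          · simp only [q]
            rw [if_pos (by simpa [h1] using h2), if_pos h1, if_pos h2]
            rfl
          · simp only [q]
            rw [if_neg (by simpa [h1] using h2), if_pos h1, if_neg h2, map_zero, map_zero]
        · simp only [q]
          rw [if_neg (by simp [h1]), if_neg h1]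
      refine ⟨δ • b + minorHomotopy e i (q l), fun a => ?_⟩
      have h3 : (δ ^ (i :: l).length • c - q (i :: l)) a -
          minorDiff ι (δ • b + minorHomotopy e i (q l)) a =
          δ • ((δ ^ l.length • c - q l) a - minorDiff ι b a) +
            minorHomotopy e i (minorDiff ι (q l)) a := by
        have h4 := he.homotopy i (q l) a
        rw [Pi.sub_apply, Pi.sub_apply, hq, minorDiff_add, minorDiff_smul, Pi.add_apply,
          Pi.smul_apply, Pi.smul_apply, Pi.smul_apply, List.length_cons, pow_succ', mul_smul,
          smul_sub, smul_sub, h4]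
        abel
      rw [h3, map_add, trunc_smul, hb, smul_zero, zero_add, trunc_minorHomotopy _ _ hcyc]
  obtain ⟨b, hb⟩ := key (List.finRange r)
  refine ⟨b, fun a => ?_⟩
  have h1 : trunc k n E j (q (List.finRange r) a) = 0 := by
    simp only [q]
    split_ifs with h
    · obtain rfl : a = 0 := funext fun i => h i (List.mem_finRange i)
      obtain ⟨s, hs⟩ := list_prod_mul_pairs
        (R := Module.End (MvPolynomial (Fin n) k) (MvPolynomial (Fin n) k ⊗[k] E)) (fun i j hij => he.anticomm hij)
        (List.nodup_finRange r)
      rw [hs, Module.End.mul_apply]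
      exact trunc_map_eq_zero _ hc.2
    · exact map_zero _
  have h2 := hb a
  rw [Pi.sub_apply, sub_right_comm, map_sub, h1, sub_zero, List.length_finRange] at h2
  exact h2

/-- Some power of each variable is a combination of common denominators. -/
def HasContractions (ι : Fin r → Module.End (MvPolynomial (Fin n) k) (MvPolynomial (Fin n) k ⊗[k] E)) : Prop :=
  ∀ l : Fin n, MvPolynomial.X l ∈ (Ideal.span {δ : MvPolynomial (Fin n) k | ∃ e, IsContraction ι δ e}).radical

theorem HasContractions.exists_pow_mem (h : HasContractions ι) (l : Fin n) (I : Ideal (MvPolynomial (Fin n) k))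
    (hI : ∀ δ e, IsContraction ι δ e → δ ^ r ∈ I) :
    ∃ N : ℕ, (MvPolynomial.X l : MvPolynomial (Fin n) k) ^ N ∈ I := by
  have : (Ideal.span {δ : MvPolynomial (Fin n) k | ∃ e, IsContraction ι δ e}).radical ≤ I.radical := by
    rw [Ideal.radical_le_radical_iff, Ideal.span_le]
    rintro δ ⟨e, he⟩
    exact ⟨r, hI δ e he⟩
  exact this (h l)

/-- The multipliers turning c into a boundary form an ideal containing δ^r for every common
denominator δ, hence a power of each variable. -/
theorem HasContractions.exists_isBoundaryMod (h : HasContractions ι) (hsq : ∀ i, ι i * ι i = 0)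
    (hanti : ∀ i j, ι i * ι j = -(ι j * ι i)) (l : Fin n) {j : ℕ} {c : (Fin r → ℕ) → MvPolynomial (Fin n) k ⊗[k] E}
    (hc : IsCycleMod ι j c) :
    ∃ N : ℕ, IsBoundaryMod ι j ((MvPolynomial.X l : MvPolynomial (Fin n) k) ^ N • c) := by
  let I : Ideal (MvPolynomial (Fin n) k) :=
    { carrier := {p | IsBoundaryMod ι j (p • c)}
      add_mem' := fun {p q} hp hq => by
        change IsBoundaryMod ι j ((p + q) • c)
        rw [add_smul]
        exact IsBoundaryMod.add hp hq
      zero_mem' := ⟨0, fun a => by simp [minorDiff]⟩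
      smul_mem' := fun p q hq => by
        change IsBoundaryMod ι j ((p * q) • c)
        rw [mul_smul]
        exact IsBoundaryMod.smul hq p }
  exact h.exists_pow_mem l I fun δ e he => he.isBoundaryMod hsq hanti hc

theorem minorDiff_homComp_zero
    (hdeg : ∀ i m z, homComp k n E (m + 1) (ι i z) = ι i (homComp k n E m z))
    (b : (Fin r → ℕ) → MvPolynomial (Fin n) k ⊗[k] E) (a) : minorDiff ι (fun a => homComp k n E 0 (b a)) a =
      homComp k n E 1 (minorDiff ι b a) := by
  simp only [minorDiff, map_sum]
  exact Finset.sum_congr rfl fun i _ => (hdeg i 0 _).symm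

/-- A cycle without constant terms is a boundary. -/
theorem HasContractions.isBoundaryMod (h : HasContractions ι) (hsq : ∀ i, ι i * ι i = 0)
    (hanti : ∀ i j, ι i * ι j = -(ι j * ι i))
    (hdeg : ∀ i m z, homComp k n E (m + 1) (ι i z) = ι i (homComp k n E m z))
    {j : ℕ} (hj : j ≤ n) {c : (Fin r → ℕ) → MvPolynomial (Fin n) k ⊗[k] E} (hc0 : ∀ a, homComp k n E 0 (c a) = 0)
    (hc : IsCycleMod ι j c) : IsBoundaryMod ι j c := by
  induction j generalizing c with
  -- With all variables set to zero only the constant terms are left, and these vanish by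
  -- hypothesis.
  | zero => exact ⟨0, fun a => by simp [minorDiff, trunc_zero, hc0]⟩
  | succ j ih =>
    let x : Fin n := ⟨j, hj⟩
    have hx : trunc k n E (j + 1) = trunc k n E (x + 1) := rfl
    -- Cancelling one factor X_j: if X_j c = ∂b, then b may be taken without constant terms, so
    -- modulo X_j it is a boundary by induction. Writing b = ∂b₂ + X_j g gives X_j c = X_j ∂g, and
    -- X_j cancels.
    have descent (c : (Fin r → ℕ) → MvPolynomial (Fin n) k ⊗[k] E) (hc0 : ∀ a, homComp k n E 0 (c a) = 0)
        (hb : IsBoundaryMod ι (j + 1) ((MvPolynomial.X x : MvPolynomial (Fin n) k) • c)) :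
        IsBoundaryMod ι (j + 1) c := by
      obtain ⟨b, hb⟩ := hb
      let b₀ : (Fin r → ℕ) → MvPolynomial (Fin n) k ⊗[k] E := fun a => homComp k n E 0 (b a)
      -- The differential never reads the value at index 0, since a + ε_i ≠ 0. Setting it to zero
      -- makes the augmentation condition of a cycle trivial.
      let b₁ : (Fin r → ℕ) → MvPolynomial (Fin n) k ⊗[k] E := fun a => if a = 0 then 0 else b a - b₀ a
      have hb₁ (a) : minorDiff ι b₁ a = minorDiff ι b a - homComp k n E 1 (minorDiff ι b a) := by
        rw [← minorDiff_homComp_zero hdeg, ← Pi.sub_apply, ← minorDiff_sub]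
        refine Finset.sum_congr rfl fun i _ => congrArg _ ?_
        have : a + Pi.single i 1 ≠ 0 := fun h => by
          have := congrFun h i
          simp at this
        exact if_neg this
      have h1 (a) : trunc k n E (j + 1) ((MvPolynomial.X x : MvPolynomial (Fin n) k) • c a - minorDiff ι b₁ a) = 0 := by
        -- c has no constant terms, so X_j c has no linear terms; the constant part of b therefore
        -- has differential zero and can be dropped.
        have h2 : homComp k n E 1 ((MvPolynomial.X x : MvPolynomial (Fin n) k) • c a) = 0 := by
          rw [homComp_succ_X_smul, hc0, smul_zero]
        have h3 := congrArg (homComp k n E 1) (hb a)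
        rw [map_zero, ← trunc_homComp, map_sub, Pi.smul_apply, h2, zero_sub, map_neg,
          neg_eq_zero] at h3
        have h4 := hb a
        rw [Pi.smul_apply] at h4
        rw [hb₁, ← sub_add, map_add, h4, h3, add_zero]
      have h5 : ∀ a, homComp k n E 0 (b₁ a) = 0 := by
        intro a
        simp only [b₁]
        split_ifs
        · exact map_zero _
        · rw [map_sub, ← trunc_zero, ← trunc_zero]
          simp only [b₀]
          rw [← trunc_zero, trunc_trunc le_rfl, sub_self]
      have h6 : IsCycleMod ι j b₁ := by
        refine ⟨fun a => ?_, ?_⟩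
        · have h7 := congrArg (trunc k n E j) (h1 a)
          rw [map_zero, trunc_trunc (Nat.le_succ j), map_sub, trunc_smul, truncVars_X,
            if_neg (lt_irrefl j), zero_smul, zero_sub, neg_eq_zero] at h7
          exact h7
        · simp [b₁]
      obtain ⟨b₂, hb₂⟩ := ih (by omega) h5 h6
      choose g hg using fun a => exists_trunc_succ (j := x) (hb₂ a)
      refine ⟨g, fun a => eq_zero_of_trunc_X_smul (j := x) ?_⟩
      have h8 := trunc_minorDiff ι hg a
      have h9 : minorDiff ι (fun a => b₁ a - minorDiff ι b₂ a - (MvPolynomial.X x : MvPolynomial (Fin n) k) • g a) =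
          minorDiff ι b₁ - (MvPolynomial.X x : MvPolynomial (Fin n) k) • minorDiff ι g := by
        change minorDiff ι (b₁ - minorDiff ι b₂ - (MvPolynomial.X x : MvPolynomial (Fin n) k) • g) = _
        rw [minorDiff_sub, minorDiff_sub, minorDiff_minorDiff hsq hanti, minorDiff_smul, sub_zero]
      rw [h9] at h8
      have h10 : (MvPolynomial.X x : MvPolynomial (Fin n) k) • (c a - minorDiff ι g a) =
          ((MvPolynomial.X x : MvPolynomial (Fin n) k) • c a - minorDiff ι b₁ a) +
            (minorDiff ι b₁ - (MvPolynomial.X x : MvPolynomial (Fin n) k) • minorDiff ι g) a := by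
        rw [Pi.sub_apply, Pi.smul_apply, smul_sub]
        abel
      rw [h10, map_add, h8, ← hx, h1, add_zero]
    obtain ⟨N, hN⟩ := h.exists_isBoundaryMod hsq hanti x hc
    clear hc
    induction N generalizing c with
    | zero => simpa using hN
    | succ N ihN =>
      have hcN (N : ℕ) (a) : homComp k n E 0 (((MvPolynomial.X x : MvPolynomial (Fin n) k) ^ N • c) a) = 0 := by
        rw [Pi.smul_apply, ← trunc_zero, trunc_smul, trunc_zero, hc0, smul_zero]
      refine ihN hc0 (descent _ (hcN N) ?_)
      rw [smul_smul, ← pow_succ']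
      exact hN

/-- The same descent, one step further to the right. If X_j y is the augmentation of z, the constant
part of z contributes only in degree r, where X_j y vanishes as y has no part of degree r - 1. After
removing it, z is a cycle modulo X_j without constant terms, hence a boundary plus X_j g, and y is
the augmentation of g. -/
theorem HasContractions.exists_minorAug_eq (h : HasContractions ι) (hsq : ∀ i, ι i * ι i = 0)
    (hanti : ∀ i j, ι i * ι j = -(ι j * ι i))
    (hdeg : ∀ i m z, homComp k n E (m + 1) (ι i z) = ι i (homComp k n E m z)) (hr : 0 < r)
    {j : ℕ} (hj : j ≤ n) {y : MvPolynomial (Fin n) k ⊗[k] E} (hy0 : ∀ m < r, homComp k n E m y = 0)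
    (hy : ∀ l : Fin n, ∃ N : ℕ, ∃ z, (MvPolynomial.X l : MvPolynomial (Fin n) k) ^ N • y = minorAug ι z) :
    ∃ z, trunc k n E j (y - minorAug ι z) = 0 := by
  induction j generalizing y with
  | zero => exact ⟨0, by rw [map_zero, sub_zero, trunc_zero, hy0 0 hr]⟩
  | succ j ih =>
    let x : Fin n := ⟨j, hj⟩
    have hx : trunc k n E (j + 1) = trunc k n E (x + 1) := rfl
    have descent (y : MvPolynomial (Fin n) k ⊗[k] E) (hy0 : ∀ m < r, homComp k n E m y = 0)
        (hb : ∃ z, trunc k n E (j + 1) ((MvPolynomial.X x : MvPolynomial (Fin n) k) • y - minorAug ι z) = 0) :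
        ∃ z, trunc k n E (j + 1) (y - minorAug ι z) = 0 := by
      obtain ⟨z, hz⟩ := hb
      let z₁ : MvPolynomial (Fin n) k ⊗[k] E := z - homComp k n E 0 z
      obtain ⟨s, hs⟩ : ∃ s, r = s + 1 := ⟨r - 1, by omega⟩
      have h1 : trunc k n E (j + 1) ((MvPolynomial.X x : MvPolynomial (Fin n) k) • y - minorAug ι z₁) = 0 := by
        have h2 : homComp k n E r ((MvPolynomial.X x : MvPolynomial (Fin n) k) • y) = 0 := by
          conv_lhs => rw [hs]
          rw [homComp_succ_X_smul, hy0 s (by omega), smul_zero]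
        have h3 := congrArg (homComp k n E r) hz
        rw [map_zero, ← trunc_homComp, map_sub, h2, zero_sub, map_neg, neg_eq_zero,
          homComp_minorAug hdeg] at h3
        rw [map_sub (minorAug ι), ← sub_add, map_add, hz, h3, add_zero]
      -- The element z₁ as a chain concentrated at index 0, where every differential is zero and the
      -- cycle condition is that of the augmentation.
      let c : (Fin r → ℕ) → MvPolynomial (Fin n) k ⊗[k] E := fun a => if a = 0 then z₁ else 0
      have hc0 : ∀ a, homComp k n E 0 (c a) = 0 := by
        intro a
        simp only [c]
        split_ifs
        · simp only [z₁]
          rw [map_sub, ← trunc_zero, ← trunc_zero, trunc_trunc le_rfl, sub_self]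
        · exact map_zero _
      have hc : IsCycleMod ι j c := by
        refine ⟨fun a => ?_, ?_⟩
        · rw [minorDiff, map_sum]
          refine Finset.sum_eq_zero fun i _ => ?_
          have : a + Pi.single i 1 ≠ 0 := fun h => by
            have := congrFun h i
            simp at this
          simp only [c]
          rw [if_neg this, map_zero, map_zero]
        · have h7 := congrArg (trunc k n E j) h1
          rw [map_zero, trunc_trunc (Nat.le_succ j), map_sub, trunc_smul, truncVars_X,
            if_neg (lt_irrefl j), zero_smul, zero_sub, neg_eq_zero] at h7
          simpa [c] using h7
      obtain ⟨b₂, hb₂⟩ := h.isBoundaryMod hsq hanti hdeg (by omega) hc0 hc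
      obtain ⟨g, hg⟩ := exists_trunc_succ (j := x) (hb₂ 0)
      refine ⟨g, eq_zero_of_trunc_X_smul (j := x) ?_⟩
      have h8 := trunc_map_eq_zero (minorAug ι) hg
      have hcz : c 0 = z₁ := if_pos rfl
      rw [map_sub, map_sub (minorAug ι), minorAug_minorDiff hsq hanti, sub_zero, map_smul, hcz] at h8
      have h10 : (MvPolynomial.X x : MvPolynomial (Fin n) k) • (y - minorAug ι g) =
          ((MvPolynomial.X x : MvPolynomial (Fin n) k) • y - minorAug ι z₁) +
            (minorAug ι z₁ - (MvPolynomial.X x : MvPolynomial (Fin n) k) • minorAug ι g) := by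
        rw [smul_sub]
        abel
      rw [h10, map_add, h8, ← hx, h1, add_zero]
    obtain ⟨N, z, hN⟩ := hy x
    have hN' : ∃ z, trunc k n E (j + 1) ((MvPolynomial.X x : MvPolynomial (Fin n) k) ^ N • y - minorAug ι z) = 0 :=
      ⟨z, by rw [hN, sub_self, map_zero]⟩
    clear hN hy
    induction N with
    | zero => simpa using hN'
    | succ N ihN =>
      refine ihN (descent _ (fun m hm => ?_) ?_)
      · clear hN' ihN descent
        induction N generalizing m with
        | zero => simpa using hy0 m hm
        | succ N ih' =>
          rw [pow_succ', mul_smul]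
          cases m with
          | zero => rw [← trunc_zero, trunc_smul, trunc_zero, ih' 0 hm, smul_zero]
          | succ m => rw [homComp_succ_X_smul, ih' m (by omega), smul_zero]
      · simpa only [smul_smul, ← pow_succ'] using hN'

end MinorComplex

/-! ### Inverting the product of the operators on their common kernel, up to a denominator. -/

section MinorComplex

variable {k : Type*} [Field k] {n : ℕ} {E : Type*} [AddCommGroup E] [Module k E] {r : ℕ}

/-- Since ι_i z = 0, the relation gives ι_i e_i z = δ z, while e_i z is still killed by the
remaining ι_j. The factors peel off from the inside, which is why the e's appear in reverse order.
-/
theorem IsContraction.list_prod_apply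
    {ι e : Fin r → Module.End (MvPolynomial (Fin n) k) (MvPolynomial (Fin n) k ⊗[k] E)}
    {δ : MvPolynomial (Fin n) k} (he : IsContraction ι δ e) {l : List (Fin r)} (hl : l.Nodup)
    {z : MvPolynomial (Fin n) k ⊗[k] E} (hz : ∀ i ∈ l, ι i z = 0) :
    (l.map ι).prod ((l.reverse.map e).prod z) = δ ^ l.length • z := by
  induction l generalizing z with
  | nil => simp
  | cons i l ih =>
    have h1 : ∀ j ∈ l, ι j (e i z) = 0 := fun j hj => by
      have hij : j ≠ i := fun h => (List.nodup_cons.1 hl).1 (h ▸ hj)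
      have := DFunLike.congr_fun (he.anticomm hij) z
      rw [LinearMap.neg_apply, Module.End.mul_apply, Module.End.mul_apply,
        hz j (List.mem_cons_of_mem _ hj), map_zero, neg_zero] at this
      exact this
    have h2 : ι i (e i z) = δ • z := by
      have := DFunLike.congr_fun (he i i) z
      rw [if_pos rfl, LinearMap.add_apply, Module.End.mul_apply, Module.End.mul_apply,
        hz i List.mem_cons_self, map_zero, add_zero] at this
      exact this
    rw [List.map_cons, List.prod_cons, List.reverse_cons, List.map_append, List.prod_append,
      List.map_singleton, List.prod_singleton, Module.End.mul_apply, Module.End.mul_apply,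
      ih hl.of_cons h1, map_smul, h2, smul_smul, List.length_cons, pow_succ]

theorem IsContraction.exists_minorAug_eq
    {ι e : Fin r → Module.End (MvPolynomial (Fin n) k) (MvPolynomial (Fin n) k ⊗[k] E)}
    {δ : MvPolynomial (Fin n) k} (he : IsContraction ι δ e)
    {z : MvPolynomial (Fin n) k ⊗[k] E} (hz : ∀ i, ι i z = 0) :
    minorAug ι (((List.finRange r).reverse.map e).prod z) = δ ^ r • z := by
  have := he.list_prod_apply (List.nodup_finRange r) fun i _ => hz i
  rwa [List.length_finRange] at this

end MinorComplex

/-! ### Anticommutation of operators with linear coefficients. -/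

section LinOp

variable {k : Type*} [Field k] {n : ℕ} {E : Type*} [AddCommGroup E] [Module k E]

theorem linOp_anticomm {θ θ' : Fin n → Module.End k E}
    (h : ∀ l m x, θ l (θ' m x) = -θ' m (θ l x)) :
    linOp θ * linOp θ' = -(linOp θ' * linOp θ) := by
  refine LinearMap.ext fun z => ?_
  rw [LinearMap.neg_apply, Module.End.mul_apply, Module.End.mul_apply]
  induction z with
  | zero => simp
  | add x y hx hy => rw [map_add, map_add, map_add, map_add, hx, hy, neg_add]
  | tmul a x =>
    simp only [linOp_tmul, map_sum]
    rw [Finset.sum_comm, ← Finset.sum_neg_distrib]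
    refine Finset.sum_congr rfl fun l _ => ?_
    rw [← Finset.sum_neg_distrib]
    refine Finset.sum_congr rfl fun m _ => ?_
    rw [h, TensorProduct.tmul_neg, mul_left_comm]

theorem linOp_sq {θ : Fin n → Module.End k E} (h : ∀ l m x, θ l (θ m x) = -θ m (θ l x))
    (h' : ∀ l x, θ l (θ l x) = 0) : linOp θ * linOp θ = 0 := by
  refine LinearMap.ext fun z => ?_
  rw [LinearMap.zero_apply, Module.End.mul_apply]
  induction z with
  | zero => simp
  | add x y hx hy => rw [map_add, map_add, hx, hy, add_zero]
  | tmul a x =>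
    simp only [linOp_tmul, map_sum]
    rw [← Finset.sum_product', Finset.univ_product_univ]
    refine Finset.sum_involution (fun p _ => p.swap) ?_ ?_ (by simp) (by simp)
    · rintro ⟨l, m⟩ -
      dsimp only [Prod.swap]
      rw [h, TensorProduct.tmul_neg, mul_left_comm, neg_add_cancel]
    · rintro ⟨l, m⟩ - hne e
      obtain rfl : m = l := congrArg Prod.fst e
      exact hne (by dsimp only; rw [h', TensorProduct.tmul_zero])

end LinOp

/-! ### Contractions of the exterior algebra with polynomial coefficients -/

section ContractRow

variable {k : Type*} [Field k] {n : ℕ} {Y : Type*} [AddCommGroup Y] [Module k Y]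

/-- The contraction of the exterior algebra by a linear form. -/
def contract (d : Module.Dual k Y) : Module.End k (ExteriorAlgebra k Y) :=
  CliffordAlgebra.contractLeft (Q := (0 : QuadraticForm k Y)) d

theorem contract_sq (d : Module.Dual k Y) (x : ExteriorAlgebra k Y) :
    contract d (contract d x) = 0 := CliffordAlgebra.contractLeft_contractLeft _ x

theorem contract_anticomm (d d' : Module.Dual k Y) (x : ExteriorAlgebra k Y) :
    contract d (contract d' x) = -contract d' (contract d x) := CliffordAlgebra.contractLeft_comm _ _ x

theorem contract_one (d : Module.Dual k Y) : contract d 1 = 0 :=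
  CliffordAlgebra.contractLeft_one _ d

theorem contract_ι (d : Module.Dual k Y) (y : Y) :
    contract d (ExteriorAlgebra.ι k y) = algebraMap k _ (d y) :=
  CliffordAlgebra.contractLeft_ι _ d y

theorem contract_ι_mul (d : Module.Dual k Y) (y : Y) (x : ExteriorAlgebra k Y) :
    contract d (ExteriorAlgebra.ι k y * x) = d y • x - ExteriorAlgebra.ι k y * contract d x :=
  CliffordAlgebra.contractLeft_ι_mul d y x

/-- The contraction by the vector `∑ X l ⊗ φ l` of linear forms. -/
def contractRow (φ : Fin n → Module.Dual k Y) : Module.End (MvPolynomial (Fin n) k)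
    (MvPolynomial (Fin n) k ⊗[k] ExteriorAlgebra k Y) :=
  linOp fun l => contract (φ l)

theorem contractRow_tmul (φ : Fin n → Module.Dual k Y) (a : MvPolynomial (Fin n) k)
    (x : ExteriorAlgebra k Y) :
    contractRow φ (a ⊗ₜ x) = ∑ l, (MvPolynomial.X l * a) ⊗ₜ contract (φ l) x :=
  linOp_tmul _ a x

theorem contractRow_tmul_one (φ : Fin n → Module.Dual k Y) (a : MvPolynomial (Fin n) k) :
    contractRow φ (a ⊗ₜ 1) = 0 := by
  simp [contractRow_tmul, contract_one]

theorem contractRow_anticomm (φ ψ : Fin n → Module.Dual k Y) :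
    contractRow φ * contractRow ψ = -(contractRow ψ * contractRow φ) :=
  linOp_anticomm fun _ _ _ => contract_anticomm _ _ _

theorem contractRow_sq (φ : Fin n → Module.Dual k Y) : contractRow φ * contractRow φ = 0 :=
  linOp_sq (fun _ _ _ => contract_anticomm _ _ _) fun _ _ => contract_sq _ _

theorem homComp_succ_contractRow (φ : Fin n → Module.Dual k Y) (m : ℕ)
    (z : MvPolynomial (Fin n) k ⊗[k] ExteriorAlgebra k Y) :
    homComp k n _ (m + 1) (contractRow φ z) = contractRow φ (homComp k n _ m z) :=
  homComp_succ_linOp _ m z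

/-- Exterior multiplication by `y`. -/
def wedgeOp (k : Type*) [Field k] (n : ℕ) {Y : Type*} [AddCommGroup Y] [Module k Y] (y : Y) :
    Module.End (MvPolynomial (Fin n) k) (MvPolynomial (Fin n) k ⊗[k] ExteriorAlgebra k Y) :=
  (LinearMap.mulLeft k (ExteriorAlgebra.ι k y)).baseChange (MvPolynomial (Fin n) k)

theorem wedgeOp_tmul (y : Y) (a : MvPolynomial (Fin n) k) (x : ExteriorAlgebra k Y) :
    wedgeOp k n y (a ⊗ₜ x) = a ⊗ₜ (ExteriorAlgebra.ι k y * x) := rfl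

theorem contractRow_wedgeOp (φ : Fin n → Module.Dual k Y) (y : Y)
    (z : MvPolynomial (Fin n) k ⊗[k] ExteriorAlgebra k Y) :
    contractRow φ (wedgeOp k n y z) + wedgeOp k n y (contractRow φ z) =
      (∑ l, φ l y • MvPolynomial.X l : MvPolynomial (Fin n) k) • z := by
  induction z with
  | zero => simp
  | add x z hx hz => simp only [map_add, smul_add, ← hx, ← hz]; abel
  | tmul a x =>
    simp only [wedgeOp_tmul, contractRow_tmul, map_sum]
    rw [← Finset.sum_add_distrib, Finset.sum_smul]
    refine Finset.sum_congr rfl fun l _ => ?_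
    rw [contract_ι_mul, ← TensorProduct.tmul_add, sub_add_cancel, TensorProduct.tmul_smul,
      smul_assoc]
    rfl

/-- A form of degree `r` is a combination of maximal minors: it is `ι_1 ⋯ ι_r (1 ⊗ ω)`. -/
theorem HasContractions.exists_minorAug_one_tmul_eq {r : ℕ} {φ : Fin r → Fin n → Module.Dual k Y}
    (h : HasContractions fun i => contractRow (φ i)) {z : MvPolynomial (Fin n) k}
    (hz : z.IsHomogeneous r) :
    ∃ ω : ExteriorAlgebra k Y, minorAug (fun i => contractRow (φ i)) (1 ⊗ₜ ω) = z ⊗ₜ 1 := by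
  -- For r = 0 the augmentation is the empty product and z is a scalar; the descent needs r > 0.
  obtain rfl | hr := r.eq_zero_or_pos
  · refine ⟨algebraMap k _ (z.coeff 0), ?_⟩
    have h1 := MvPolynomial.totalDegree_eq_zero_iff_eq_C.1 (Nat.le_zero.1 hz.totalDegree_le)
    conv_rhs => rw [h1, MvPolynomial.C_eq_smul_one, TensorProduct.smul_tmul,
      ← Algebra.algebraMap_eq_smul_one]
    simp [minorAug]
  have hdeg : ∀ i m z, homComp k n _ (m + 1) (contractRow (φ i) z) =
    contractRow (φ i) (homComp k n _ m z) := fun i => homComp_succ_contractRow (φ i)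
  have hy (m : ℕ) : homComp k n (ExteriorAlgebra k Y) m (z ⊗ₜ 1) = if m = r then z ⊗ₜ 1 else 0 := by
    rw [homComp_tmul, MvPolynomial.homogeneousComponent_of_mem hz]
    split_ifs <;> simp
  obtain ⟨x, hx⟩ := h.exists_minorAug_eq (fun i => contractRow_sq _)
    (fun i j => contractRow_anticomm _ _) hdeg hr le_rfl (y := z ⊗ₜ 1)
    (fun m hm => by rw [hy, if_neg hm.ne]) (fun l => by
      -- The multipliers bringing z ⊗ 1 into the image of the augmentation. As contractions kill z ⊗
      -- 1, every δ^r belongs to this ideal.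
      let I : Ideal (MvPolynomial (Fin n) k) :=
        (LinearMap.range (minorAug fun i => contractRow (φ i))).comap
          (LinearMap.toSpanSingleton _ _ (z ⊗ₜ[k] (1 : ExteriorAlgebra k Y)))
      obtain ⟨N, y, hN⟩ := h.exists_pow_mem l I fun δ e he =>
        ⟨_, he.exists_minorAug_eq fun i => contractRow_tmul_one (φ i) z⟩
      exact ⟨N, y, hN.symm⟩)
  rw [trunc_self, sub_eq_zero] at hx
  -- Only the constant part of x contributes to degree r, the degree of z.
  obtain ⟨ω, hω⟩ := exists_homComp_zero_eq x
  refine ⟨ω, ?_⟩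
  rw [← hω, ← homComp_minorAug hdeg, ← hx, hy, if_pos rfl]

end ContractRow

/-! ### Maximal minors of a geometrically `1`-generic pairing -/

section OneGeneric

/-- Row rank equals column rank, so the column space has dimension r and r of the columns form a
basis of it. -/
theorem exists_det_submatrix_ne_zero {K : Type*} [Field K] {r : ℕ} {J : Type*} [Fintype J]
    (N : Matrix (Fin r) J K) (h : LinearIndependent K N.row) :
    ∃ c : Fin r → J, (N.submatrix id c).det ≠ 0 := by
  have h1 : Module.finrank K (Submodule.span K (Set.range N.col)) = r := by
    rw [← Matrix.rank_eq_finrank_span_cols, h.rank_matrix, Fintype.card_fin]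
  obtain ⟨f, hf, -, hli⟩ := Submodule.exists_fun_fin_finrank_span_eq K (Set.range N.col)
  choose c hc using hf
  refine ⟨c ∘ Fin.cast h1.symm, ?_⟩
  rw [← isUnit_iff_ne_zero, ← Matrix.isUnit_iff_isUnit_det, ← Matrix.linearIndependent_cols_iff_isUnit]
  have : (N.submatrix id (c ∘ Fin.cast h1.symm)).col = f ∘ Fin.cast h1.symm := by
    funext j
    exact hc _
  rw [this]
  exact hli.comp _ (Fin.cast_injective _)

/-- Contraction is an antiderivation, so contracting by row i anticommutes with wedging by y_m up to
the matrix entry (i, m). Combining the wedges with the coefficients P yields the matrix product;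
taking for P the adjugate of a square submatrix makes its minor a common denominator. -/
theorem isContraction_of_matrix {k : Type*} [Field k] {n r : ℕ} {Y J : Type*} [AddCommGroup Y]
    [Module k Y] [Fintype J] (φ : Fin r → Fin n → Module.Dual k Y) (y : J → Y)
    (P : Matrix J (Fin r) (MvPolynomial (Fin n) k)) (δ : MvPolynomial (Fin n) k)
    (h : Matrix.of (fun i m => ∑ l, φ i l (y m) • (MvPolynomial.X l : MvPolynomial (Fin n) k)) * P =
      δ • (1 : Matrix (Fin r) (Fin r) (MvPolynomial (Fin n) k))) :
    IsContraction (fun i => contractRow (φ i)) δ fun j => ∑ m, P m j • wedgeOp k n (y m) := by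
  intro i j
  refine LinearMap.ext fun z => ?_
  have h1 := congrFun (congrFun h i) j
  rw [Matrix.mul_apply, Matrix.smul_apply, Matrix.one_apply] at h1
  rw [LinearMap.add_apply, Module.End.mul_apply, Module.End.mul_apply, LinearMap.sum_apply,
    LinearMap.sum_apply, map_sum, ← Finset.sum_add_distrib]
  have h2 (m : J) : contractRow (φ i) ((P m j • wedgeOp k n (y m)) z) +
      (P m j • wedgeOp k n (y m)) (contractRow (φ i) z) =
      ((∑ l, φ i l (y m) • (MvPolynomial.X l : MvPolynomial (Fin n) k)) * P m j) • z := by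
    rw [LinearMap.smul_apply, LinearMap.smul_apply, map_smul, ← smul_add, contractRow_wedgeOp,
      smul_smul, mul_comm]
  rw [Finset.sum_congr rfl fun m _ => h2 m, ← Finset.sum_smul]
  change ∑ m, (∑ l, φ i l (y m) • (MvPolynomial.X l : MvPolynomial (Fin n) k)) * P m j = _ at h1
  rw [h1]
  split_ifs <;> simp

variable {k : Type u} [Field k] {V W U : Type u} [AddCommGroup V] [Module k V] [AddCommGroup W]
  [Module k W] [AddCommGroup U] [Module k U]

/-- A relation c among the rows at the point x says that the pairing vanishes on (∑ c_i a_i) ⊗ (∑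
x_l b_l), which 1-genericity over the algebraic closure forbids. -/
theorem IsGeometricallyOneGeneric.linearIndependent {μ : W →ₗ[k] U →ₗ[k] V}
    (h : IsGeometricallyOneGeneric μ) {r n : ℕ} {a : Fin r → W} (ha : LinearIndependent k a)
    {b : Fin n → U} (hb : LinearIndependent k b) {J : Type*} [Fintype J] (v : Module.Basis J k V)
    {x : Fin n → AlgebraicClosure k} (hx : x ≠ 0) :
    LinearIndependent (AlgebraicClosure k) (fun i m => ∑ l, v.coord m (μ (a i) (b l)) • x l :
      Fin r → J → AlgebraicClosure k) := by
  rw [Fintype.linearIndependent_iff]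
  intro c hc
  by_contra hne
  have key {Z : Type u} [AddCommGroup Z] [Module k Z] {m : ℕ} {z : Fin m → Z}
      (hz : LinearIndependent k z) {y : Fin m → AlgebraicClosure k} (hy : y ≠ 0) :
      ∑ i, y i ⊗ₜ[k] z i ≠ 0 := by
    obtain ⟨g, hg⟩ := (Fintype.linearCombination k z).exists_leftInverse_of_injective
      (LinearMap.ker_eq_bot.2 hz.fintypeLinearCombination_injective)
    refine fun h0 => hy (funext fun i => ?_)
    have h1 := congrArg (fun t => TensorProduct.rid k _
      ((LinearMap.proj i ∘ₗ g).lTensor (AlgebraicClosure k) t)) h0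
    have h2 (j : Fin m) : g (z j) i = if j = i then 1 else 0 := by
      have h3 := DFunLike.congr_fun hg (Pi.single j 1)
      rw [LinearMap.comp_apply, Fintype.linearCombination_apply_single, one_smul] at h3
      rw [h3, LinearMap.id_apply, Pi.single_apply]
      simp only [eq_comm]
    simpa [h2] using h1
  have hc' : c ≠ 0 := fun h0 => hne fun i => congrFun h0 i
  refine h _ _ (key ha hc') (key hb hx) ?_
  have h1 : (TensorProduct.lift μ).baseChange (AlgebraicClosure k)
      ((TensorProduct.AlgebraTensorModule.distribBaseChange k (AlgebraicClosure k) W U).symm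
        ((∑ i, c i ⊗ₜ[k] a i) ⊗ₜ[AlgebraicClosure k] ∑ l, x l ⊗ₜ[k] b l)) =
      ∑ i, ∑ l, (c i * x l) ⊗ₜ[k] μ (a i) (b l) := by
    simp only [TensorProduct.sum_tmul, TensorProduct.tmul_sum, map_sum,
      TensorProduct.AlgebraTensorModule.distribBaseChange_symm_tmul,
      LinearMap.baseChange_tmul, TensorProduct.lift.tmul]
    exact Finset.sum_comm
  rw [h1]
  have h2 (i l) : (c i * x l) ⊗ₜ[k] μ (a i) (b l) =
      ∑ m, (c i * (v.coord m (μ (a i) (b l)) • x l)) ⊗ₜ[k] v m := by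
    conv_lhs => rw [← v.sum_repr (μ (a i) (b l)), TensorProduct.tmul_sum]
    refine Finset.sum_congr rfl fun m _ => ?_
    rw [← TensorProduct.smul_tmul, mul_smul_comm]
    rfl
  simp only [h2]
  rw [Finset.sum_congr rfl fun i _ => Finset.sum_comm, Finset.sum_comm]
  refine Finset.sum_eq_zero fun m _ => ?_
  simp only [← TensorProduct.sum_tmul, ← Finset.mul_sum]
  have := congrFun hc m
  rw [Finset.sum_apply] at this
  simp only [Pi.smul_apply, smul_eq_mul, Pi.zero_apply] at this
  rw [this, TensorProduct.zero_tmul]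

/-- Each maximal minor is a common denominator, and the minors have no common zero over the
algebraic closure except possibly the origin. The Nullstellensatz therefore puts every variable in
the radical. -/
theorem IsGeometricallyOneGeneric.hasContractions [FiniteDimensional k V] {μ : W →ₗ[k] U →ₗ[k] V}
    (h : IsGeometricallyOneGeneric μ) {r n : ℕ} {a : Fin r → W} (ha : LinearIndependent k a)
    {b : Fin n → U} (hb : LinearIndependent k b) :
    HasContractions fun i => contractRow (n := n) (Y := Module.Dual k V) fun l =>
      Module.Dual.eval k V (μ (a i) (b l)) := by
  intro l
  let v := Module.finBasis k V
  let φ : Fin r → Fin n → Module.Dual k (Module.Dual k V) :=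
    fun i l => Module.Dual.eval k V (μ (a i) (b l))
  let N : Matrix (Fin r) (Fin (Module.finrank k V)) (MvPolynomial (Fin n) k) :=
    .of fun i m => ∑ l, φ i l (v.coord m) • (MvPolynomial.X l : MvPolynomial (Fin n) k)
  have hdet (c) : (N.submatrix id c).det ∈ {δ | ∃ e, IsContraction (fun i => contractRow (φ i)) δ e} :=
    ⟨_, isContraction_of_matrix φ (fun m => v.coord (c m)) (N.submatrix id c).adjugate _
      (Matrix.mul_adjugate _)⟩
  rw [← MvPolynomial.vanishingIdeal_zeroLocus_eq_radical (K := AlgebraicClosure k)]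
  intro x hx
  rw [MvPolynomial.aeval_X]
  by_contra hxl
  have hx0 : x ≠ 0 := fun h0 => hxl (congrFun h0 l)
  obtain ⟨c, hc⟩ := exists_det_submatrix_ne_zero (.of fun i m => ∑ l, v.coord m (μ (a i) (b l)) • x l)
    (h.linearIndependent ha hb v hx0)
  apply hc
  have := hx _ (Ideal.subset_span (hdet c))
  rw [AlgHom.map_det] at this
  rw [← this]
  congr 1
  ext i m
  simp [N, φ]

end OneGeneric

/-! ### The homogeneous parts of the symmetric algebra as spaces of polynomials -/

section SymPoly

variable {k : Type u} [Field k] {Z : Type u} [AddCommGroup Z] [Module k Z] {J : Type*}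
  (b : Module.Basis J k Z)

theorem map_symDeg (m : ℕ) :
    (symDeg k Z m).map (SymmetricAlgebra.equivMvPolynomial b).toAlgHom.toLinearMap =
      MvPolynomial.homogeneousSubmodule J k m := by
  have h : (LinearMap.range (SymmetricAlgebra.ι k Z)).map
      (SymmetricAlgebra.equivMvPolynomial b).toAlgHom.toLinearMap =
        MvPolynomial.homogeneousSubmodule J k 1 := by
    rw [MvPolynomial.homogeneousSubmodule_one_eq_span_X, LinearMap.range_eq_map, ← b.span_eq,
      Submodule.map_span, Submodule.map_span, ← Set.range_comp, ← Set.range_comp]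
    congr 2
    funext i
    exact SymmetricAlgebra.equivMvPolynomial_ι_apply b i
  rw [symDeg, Submodule.map_pow, h, MvPolynomial.homogeneousSubmodule_one_pow]

theorem isHomogeneous_of_mem_symDeg {m : ℕ} {s : SymmetricAlgebra k Z} (hs : s ∈ symDeg k Z m) :
    (SymmetricAlgebra.equivMvPolynomial b s).IsHomogeneous m := by
  have := Submodule.mem_map_of_mem
    (f := (SymmetricAlgebra.equivMvPolynomial b).toAlgHom.toLinearMap) hs
  rwa [map_symDeg] at this

end SymPoly

/-! ### Generation of the module of a `1`-generic pairing -/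

section Generation

variable {k : Type u} [Field k] {n : ℕ} {Z : Type u} [AddCommGroup Z] [Module k Z]

/-- The contraction by a constant linear form. -/
def contractConst (n : ℕ) (d : Module.Dual k Z) : Module.End (MvPolynomial (Fin n) k)
    (MvPolynomial (Fin n) k ⊗[k] ExteriorAlgebra k Z) :=
  (contract d).baseChange (MvPolynomial (Fin n) k)

theorem contractConst_tmul (d : Module.Dual k Z) (a : MvPolynomial (Fin n) k)
    (x : ExteriorAlgebra k Z) : contractConst n d (a ⊗ₜ x) = a ⊗ₜ contract d x := rfl

theorem homComp_contractConst (d : Module.Dual k Z) (m : ℕ)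
    (z : MvPolynomial (Fin n) k ⊗[k] ExteriorAlgebra k Z) :
    homComp k n _ m (contractConst n d z) = contractConst n d (homComp k n _ m z) := by
  induction z with
  | zero => simp
  | add x y hx hy => simp only [map_add, hx, hy]
  | tmul a x => rfl

theorem contractConst_wedgeOp (d : Module.Dual k Z) (y : Z)
    (z : MvPolynomial (Fin n) k ⊗[k] ExteriorAlgebra k Z) :
    contractConst n d (wedgeOp k n y z) + wedgeOp k n y (contractConst n d z) = d y • z := by
  induction z with
  | zero => simp
  | add x z hx hz => simp only [map_add, smul_add, ← hx, ← hz]; abel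
  | tmul a x =>
    rw [wedgeOp_tmul, contractConst_tmul, contractConst_tmul, wedgeOp_tmul, contract_ι_mul,
      ← TensorProduct.tmul_add, sub_add_cancel, TensorProduct.tmul_smul]

/-- Multiplication by `∑ X l ⊗ c l`. -/
def wedgeRow (c : Fin n → Z) : Module.End (MvPolynomial (Fin n) k)
    (MvPolynomial (Fin n) k ⊗[k] ExteriorAlgebra k Z) :=
  linOp fun l => LinearMap.mulLeft k (ExteriorAlgebra.ι k (c l))

theorem wedgeRow_tmul (c : Fin n → Z) (a : MvPolynomial (Fin n) k) (x : ExteriorAlgebra k Z) :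
    wedgeRow c (a ⊗ₜ x) = ∑ l, (MvPolynomial.X l * a) ⊗ₜ (ExteriorAlgebra.ι k (c l) * x) :=
  linOp_tmul _ a x

theorem wedgeRow_sq (c : Fin n → Z) :
    wedgeRow (k := k) c * wedgeRow c = 0 := by
  refine linOp_sq (fun l m x => ?_) fun l x => ?_
  · have := ExteriorAlgebra.ι_add_mul_swap (R := k) (c l) (c m)
    simp only [LinearMap.mulLeft_apply]
    rw [← mul_assoc, ← mul_assoc, ← neg_mul, eq_neg_of_add_eq_zero_left this]
  · simp only [LinearMap.mulLeft_apply]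
    rw [← mul_assoc, ExteriorAlgebra.ι_sq_zero, zero_mul]

theorem contractConst_wedgeRow (d : Module.Dual k Z) (c : Fin n → Z)
    (z : MvPolynomial (Fin n) k ⊗[k] ExteriorAlgebra k Z) :
    contractConst n d (wedgeRow c z) + wedgeRow c (contractConst n d z) =
      (∑ l, d (c l) • MvPolynomial.X l : MvPolynomial (Fin n) k) • z := by
  induction z with
  | zero => simp
  | add x z hx hz => simp only [map_add, smul_add, ← hx, ← hz]; abel
  | tmul a x =>
    simp only [wedgeRow_tmul, contractConst_tmul, map_sum]
    rw [← Finset.sum_add_distrib, Finset.sum_smul]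
    refine Finset.sum_congr rfl fun l _ => ?_
    rw [contract_ι_mul, ← TensorProduct.tmul_add, sub_add_cancel, TensorProduct.tmul_smul,
      smul_assoc]
    rfl

/-- The linear dependence of `wedgeRow c` on a parameter. -/
def wedgeRowHom {Y : Type u} [AddCommGroup Y] [Module k Y] (c : Fin n → Y →ₗ[k] Z) :
    Y →ₗ[k] Module.End (MvPolynomial (Fin n) k)
      (MvPolynomial (Fin n) k ⊗[k] ExteriorAlgebra k Z) where
  toFun y := wedgeRow fun l => c l y
  map_add' y y' := by
    refine TensorProduct.AlgebraTensorModule.ext fun a x => ?_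
    simp only [wedgeRow_tmul, LinearMap.add_apply, map_add, add_mul, TensorProduct.tmul_add,
      Finset.sum_add_distrib]
  map_smul' t y := by
    refine TensorProduct.AlgebraTensorModule.ext fun a x => ?_
    simp only [wedgeRow_tmul, LinearMap.smul_apply, map_smul, smul_mul_assoc,
      TensorProduct.tmul_smul, Finset.smul_sum, RingHom.id_apply]

theorem wedgeRowHom_sq {Y : Type u} [AddCommGroup Y] [Module k Y] (c : Fin n → Y →ₗ[k] Z) (y : Y) :
    wedgeRowHom c y * wedgeRowHom c y = 0 := wedgeRow_sq _

/-- The action of the exterior algebra through `wedgeRow`. -/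
def wedgeRowAlg {Y : Type u} [AddCommGroup Y] [Module k Y] (c : Fin n → Y →ₗ[k] Z) :
    ExteriorAlgebra k Y →ₐ[k] Module.End (MvPolynomial (Fin n) k)
      (MvPolynomial (Fin n) k ⊗[k] ExteriorAlgebra k Z) :=
  ExteriorAlgebra.lift k ⟨wedgeRowHom c, wedgeRowHom_sq c⟩

theorem wedgeRowAlg_ι_mul {Y : Type u} [AddCommGroup Y] [Module k Y] (c : Fin n → Y →ₗ[k] Z)
    (y : Y) (x : ExteriorAlgebra k Y)
    (z : MvPolynomial (Fin n) k ⊗[k] ExteriorAlgebra k Z) :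
    wedgeRowAlg c (ExteriorAlgebra.ι k y * x) z =
      wedgeRow (fun l => c l y) (wedgeRowAlg c x z) := by
  have h : wedgeRowAlg c (ExteriorAlgebra.ι k y) = wedgeRowHom c y :=
    ExteriorAlgebra.lift_ι_apply k _ (wedgeRowHom_sq c) y
  rw [map_mul, Module.End.mul_apply, h]
  rfl

/-- The map `A ⊗ ∧Y → A ⊗ ∧Z`, `p ⊗ x ↦ p • (x · ζ)`. -/
def wedgeOrbit {Y : Type u} [AddCommGroup Y] [Module k Y] (c : Fin n → Y →ₗ[k] Z)
    (ζ : MvPolynomial (Fin n) k ⊗[k] ExteriorAlgebra k Z) :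
    MvPolynomial (Fin n) k ⊗[k] ExteriorAlgebra k Y →ₗ[MvPolynomial (Fin n) k]
      MvPolynomial (Fin n) k ⊗[k] ExteriorAlgebra k Z :=
  LinearMap.liftBaseChange (MvPolynomial (Fin n) k)
    ((LinearMap.applyₗ ζ).restrictScalars k ∘ₗ (wedgeRowAlg c).toLinearMap)

theorem wedgeOrbit_tmul {Y : Type u} [AddCommGroup Y] [Module k Y] (c : Fin n → Y →ₗ[k] Z)
    (ζ : MvPolynomial (Fin n) k ⊗[k] ExteriorAlgebra k Z) (p : MvPolynomial (Fin n) k)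
    (x : ExteriorAlgebra k Y) : wedgeOrbit c ζ (p ⊗ₜ x) = p • wedgeRowAlg c x ζ := rfl

/-- Moving the contraction by d past a factor ∑ X_l ⊗ c_l(y) releases the linear form ∑ d(c_l y)
X_l. On ∧Y the contraction with the row d ∘ c_l releases the same form, and ζ itself contributes
nothing. Thus contractions of elements of Q become contractions on ∧V^*, where the minors are
computed. -/
theorem contractConst_wedgeOrbit {Y : Type u} [AddCommGroup Y] [Module k Y]
    (c : Fin n → Y →ₗ[k] Z) {ζ : MvPolynomial (Fin n) k ⊗[k] ExteriorAlgebra k Z}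
    {d : Module.Dual k Z} (hζ : contractConst n d ζ = 0)
    (z : MvPolynomial (Fin n) k ⊗[k] ExteriorAlgebra k Y) :
    contractConst n d (wedgeOrbit c ζ z) = wedgeOrbit c ζ (contractRow (fun l => d ∘ₗ c l) z) := by
  suffices H : ∀ x : ExteriorAlgebra k Y, contractConst n d (wedgeOrbit c ζ (1 ⊗ₜ x)) =
      wedgeOrbit c ζ (contractRow (fun l => d ∘ₗ c l) (1 ⊗ₜ x)) by
    induction z with
    | zero => simp
    | add x y hx hy => simp only [map_add, hx, hy]
    | tmul p x =>
      have : p ⊗ₜ[k] x = p • ((1 : MvPolynomial (Fin n) k) ⊗ₜ[k] x) := by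
        rw [TensorProduct.smul_tmul', smul_eq_mul, mul_one]
      rw [this, map_smul, map_smul, H, map_smul, map_smul]
  intro x
  induction x using CliffordAlgebra.left_induction with
  | algebraMap t =>
    have h1 : contractRow (fun l => d ∘ₗ c l)
        ((1 : MvPolynomial (Fin n) k) ⊗ₜ[k] algebraMap k (ExteriorAlgebra k Y) t) = 0 := by
      rw [Algebra.algebraMap_eq_smul_one, ← TensorProduct.smul_tmul, contractRow_tmul_one]
    have h2 : wedgeOrbit c ζ ((1 : MvPolynomial (Fin n) k) ⊗ₜ[k]
        algebraMap k (ExteriorAlgebra k Y) t) = t • ζ := by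
      rw [wedgeOrbit_tmul, AlgHom.commutes, one_smul]
      rfl
    refine (congrArg _ h2).trans ?_
    rw [LinearMap.map_smul_of_tower, hζ, smul_zero]
    exact ((congrArg _ h1).trans (map_zero _)).symm
  | add x y hx hy => rw [TensorProduct.tmul_add]; simp only [map_add, hx, hy]
  | ι_mul x y hx =>
    change contractConst n d (wedgeOrbit c ζ (1 ⊗ₜ (ExteriorAlgebra.ι k y * x))) =
      wedgeOrbit c ζ (contractRow (fun l => d ∘ₗ c l) (1 ⊗ₜ (ExteriorAlgebra.ι k y * x)))
    have h1 (w : MvPolynomial (Fin n) k ⊗[k] ExteriorAlgebra k Y) :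
        wedgeOrbit c ζ (wedgeOp k n y w) = wedgeRow (fun l => c l y) (wedgeOrbit c ζ w) := by
      induction w with
      | zero => simp
      | add w w' hw hw' => simp only [map_add, hw, hw']
      | tmul p x => rw [wedgeOp_tmul, wedgeOrbit_tmul, wedgeRowAlg_ι_mul, wedgeOrbit_tmul, map_smul]
    have h2 := contractRow_wedgeOp (fun l => d ∘ₗ c l) y
      ((1 : MvPolynomial (Fin n) k) ⊗ₜ[k] x)
    have h3 := contractConst_wedgeRow d (fun l => c l y)
      (wedgeOrbit c ζ ((1 : MvPolynomial (Fin n) k) ⊗ₜ[k] x))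
    rw [← wedgeOp_tmul, h1, eq_sub_of_add_eq h2, eq_sub_of_add_eq h3, hx, map_sub, map_smul, h1]
    rfl

end Generation

/-! ### The pieces of Q inside k[X] ⊗ ∧W^*, and generation in the top degree. -/

section Generation

variable {k : Type u} [Field k] {n : ℕ} {V W U : Type u} [AddCommGroup V] [Module k V]
  [AddCommGroup W] [Module k W] [AddCommGroup U] [Module k U]
  (b : Module.Basis (Fin n) k U)

/-- The inclusion of `∧^{m+1} W^* ⊗ Sym_m(U^*)` into `k[X] ⊗ ∧ W^*`. -/
def pieceEmb (m : ℕ) : ⋀[k]^(m + 1) (Module.Dual k W) ⊗[k] symDeg k (Module.Dual k U) m →ₗ[k]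
    MvPolynomial (Fin n) k ⊗[k] ExteriorAlgebra k (Module.Dual k W) :=
  TensorProduct.map ((SymmetricAlgebra.equivMvPolynomial b.dualBasis).toAlgHom.toLinearMap ∘ₗ
      (symDeg k (Module.Dual k U) m).subtype)
    (⋀[k]^(m + 1) (Module.Dual k W)).subtype ∘ₗ
    (TensorProduct.comm k (⋀[k]^(m + 1) (Module.Dual k W))
      (symDeg k (Module.Dual k U) m)).toLinearMap

theorem pieceEmb_tmul (m : ℕ) (x : ⋀[k]^(m + 1) (Module.Dual k W))
    (g : symDeg k (Module.Dual k U) m) : pieceEmb b m (x ⊗ₜ g) =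
      SymmetricAlgebra.equivMvPolynomial b.dualBasis g.1 ⊗ₜ x.1 := rfl

theorem homComp_pieceEmb (m i : ℕ)
    (y : ⋀[k]^(m + 1) (Module.Dual k W) ⊗[k] symDeg k (Module.Dual k U) m) :
    homComp k n _ i (pieceEmb b m y) = if i = m then pieceEmb b m y else 0 := by
  induction y with
  | zero => simp
  | add y z hy hz =>
    rw [map_add, map_add, hy, hz]
    split_ifs <;> simp
  | tmul x g =>
    rw [pieceEmb_tmul, homComp_tmul, MvPolynomial.homogeneousComponent_of_mem
      (isHomogeneous_of_mem_symDeg _ g.2)]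
    split_ifs <;> simp

variable [FiniteDimensional k W] [FiniteDimensional k U] (μ : W →ₗ[k] U →ₗ[k] V)

theorem dualPairing_eq_sum (ξ : Module.Dual k V) :
    dualPairing μ ξ = ∑ l, (ξ ∘ₗ μ.flip (b l)) ⊗ₜ[k] b.coord l := by
  rw [dualPairing, LinearMap.comp_apply, LinearEquiv.coe_coe, LinearEquiv.symm_apply_eq]
  refine TensorProduct.ext' fun w u => ?_
  rw [map_sum, LinearMap.sum_apply]
  change ξ (μ w u) = ∑ l, ξ (μ w (b l)) * b.repr u l
  conv_lhs => rw [← b.sum_repr u]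
  simp only [map_sum, map_smul, smul_eq_mul, mul_comm]

theorem pieceEmb_act (m : ℕ) (ξ : Module.Dual k V)
    (y : ⋀[k]^(m + 1) (Module.Dual k W) ⊗[k] symDeg k (Module.Dual k U) m) :
    pieceEmb b (m + 1) (wedgeSym k (Module.Dual k W) (Module.Dual k U) m (dualPairing μ ξ) y) =
      wedgeRow (fun l => ξ ∘ₗ μ.flip (b l)) (pieceEmb b m y) := by
  rw [dualPairing_eq_sum b μ, map_sum, LinearMap.sum_apply]
  induction y with
  | zero => simp
  | add y z hy hz => simp only [map_add, Finset.sum_add_distrib, hy, hz]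
  | tmul x g =>
    simp only [wedgeSym_tmul, map_sum, pieceEmb_tmul, wedgeRow_tmul]
    refine Finset.sum_congr rfl fun l _ => ?_
    congr 1
    change SymmetricAlgebra.equivMvPolynomial b.dualBasis
      (SymmetricAlgebra.ι k _ (b.coord l) * g.1) = _
    rw [map_mul, ← Module.Basis.coe_dualBasis, SymmetricAlgebra.equivMvPolynomial_ι_apply]

/-- The pieces of the submodule generated by the piece of degree `0`. -/
def pairingGen (m : ℕ) :
    Submodule k (⋀[k]^(m + 1) (Module.Dual k W) ⊗[k] symDeg k (Module.Dual k U) m) :=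
  (pairingMod μ).gen m

theorem wedgeSym_mem_pairingGen {m : ℕ} (ξ : Module.Dual k V)
    {y : ⋀[k]^(m + 1) (Module.Dual k W) ⊗[k] symDeg k (Module.Dual k U) m}
    (hy : y ∈ pairingGen μ m) : wedgeSym k (Module.Dual k W) (Module.Dual k U) m
      (dualPairing μ ξ) y ∈ pairingGen μ (m + 1) :=
  (pairingMod μ).act_mem_gen m ξ hy

theorem exists_pieceEmb_eq (α : Module.Dual k W) (m : ℕ)
    (x : ExteriorAlgebra k (Module.Dual k V)) (hx : x ∈ ⋀[k]^m (Module.Dual k V)) :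
    ∃ y ∈ pairingGen μ m, pieceEmb b m y =
      wedgeRowAlg (fun l => (μ.flip (b l)).dualMap) x
        ((1 : MvPolynomial (Fin n) k) ⊗ₜ ExteriorAlgebra.ι k α) := by
  induction m generalizing x with
  | zero =>
    obtain ⟨t, rfl⟩ := Submodule.mem_one.1 (by simpa using hx)
    refine ⟨t • ((⟨ExteriorAlgebra.ι k α, by simp⟩ : ⋀[k]^(0 + 1) (Module.Dual k W)) ⊗ₜ[k]
      (⟨1, one_mem_symDeg⟩ : symDeg k (Module.Dual k U) 0)), trivial, ?_⟩
    rw [map_smul, pieceEmb_tmul, AlgHom.commutes, map_one]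
    rfl
  | succ m ih =>
    rw [ExteriorAlgebra.exteriorPower, pow_succ'] at hx
    induction hx using Submodule.mul_induction_on' with
    | mem_mul_mem x hx y hy =>
      obtain ⟨ξ, rfl⟩ := hx
      obtain ⟨z, hz, hz'⟩ := ih y hy
      refine ⟨_, wedgeSym_mem_pairingGen μ ξ hz, ?_⟩
      rw [pieceEmb_act, hz', wedgeRowAlg_ι_mul]
      rfl
    | add x _ y _ hx hy =>
      obtain ⟨z, hz, hz'⟩ := hx
      obtain ⟨z', hz1, hz2⟩ := hy
      exact ⟨_, add_mem hz hz1, by rw [map_add, hz', hz2, map_add, LinearMap.add_apply]⟩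

/-- The part of x of exterior degree i contributes exactly in polynomial degree i, so x need not be
homogeneous. -/
theorem exists_pieceEmb_eq_homComp (α : Module.Dual k W) (m : ℕ)
    (x : ExteriorAlgebra k (Module.Dual k V)) :
    ∃ y ∈ pairingGen μ m, pieceEmb b m y =
      homComp k n _ m (wedgeRowAlg (fun l => (μ.flip (b l)).dualMap) x
        ((1 : MvPolynomial (Fin n) k) ⊗ₜ ExteriorAlgebra.ι k α)) := by
  have hx : x ∈ ⨆ i, ⋀[k]^i (Module.Dual k V) := by
    rw [(DirectSum.Decomposition.isInternal
      (fun i => ⋀[k]^i (Module.Dual k V))).submodule_iSup_eq_top]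
    trivial
  induction hx using Submodule.iSup_induction' with
  | mem i x hx =>
    obtain ⟨y, hy, hy'⟩ := exists_pieceEmb_eq b μ α i x hx
    rw [← hy', homComp_pieceEmb]
    split_ifs with h
    · subst h
      exact ⟨y, hy, rfl⟩
    · exact ⟨0, zero_mem _, map_zero _⟩
  | zero => exact ⟨0, zero_mem _, by simp⟩
  | add x y _ _ hx hy =>
    obtain ⟨z, hz, hz'⟩ := hx
    obtain ⟨z', hz1, hz2⟩ := hy
    exact ⟨_, add_mem hz hz1, by
      rw [map_add, hz', hz2, map_add, LinearMap.add_apply, map_add]⟩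

theorem minorAug_contractConst_wedgeOrbit {Y Z : Type u} [AddCommGroup Y] [Module k Y]
    [AddCommGroup Z] [Module k Z] {r : ℕ} (c : Fin n → Y →ₗ[k] Z)
    {ζ : MvPolynomial (Fin n) k ⊗[k] ExteriorAlgebra k Z}
    {d : Fin r → Module.Dual k Z} (hζ : ∀ i, contractConst n (d i) ζ = 0)
    (z : MvPolynomial (Fin n) k ⊗[k] ExteriorAlgebra k Y) :
    minorAug (fun i => contractConst n (d i)) (wedgeOrbit c ζ z) =
      wedgeOrbit c ζ (minorAug (fun i => contractRow fun l => d i ∘ₗ c l) z) := by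
  rw [minorAug, minorAug]
  induction List.finRange r with
  | nil => rfl
  | cons i l ih =>
    rw [List.map_cons, List.prod_cons, List.map_cons, List.prod_cons, Module.End.mul_apply,
      Module.End.mul_apply, ih, contractConst_wedgeOrbit c (hζ i)]

theorem homComp_minorAug_contractConst {Z : Type u} [AddCommGroup Z] [Module k Z] {r : ℕ}
    (d : Fin r → Module.Dual k Z) (m : ℕ)
    (z : MvPolynomial (Fin n) k ⊗[k] ExteriorAlgebra k Z) :
    homComp k n _ m (minorAug (fun i => contractConst n (d i)) z) =
      minorAug (fun i => contractConst n (d i)) (homComp k n _ m z) := by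
  rw [minorAug]
  induction List.finRange r with
  | nil => rfl
  | cons i l ih =>
    rw [List.map_cons, List.prod_cons, Module.End.mul_apply, Module.End.mul_apply,
      homComp_contractConst, ih]

theorem isContraction_contractConst {Z : Type u} [AddCommGroup Z] [Module k Z] {r : ℕ}
    {d : Fin r → Module.Dual k Z} {z : Fin r → Z}
    (h : ∀ i j, d i (z j) = if i = j then 1 else 0) :
    IsContraction (fun i => contractConst n (d i)) 1 fun j => wedgeOp k n (z j) := by
  intro i j
  refine LinearMap.ext fun x => ?_
  rw [LinearMap.add_apply, Module.End.mul_apply, Module.End.mul_apply, contractConst_wedgeOp, h]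
  split_ifs <;> simp

theorem exists_list_prod_wedgeOp_eq {Z : Type u} [AddCommGroup Z] [Module k Z] {r : ℕ}
    (z : Fin r → Z) (α : Z) (l : List (Fin r)) :
    ∃ x ∈ ⋀[k]^(l.length + 1) Z, (l.map fun j => wedgeOp k n (z j)).prod
      (1 ⊗ₜ ExteriorAlgebra.ι k α) = 1 ⊗ₜ x := by
  induction l with
  | nil => exact ⟨_, by simp, rfl⟩
  | cons i l ih =>
    obtain ⟨x, hx, hx'⟩ := ih
    refine ⟨ExteriorAlgebra.ι k (z i) * x, ?_, ?_⟩
    · rw [List.length_cons, ExteriorAlgebra.exteriorPower, pow_succ']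
      exact Submodule.mul_mem_mul ⟨_, rfl⟩ hx
    · rw [List.map_cons, List.prod_cons, Module.End.mul_apply, hx', wedgeOp_tmul]

/-- The module of a geometrically `1`-generic pairing is generated by its piece of degree `0`
in the top degree. -/
theorem gen_eq_top_of_isGeometricallyOneGeneric [FiniteDimensional k V]
    (h : IsGeometricallyOneGeneric μ) {r : ℕ} (hr : Module.finrank k W = r + 1) :
    (pairingMod μ).gen r = ⊤ := by
  change pairingGen μ r = ⊤
  let b := Module.finBasis k U
  let a : Module.Basis (Fin (r + 1)) k W := Module.finBasisOfFinrankEq k W hr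
  let α := a.coord 0
  let d : Fin r → Module.Dual k (Module.Dual k W) := fun i => Module.Dual.eval k W (a i.succ)
  let ζ : MvPolynomial (Fin (Module.finrank k U)) k ⊗[k] ExteriorAlgebra k (Module.Dual k W) :=
    1 ⊗ₜ ExteriorAlgebra.ι k α
  have hζ (i) : contractConst _ (d i) ζ = 0 := by
    simp [ζ, α, d, contractConst_tmul, contract_ι]
  -- Contracting ζ with a_0 turns it into 1, so a polynomial multiple of ζ determines the
  -- polynomial.
  have hsmul {p q : MvPolynomial (Fin (Module.finrank k U)) k} (hpq : p • ζ = q • ζ) : p = q := by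
    have h1 (p : MvPolynomial (Fin (Module.finrank k U)) k) : TensorProduct.rid k _
        ((ExteriorAlgebra.algebraMapInv.toLinearMap ∘ₗ
          contract (Module.Dual.eval k W (a 0))).lTensor _ (p • ζ)) = p := by
      simp [ζ, α, TensorProduct.smul_tmul', contract_ι]
    rw [← h1 p, hpq, h1]
  -- The volume form is built in the order inverse to the contractions by a_1, …, a_r, so that these
  -- take it back to α without a sign.
  obtain ⟨vol, hvol, hvol'⟩ := exists_list_prod_wedgeOp_eq (k := k) (n := Module.finrank k U)
    (fun i : Fin r => a.coord i.succ) α (List.finRange r).reverse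
  rw [List.length_reverse, List.length_finRange] at hvol
  have hP : minorAug (fun i => contractConst _ (d i)) (1 ⊗ₜ vol) = ζ := by
    rw [← hvol']
    refine ((isContraction_contractConst fun i j => ?_).exists_minorAug_eq hζ).trans (by
      rw [one_pow, one_smul])
    simp [d, Finsupp.single_apply]
  have hvol0 : (⟨vol, hvol⟩ : ⋀[k]^(r + 1) (Module.Dual k W)) ≠ 0 := by
    intro h0
    have h1 : vol = 0 := congrArg Subtype.val h0
    rw [h1, TensorProduct.tmul_zero, map_zero] at hP
    exact one_ne_zero (hsmul (p := 1) (q := 0) (by rw [← hP, smul_zero, smul_zero]))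
  have hone : Module.finrank k (⋀[k]^(r + 1) (Module.Dual k W)) = 1 := by
    rw [exteriorPower.finrank_eq, Subspace.dual_finrank_eq, hr, Nat.choose_self]
  have hpiece (y : ⋀[k]^(r + 1) (Module.Dual k W) ⊗[k] symDeg k (Module.Dual k U) r) :
      ∃ g, y = ⟨vol, hvol⟩ ⊗ₜ g := by
    induction y with
    | zero => exact ⟨0, by simp⟩
    | add y z hy hz =>
      obtain ⟨g, rfl⟩ := hy
      obtain ⟨g', rfl⟩ := hz
      exact ⟨g + g', by rw [TensorProduct.tmul_add]⟩
    | tmul x g =>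
      obtain ⟨t, rfl⟩ := (finrank_eq_one_iff_of_nonzero' _ hvol0).1 hone x
      exact ⟨t • g, by rw [TensorProduct.smul_tmul]⟩
  have hPpiece (g : symDeg k (Module.Dual k U) r) :
      minorAug (fun i => contractConst _ (d i)) (pieceEmb b r (⟨vol, hvol⟩ ⊗ₜ g)) =
        SymmetricAlgebra.equivMvPolynomial b.dualBasis g.1 • ζ := by
    rw [pieceEmb_tmul, ← hP, ← map_smul, TensorProduct.smul_tmul', smul_eq_mul, mul_one]
  rw [eq_top_iff]
  rintro y -
  obtain ⟨g, rfl⟩ := hpiece y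
  -- Write the form g as a combination of maximal minors of the rows a_1, …, a_r. Acting by ω on α
  -- gives an element vol ⊗ g' of the generated submodule, and contracting it shows g' = g.
  obtain ⟨ω, hω⟩ := HasContractions.exists_minorAug_one_tmul_eq
    (h.hasContractions (a.linearIndependent.comp _ (Fin.succ_injective r)) b.linearIndependent)
    (isHomogeneous_of_mem_symDeg b.dualBasis g.2)
  obtain ⟨y, hy, hy'⟩ := exists_pieceEmb_eq_homComp b μ α r ω
  obtain ⟨g', rfl⟩ := hpiece y
  have h1 := congrArg (minorAug fun i => contractConst _ (d i)) hy'
  have h2 : wedgeRowAlg (fun l => (μ.flip (b l)).dualMap) ω ζ =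
      wedgeOrbit (fun l => (μ.flip (b l)).dualMap) ζ (1 ⊗ₜ ω) := by
    rw [wedgeOrbit_tmul, one_smul]
  rw [hPpiece, ← homComp_minorAug_contractConst, h2, minorAug_contractConst_wedgeOrbit _ hζ] at h1
  have h3 : minorAug (fun i => contractRow fun l => d i ∘ₗ (μ.flip (b l)).dualMap) (1 ⊗ₜ ω) =
    SymmetricAlgebra.equivMvPolynomial b.dualBasis g.1 ⊗ₜ 1 := hω
  rw [h3, wedgeOrbit_tmul, map_one, Module.End.one_apply] at h1
  have h4 : homComp k _ _ r (SymmetricAlgebra.equivMvPolynomial b.dualBasis g.1 • ζ) =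
      SymmetricAlgebra.equivMvPolynomial b.dualBasis g.1 • ζ := by
    rw [TensorProduct.smul_tmul', smul_eq_mul, mul_one, homComp_tmul,
      MvPolynomial.homogeneousComponent_of_mem (isHomogeneous_of_mem_symDeg b.dualBasis g.2),
      if_pos rfl]
  rw [h4] at h1
  have h5 : g' = g := Subtype.ext ((SymmetricAlgebra.equivMvPolynomial b.dualBasis).injective
    (hsmul h1))
  rwa [← h5]

end Generation

/-! ### The divided power algebra of a finite-dimensional vector space -/

section DividedPowerSequence

open PowerSeries Finset

variable {C : Type*} [CommRing C]

/-- The coefficients of the power series `s` multiply like the divided powers of an element. -/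
def IsDividedPowerSeries (s : PowerSeries C) : Prop :=
  coeff 0 s = 1 ∧ ∀ m n, coeff m s * coeff n s = (m + n).choose m • coeff (m + n) s

theorem isDividedPowerSeries_one : IsDividedPowerSeries (1 : PowerSeries C) := by
  refine ⟨coeff_zero_one, fun m n => ?_⟩
  rw [coeff_one, coeff_one, coeff_one]
  rcases Nat.eq_zero_or_pos m with rfl | hm
  · simp
  · rw [if_neg hm.ne', zero_mul, if_neg (by omega : m + n ≠ 0), smul_zero]

/-- Vandermonde's identity distributes the binomial coefficient of a pair p over the splittings p =
i + j, matching the terms of the product of the two coefficients. -/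
theorem IsDividedPowerSeries.mul {s t : PowerSeries C} (hs : IsDividedPowerSeries s)
    (ht : IsDividedPowerSeries t) : IsDividedPowerSeries (s * t) := by
  refine ⟨by simp [coeff_mul, hs.1, ht.1], fun m n => ?_⟩
  rw [coeff_mul, coeff_mul, coeff_mul, Finset.sum_mul_sum, Finset.smul_sum]
  have h (p : ℕ × ℕ) (hp : p ∈ antidiagonal (m + n)) :
      (m + n).choose m • (coeff p.1 s * coeff p.2 t) = ∑ i ∈ antidiagonal m,
        (p.1.choose i.1 * p.2.choose i.2) • (coeff p.1 s * coeff p.2 t) := by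
    rw [← Finset.sum_smul, ← Nat.add_choose_eq, HasAntidiagonal.mem_antidiagonal.1 hp]
  rw [Finset.sum_congr rfl h]
  refine Eq.trans ?_ Finset.sum_comm
  refine Finset.sum_congr rfl fun i hi => ?_
  rw [HasAntidiagonal.mem_antidiagonal] at hi
  refine Finset.sum_of_injOn (fun j => i + j) (fun j _ j' _ h => add_left_cancel h) ?_ ?_ ?_
  · intro j hj
    simp only [Finset.mem_coe, HasAntidiagonal.mem_antidiagonal, Prod.fst_add, Prod.snd_add] at hj ⊢
    omega
  · rintro ⟨x, y⟩ hp hne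
    rw [HasAntidiagonal.mem_antidiagonal] at hp
    by_cases hx : x < i.1
    · rw [Nat.choose_eq_zero_of_lt hx, zero_mul, zero_smul]
    by_cases hy : y < i.2
    · rw [Nat.choose_eq_zero_of_lt hy, mul_zero, zero_smul]
    · refine absurd ⟨(x - i.1, y - i.2), ?_, ?_⟩ hne
      · simp only [Finset.mem_coe, HasAntidiagonal.mem_antidiagonal] at hp ⊢
        omega
      · ext <;> simp <;> omega
  · intro j _
    rw [Prod.fst_add, Prod.snd_add, mul_mul_mul_comm, hs.2, ht.2, smul_mul_smul_comm]

theorem IsDividedPowerSeries.rescale {s : PowerSeries C} (hs : IsDividedPowerSeries s) (c : C) :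
    IsDividedPowerSeries (rescale c s) := by
  refine ⟨by rw [coeff_rescale, hs.1, pow_zero, one_mul], fun m n => ?_⟩
  rw [coeff_rescale, coeff_rescale, coeff_rescale, mul_mul_mul_comm, hs.2, ← pow_add,
    mul_smul_comm]

/-- The binomial theorem for (c + d)^m, with the binomial coefficient absorbed by the multiplication
rule of the coefficients. -/
theorem IsDividedPowerSeries.rescale_add {s : PowerSeries C} (hs : IsDividedPowerSeries s)
    (c d : C) : PowerSeries.rescale (c + d) s = PowerSeries.rescale c s * PowerSeries.rescale d s := by
  ext m
  rw [coeff_rescale, coeff_mul, (Commute.all c d).add_pow', Finset.sum_mul]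
  refine Finset.sum_congr rfl fun p hp => ?_
  rw [coeff_rescale, coeff_rescale, mul_mul_mul_comm, hs.2, HasAntidiagonal.mem_antidiagonal.1 hp, smul_mul_assoc,
    mul_smul_comm]

theorem IsDividedPowerSeries.rescale_zero {s : PowerSeries C} (hs : IsDividedPowerSeries s) :
    PowerSeries.rescale (0 : C) s = 1 := by
  ext m
  rw [coeff_rescale, coeff_one]
  rcases Nat.eq_zero_or_pos m with rfl | hm
  · simp [hs.1]
  · rw [zero_pow hm.ne', zero_mul, if_neg hm.ne']

variable {k : Type*} [Field k] [Algebra k C] {U : Type*} [AddCommGroup U] [Module k U]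
  {J : Type*} [Fintype J] (b : Module.Basis J k U) {s : J → PowerSeries C}

/-- The product of the power series `s l` rescaled by the coordinates of a vector. -/
def coordSeries (s : J → PowerSeries C) (x : U) : PowerSeries C :=
  ∏ l, PowerSeries.rescale (algebraMap k C (b.repr x l)) (s l)

theorem isDividedPowerSeries_coordSeries (hs : ∀ l, IsDividedPowerSeries (s l)) (x : U) :
    IsDividedPowerSeries (coordSeries b s x) :=
  Finset.prod_induction _ _ (fun _ _ => IsDividedPowerSeries.mul) isDividedPowerSeries_one
    fun l _ => (hs l).rescale _

theorem coordSeries_add (hs : ∀ l, IsDividedPowerSeries (s l)) (x y : U) :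
    coordSeries b s (x + y) = coordSeries b s x * coordSeries b s y := by
  simp only [coordSeries]
  rw [← Finset.prod_mul_distrib]
  refine Finset.prod_congr rfl fun l _ => ?_
  rw [map_add, Finsupp.add_apply, map_add, (hs l).rescale_add]

theorem coordSeries_smul (c : k) (x : U) :
    coordSeries b s (c • x) = PowerSeries.rescale (algebraMap k C c) (coordSeries b s x) := by
  simp only [coordSeries]
  rw [map_prod]
  refine Finset.prod_congr rfl fun l _ => ?_
  rw [map_smul, Finsupp.smul_apply, smul_eq_mul, map_mul, mul_comm, PowerSeries.rescale_rescale]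

theorem coordSeries_basis (hs : ∀ l, IsDividedPowerSeries (s l)) (l : J) :
    coordSeries b s (b l) = s l := by
  classical
  rw [coordSeries, Finset.prod_eq_single l]
  · simp
  · intro j _ hj
    rw [b.repr_self, Finsupp.single_eq_of_ne hj, map_zero, (hs j).rescale_zero]
  · simp

/-- Divided powers of the elements of a basis determine a homomorphism from the divided power
algebra. -/
theorem exists_dividedPowerAlgebra_hom (hs : ∀ l, IsDividedPowerSeries (s l)) :
    ∃ Φ : DividedPowerAlgebra k U →ₐ[k] C, ∀ m l,
      Φ (DividedPowerAlgebra.dp k m (b l)) = coeff m (s l) := by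
  -- Divided powers of a general vector must be prescribed too: for x = ∑ x_l b_l they are the
  -- coefficients of ∏ s_l(x_l T), the rule satisfied by exponential series.
  refine ⟨DividedPowerAlgebra.lift' (f := fun q => coeff q.1 (coordSeries b s q.2))
    (fun x => (isDividedPowerSeries_coordSeries b hs x).1) (fun m c x => ?_)
    (fun m n x => (isDividedPowerSeries_coordSeries b hs x).2 m n) (fun m x y => ?_),
    fun m l => ?_⟩
  · rw [coordSeries_smul, coeff_rescale, ← map_pow, Algebra.smul_def]
  · rw [coordSeries_add b hs, coeff_mul]
  · rw [DividedPowerAlgebra.lift'_apply_dp, coordSeries_basis b hs]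

end DividedPowerSequence

/-! ### A monomial basis of the divided power algebra. -/

section DividedPowerBasis

variable {k : Type u} [Field k] {U : Type u} [AddCommGroup U] [Module k U] {n : ℕ}

/-- The divided power operators `f ↦ (β ↦ (β_l + m choose m) f(β + m ε_l))`. -/
def hasseOp (k : Type u) [Field k] {n : ℕ} (l : Fin n) (m : ℕ) :
    Module.End k ((Fin n →₀ ℕ) → k) where
  toFun f β := ((β l + m).choose m : k) * f (β + Finsupp.single l m)
  map_add' f g := by funext β; simp [mul_add]
  map_smul' c f := by funext β; simp [mul_left_comm]

theorem hasseOp_apply (l : Fin n) (m : ℕ) (f : (Fin n →₀ ℕ) → k) (β : Fin n →₀ ℕ) :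
    hasseOp k l m f β = ((β l + m).choose m : k) * f (β + Finsupp.single l m) := rfl

/-- With β the l-th exponent, this is the identity C(β+m+i, m+i) C(m+i, i) = C(β+m+i, i) C(β+m, m).
-/
theorem hasseOp_mul_self (l : Fin n) (m i : ℕ) :
    hasseOp k l m * hasseOp k l i = (m + i).choose m • hasseOp k l (m + i) := by
  refine LinearMap.ext fun f => funext fun β => ?_
  rw [Module.End.mul_apply, hasseOp_apply, hasseOp_apply, LinearMap.smul_apply, Pi.smul_apply,
    hasseOp_apply, Finsupp.add_apply, Finsupp.single_eq_same, add_assoc β, ← Finsupp.single_add,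
    add_assoc (β l), nsmul_eq_mul, ← mul_assoc, ← mul_assoc, ← Nat.cast_mul, ← Nat.cast_mul]
  congr 2
  have h := Nat.choose_mul (n := β l + (m + i)) (k := m + i) (s := i) (by omega)
  rw [Nat.add_sub_cancel, ← Nat.add_assoc, Nat.add_sub_cancel, Nat.add_assoc] at h
  rw [mul_comm, ← h, mul_comm, Nat.choose_symm_add]

theorem hasseOp_comm (l j : Fin n) (m i : ℕ) :
    hasseOp k l m * hasseOp k j i = hasseOp k j i * hasseOp k l m := by
  rcases eq_or_ne l j with rfl | h
  · rw [hasseOp_mul_self, hasseOp_mul_self, add_comm i m, Nat.choose_symm_add]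
  · refine LinearMap.ext fun f => funext fun β => ?_
    simp only [Module.End.mul_apply, hasseOp_apply, Finsupp.add_apply]
    rw [Finsupp.single_eq_of_ne h.symm, Finsupp.single_eq_of_ne h, add_zero, add_zero,
      add_right_comm, mul_left_comm]

theorem hasseOp_zero (l : Fin n) : hasseOp k l 0 = 1 := by
  refine LinearMap.ext fun f => funext fun β => ?_
  simp [hasseOp_apply]

theorem list_prod_hasseOp_apply {l : List (Fin n)} (hl : l.Nodup) (α : Fin n → ℕ)
    (f : (Fin n →₀ ℕ) → k) (β : Fin n →₀ ℕ) (hβ : ∀ i ∈ l, β i = 0) :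
    (l.map fun i => hasseOp k i (α i)).prod f β =
      f (β + (l.map fun i => Finsupp.single i (α i)).sum) := by
  induction l generalizing β with
  | nil => simp
  | cons i l ih =>
    rw [List.map_cons, List.prod_cons, List.map_cons, List.sum_cons, Module.End.mul_apply,
      hasseOp_apply, hβ i List.mem_cons_self, zero_add, Nat.choose_self, Nat.cast_one, one_mul,
      ih hl.of_cons, add_assoc]
    intro j hj
    have hij : j ≠ i := fun h => (List.nodup_cons.1 hl).1 (h ▸ hj)
    rw [Finsupp.add_apply, hβ j (List.mem_cons_of_mem _ hj), Finsupp.single_eq_of_ne hij,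
      add_zero]

variable (b : Module.Basis (Fin n) k U)

/-- The monomials in the divided powers of the elements of a basis. -/
def dpMonomial (α : Fin n →₀ ℕ) : DividedPowerAlgebra k U :=
  α.prod fun i m => DividedPowerAlgebra.dp k m (b i)

theorem dpMonomial_eq_list_prod (α : Fin n →₀ ℕ) : dpMonomial b α =
    ((List.finRange n).map fun i => DividedPowerAlgebra.dp k (α i) (b i)).prod := by
  rw [dpMonomial, Finsupp.prod_fintype _ _ fun i => DividedPowerAlgebra.dp_zero, ← List.ofFn_eq_map,
    List.prod_ofFn]

/-- The Hasse operators are the transposes of the expected multiplications by divided powers. They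
commute and satisfy the divided power rule, so the divided power algebra acts through them; the
monomial of exponent α takes f to a function with value f(α) at 0. Testing on indicator functions
gives functionals dual to the monomials. -/
theorem linearIndependent_dpMonomial : LinearIndependent k (dpMonomial b) := by
  classical
  let S : Set (Module.End k ((Fin n →₀ ℕ) → k)) := Set.range fun q : Fin n × ℕ => hasseOp k q.1 q.2
  let _ : CommRing (Algebra.adjoin k S) :=
    { (Algebra.adjoin k S).toRing with
      mul_comm := (Algebra.isMulCommutative_adjoin k (by
        rintro _ ⟨p, rfl⟩ _ ⟨q, rfl⟩
        exact hasseOp_comm _ _ _ _)).is_comm.comm }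
  let h (l : Fin n) (m : ℕ) : Algebra.adjoin k S :=
    ⟨hasseOp k l m, Algebra.subset_adjoin ⟨(l, m), rfl⟩⟩
  obtain ⟨Φ, hΦ⟩ := exists_dividedPowerAlgebra_hom (C := Algebra.adjoin k S) b
    (s := fun l => PowerSeries.mk (h l)) (fun l => by
      refine ⟨?_, fun m i => ?_⟩
      · rw [PowerSeries.coeff_mk]
        exact Subtype.ext (hasseOp_zero l)
      · rw [PowerSeries.coeff_mk, PowerSeries.coeff_mk, PowerSeries.coeff_mk]
        exact Subtype.ext (hasseOp_mul_self l m i))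
  have hα (α : Fin n →₀ ℕ) (f : (Fin n →₀ ℕ) → k) : (Φ (dpMonomial b α)).1 f 0 = f α := by
    have h1 : (Φ (dpMonomial b α)).1 =
        ((List.finRange n).map fun i => hasseOp k i (α i)).prod := by
      rw [dpMonomial_eq_list_prod, map_list_prod, List.map_map]
      refine (map_list_prod (Algebra.adjoin k S).val _).trans ?_
      rw [List.map_map]
      refine congrArg _ (List.map_congr_left fun i _ => ?_)
      refine (congrArg Subtype.val (hΦ (α i) i)).trans ?_
      rw [PowerSeries.coeff_mk]
    rw [h1, list_prod_hasseOp_apply (List.nodup_finRange n) _ _ _ fun _ _ => rfl, zero_add,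
      ← List.ofFn_eq_map, List.sum_ofFn, Finsupp.univ_sum_single]
  refine LinearIndependent.of_pairwise_dual_eq_zero_one _ (fun γ =>
    LinearMap.proj (φ := fun _ : Fin n →₀ ℕ => k) 0 ∘ₗ LinearMap.applyₗ (Pi.single γ (1 : k)) ∘ₗ
      (Algebra.adjoin k S).val.toLinearMap ∘ₗ Φ.toLinearMap) ?_ ?_
  · intro γ α hne
    exact (hα α _).trans (Pi.single_eq_of_ne hne.symm _)
  · intro γ
    exact (hα γ _).trans (Pi.single_eq_same _ _)

/-- The divided powers of sums and multiples reduce x to a basis vector b l. Its divided power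
merges with the factor of the same index up to an integer. -/
theorem mul_dp_mem_span_dpMonomial (x : U) (i m : ℕ) {y : DividedPowerAlgebra k U}
    (hy : y ∈ Submodule.span k (dpMonomial b '' {α | α.degree = m})) :
    y * DividedPowerAlgebra.dp k i x ∈
      Submodule.span k (dpMonomial b '' {α | α.degree = m + i}) := by
  have hx : x ∈ Submodule.span k (Set.range b) := by rw [b.span_eq]; trivial
  induction hx using Submodule.span_induction generalizing y i m with
  | zero =>
    rw [DividedPowerAlgebra.dp_null]
    split_ifs with h
    · rwa [h, mul_one, add_zero]
    · rw [mul_zero]; exact zero_mem _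
  | smul c x _ ih =>
    rw [DividedPowerAlgebra.dp_smul, mul_smul_comm]
    exact Submodule.smul_mem _ _ (ih i m hy)
  | add x x' _ _ ih ih' =>
    rw [DividedPowerAlgebra.dp_add, Finset.mul_sum]
    refine Submodule.sum_mem _ fun p hp => ?_
    rw [← mul_assoc, ← Finset.HasAntidiagonal.mem_antidiagonal.1 hp, ← add_assoc]
    exact ih' _ _ (ih _ _ hy)
  | mem x hx =>
    obtain ⟨l, rfl⟩ := hx
    induction hy using Submodule.span_induction with
    | zero => rw [zero_mul]; exact zero_mem _
    | add y z _ _ hy hz => rw [add_mul]; exact add_mem hy hz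
    | smul c y _ hy => rw [smul_mul_assoc]; exact Submodule.smul_mem _ _ hy
    | mem y hy =>
      obtain ⟨α, hα, rfl⟩ := hy
      rw [dpMonomial, ← α.mul_prod_erase' l _ fun i => DividedPowerAlgebra.dp_zero, mul_comm,
        ← mul_assoc, DividedPowerAlgebra.dp_mul, nsmul_eq_mul, mul_assoc, ← nsmul_eq_mul]
      refine Submodule.smul_of_tower_mem _ _
        (Submodule.subset_span ⟨Finsupp.single l i + α, ?_, ?_⟩)
      · rw [Set.mem_ofPred_eq] at hα ⊢
        rw [map_add, Finsupp.degree_single, hα, add_comm]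
      · rw [dpMonomial, ← (Finsupp.single l i + α).mul_prod_erase' l _
          fun i => DividedPowerAlgebra.dp_zero]
        simp

theorem dividedPower_eq_span (m : ℕ) :
    dividedPower k U m = Submodule.span k (dpMonomial b '' {α | α.degree = m}) := by
  refine le_antisymm (Submodule.span_le.2 ?_) (Submodule.span_le.2 ?_)
  · rintro _ ⟨s, rfl, rfl⟩
    induction s using Multiset.induction_on with
    | empty => exact Submodule.subset_span ⟨0, by simp, by simp [dpMonomial]⟩
    | cons q s ih =>
      rw [Multiset.map_cons, Multiset.sum_cons, Multiset.map_cons, Multiset.prod_cons, mul_comm,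
        add_comm]
      exact mul_dp_mem_span_dpMonomial b q.2 q.1 _ ih
  · rintro _ ⟨α, rfl, rfl⟩
    refine Submodule.subset_span ⟨Finset.univ.val.map fun l => (α l, b l), ?_, ?_⟩
    · rw [Multiset.map_map, Finsupp.degree_eq_sum]
      rfl
    · rw [Multiset.map_map, dpMonomial,
        Finsupp.prod_fintype _ _ fun i => DividedPowerAlgebra.dp_zero]
      rfl

theorem homogeneousSubmodule_eq_span (J : Type*) (m : ℕ) :
    MvPolynomial.homogeneousSubmodule J k m = Submodule.span k
      (MvPolynomial.basisMonomials J k '' {α | α.degree = m}) := by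
  refine le_antisymm (fun p hp => ?_) (Submodule.span_le.2 ?_)
  · rw [← MvPolynomial.support_sum_monomial_coeff p]
    refine Submodule.sum_mem _ fun α hα => ?_
    have : MvPolynomial.monomial α (p.coeff α) =
        p.coeff α • MvPolynomial.basisMonomials J k α := by
      rw [MvPolynomial.coe_basisMonomials, MvPolynomial.smul_monomial, smul_eq_mul, mul_one]
    rw [this]
    refine Submodule.smul_mem _ _ (Submodule.subset_span ⟨α, ?_, rfl⟩)
    by_contra hne
    exact MvPolynomial.mem_support_iff.1 hα (MvPolynomial.IsHomogeneous.coeff_eq_zero hp hne)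
  · rintro _ ⟨α, rfl, rfl⟩
    exact MvPolynomial.isHomogeneous_monomial _ rfl

/-- Both spaces have a basis indexed by the exponents of degree m. Only this count is needed, not
the natural duality. -/
theorem nonempty_dividedPower_equiv_symDeg [FiniteDimensional k U] (m : ℕ) :
    Nonempty (dividedPower k U m ≃ₗ[k] symDeg k (Module.Dual k U) m) := by
  let b := Module.finBasis k U
  have h1 := (linearIndependent_dpMonomial b).comp (Subtype.val : {α | α.degree = m} → _)
    Subtype.val_injective
  have h2 := (MvPolynomial.basisMonomials (Fin (Module.finrank k U)) k).linearIndependent.comp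
    (Subtype.val : {α | α.degree = m} → _) Subtype.val_injective
  have h3 : Submodule.span k (Set.range (dpMonomial b ∘ Subtype.val : {α | α.degree = m} → _)) =
      dividedPower k U m := by
    rw [dividedPower_eq_span b, Set.range_comp, Subtype.range_val]
  have h4 : Submodule.span k (Set.range (MvPolynomial.basisMonomials _ k ∘ Subtype.val :
      {α : Fin (Module.finrank k U) →₀ ℕ | α.degree = m} → _)) =
      (symDeg k (Module.Dual k U) m).map
        (SymmetricAlgebra.equivMvPolynomial b.dualBasis).toLinearEquiv.toLinearMap := by
    refine Eq.trans ?_ (map_symDeg b.dualBasis m).symm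
    rw [homogeneousSubmodule_eq_span, Set.range_comp, Subtype.range_val]
  exact ⟨(LinearEquiv.ofEq _ _ h3).symm ≪≫ₗ
    (Module.Basis.span h1).equiv (Module.Basis.span h2) (Equiv.refl _) ≪≫ₗ
    LinearEquiv.ofEq _ _ h4 ≪≫ₗ
    ((SymmetricAlgebra.equivMvPolynomial b.dualBasis).toLinearEquiv.submoduleMap _).symm⟩

end DividedPowerBasis

/-! ### The terms of the irredundant complex of a pairing -/

section Terms

variable {k : Type u} [Field k] {V W U : Type u} [AddCommGroup V] [Module k V]
  [AddCommGroup W] [Module k W] [AddCommGroup U] [Module k U]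

theorem linQuotient_bijective [FiniteDimensional k V] {Q : ExtMod k V} {i : ℕ}
    (h : Q.gen i = ⊤) : Function.Bijective ((linQuotient Q).app i).toLin :=
  (TensorProduct.AlgebraTensorModule.congr
    (LinearEquiv.refl (SymmetricAlgebra k V) (SymmetricAlgebra k V))
    (LinearEquiv.ofTop (Q.gen i) h).dualMap).bijective

instance finiteDimensional_symDeg [FiniteDimensional k V] (m : ℕ) :
    FiniteDimensional k (symDeg k V m) :=
  Module.Finite.iff_fg.2 (Submodule.FG.pow (Module.Finite.iff_fg.1 inferInstance) m)

theorem finrank_exteriorPower_dual [FiniteDimensional k W] (m : ℕ) :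
    Module.finrank k (⋀[k]^m (Module.Dual k W)) = (Module.finrank k W).choose m := by
  rw [exteriorPower.finrank_eq, Subspace.dual_finrank_eq]

/-- The inclusion of `W^*` as the piece of degree `0`. -/
def dualToPiece (k : Type u) [Field k] (W U : Type u) [AddCommGroup W] [Module k W]
    [AddCommGroup U] [Module k U] : Module.Dual k W →ₗ[k]
      ⋀[k]^(0 + 1) (Module.Dual k W) ⊗[k] symDeg k (Module.Dual k U) 0 :=
  (TensorProduct.mk k _ _).flip ⟨1, one_mem_symDeg⟩ ∘ₗ
    (ExteriorAlgebra.ι k).codRestrict (⋀[k]^(0 + 1) (Module.Dual k W)) fun _ => by simp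

theorem dualToPiece_bijective : Function.Bijective (dualToPiece k W U) := by
  constructor
  · refine (injective_iff_map_eq_zero _).2 fun α hα => ?_
    let g : ⋀[k]^(0 + 1) (Module.Dual k W) ⊗[k] symDeg k (Module.Dual k U) 0 →ₗ[k]
        ExteriorAlgebra k (Module.Dual k W) :=
      TensorProduct.lift ((LinearMap.lsmul k _).flip.compl₁₂ (Submodule.subtype _)
        (SymmetricAlgebra.algebraMapInv.toLinearMap ∘ₗ Submodule.subtype _))
    have h1 : g (dualToPiece k W U α) = ExteriorAlgebra.ι k α := by
      change SymmetricAlgebra.algebraMapInv (1 : SymmetricAlgebra k (Module.Dual k U)) •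
        ExteriorAlgebra.ι k α = _
      rw [map_one, one_smul]
    rw [hα, LinearMap.map_zero] at h1
    exact (ExteriorAlgebra.ι_eq_zero_iff α).1 h1.symm
  · intro y
    induction y with
    | zero => exact ⟨0, map_zero _⟩
    | add y z hy hz =>
      obtain ⟨α, rfl⟩ := hy
      obtain ⟨β, rfl⟩ := hz
      exact ⟨α + β, map_add _ _ _⟩
    | tmul x g =>
      obtain ⟨x, hx⟩ := x
      obtain ⟨g, hg⟩ := g
      obtain ⟨α, rfl⟩ : ∃ α, ExteriorAlgebra.ι k α = x := by simpa using hx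
      obtain ⟨c, rfl⟩ := Submodule.mem_one.1 (by simpa [symDeg] using hg)
      refine ⟨c • α, ?_⟩
      rw [map_smul]
      refine (TensorProduct.tmul_smul c _ _).symm.trans ?_
      exact congrArg _ (Subtype.ext (Algebra.algebraMap_eq_smul_one c).symm)

theorem wedgeSym_tmul_dualToPiece (α : Module.Dual k W) (β : Module.Dual k U) :
    wedgeSym k (Module.Dual k W) (Module.Dual k U) 0 (α ⊗ₜ β) (dualToPiece k W U α) = 0 := by
  have h : wedgeLeft k (Module.Dual k W) (0 + 1) α
      ((ExteriorAlgebra.ι k).codRestrict (⋀[k]^(0 + 1) (Module.Dual k W)) (fun _ => by simp) α) =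
      0 := Subtype.ext (ExteriorAlgebra.ι_sq_zero _)
  refine (wedgeSym_tmul 0 α β _ _).trans ?_
  rw [h, TensorProduct.zero_tmul]

variable [FiniteDimensional k W] [FiniteDimensional k U]
  (μ : W →ₗ[k] U →ₗ[k] V)

theorem subsingleton_irredundantPairingComplex [FiniteDimensional k V] {i : ℕ} (hi : Module.finrank k W ≤ i) :
    Subsingleton ((irredundantPairingComplex μ).X i) := by
  have h1 : Subsingleton (⋀[k]^(i + 1) (Module.Dual k W)) := by
    rw [← Module.finrank_eq_zero_iff_of_free (R := k), finrank_exteriorPower_dual,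
      Nat.choose_eq_zero_of_lt (by omega)]
  have h2 : Subsingleton ((pairingMod μ).piece i) :=
    inferInstanceAs (Subsingleton
      (⋀[k]^(i + 1) (Module.Dual k W) ⊗[k] symDeg k (Module.Dual k U) i))
  have h3 : Subsingleton (Module.Dual k ((pairingMod μ).gen i)) :=
    ⟨fun p q => LinearMap.ext fun x => by rw [Subsingleton.elim x 0, map_zero, map_zero]⟩
  exact (inferInstance :
    Subsingleton (SymmetricAlgebra k V ⊗[k] Module.Dual k ((pairingMod μ).gen i)))

theorem gen_finrank_sub_one_eq_top [FiniteDimensional k V] {μ : W →ₗ[k] U →ₗ[k] V} (h : IsGeometricallyOneGeneric μ)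
    (hW : 0 < Module.finrank k W) : (pairingMod μ).gen (Module.finrank k W - 1) = ⊤ :=
  gen_eq_top_of_isGeometricallyOneGeneric μ h (Nat.sub_add_cancel hW).symm

instance finiteDimensional_piece (m : ℕ) : FiniteDimensional k ((pairingMod μ).piece m) :=
  inferInstanceAs (Module.Finite k
    (⋀[k]^(m + 1) (Module.Dual k W) ⊗[k] symDeg k (Module.Dual k U) m))

theorem finrank_piece (m : ℕ) : Module.finrank k ((pairingMod μ).piece m) =
    (Module.finrank k W).choose (m + 1) * Module.finrank k (symDeg k (Module.Dual k U) m) := by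
  rw [← finrank_exteriorPower_dual]
  exact Module.finrank_tensorProduct

theorem irredundantPairingComplex_X_isomorphic [FiniteDimensional k V] {μ : W →ₗ[k] U →ₗ[k] V}
    (h : IsGeometricallyOneGeneric μ) (hW : 0 < Module.finrank k W) :
    GrMod.Isomorphic ((irredundantPairingComplex μ).X (Module.finrank k W - 1))
      (freeGr k V (⋀[k]^(Module.finrank k W) W ⊗[k] dividedPower k U (Module.finrank k W - 1))
        ((Module.finrank k W : ℤ) - 1)) := by
  obtain ⟨e⟩ := nonempty_dividedPower_equiv_symDeg (k := k) (U := U) (Module.finrank k W - 1)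
  have hrank : Module.finrank k
        (Module.Dual k ((pairingMod μ).gen (Module.finrank k W - 1))) =
      Module.finrank k (⋀[k]^(Module.finrank k W) W ⊗[k]
        symDeg k (Module.Dual k U) (Module.finrank k W - 1)) := by
    rw [Subspace.dual_finrank_eq, gen_finrank_sub_one_eq_top h hW, finrank_top, finrank_piece,
      Nat.sub_add_cancel hW, Module.finrank_tensorProduct, exteriorPower.finrank_eq]
  -- An abstract isomorphism of generator spaces suffices, since both modules are free on generators
  -- of the same degree.
  obtain ⟨ψ⟩ := FiniteDimensional.nonempty_linearEquiv_of_finrank_eq hrank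
  let φ := ψ ≪≫ₗ (TensorProduct.congr (LinearEquiv.refl k (⋀[k]^(Module.finrank k W) W)) e).symm
  rw [← Nat.cast_pred hW]
  exact freeGr_isomorphic (V := V) (P := Module.Dual k ((pairingMod μ).gen (Module.finrank k W - 1)))
    (P' := ⋀[k]^(Module.finrank k W) W ⊗[k] dividedPower k U (Module.finrank k W - 1)) φ
    ((Module.finrank k W - 1 : ℕ) : ℤ)

/-- The piece of degree `0` is `W^*`. -/
def dualGenZeroEquiv : Module.Dual k W ≃ₗ[k] (pairingMod μ).gen 0 :=
  (LinearEquiv.ofBijective (dualToPiece k W U) dualToPiece_bijective :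
    Module.Dual k W ≃ₗ[k] (pairingMod μ).piece 0) ≪≫ₗ (LinearEquiv.ofTop _ rfl).symm

/-- The dual of the piece of degree `0` is `W`. -/
def dualGenEquiv : Module.Dual k ((pairingMod μ).gen 0) ≃ₗ[k] W :=
  (dualGenZeroEquiv μ).dualMap ≪≫ₗ (Module.evalEquiv k W).symm

theorem apply_dualGenEquiv (p : Module.Dual k ((pairingMod μ).gen 0)) (α : Module.Dual k W) :
    α (dualGenEquiv μ p) = p (dualGenZeroEquiv μ α) :=
  Module.apply_evalEquiv_symm_apply k W α _

theorem irredundantPairingComplex_X_zero_isomorphic [FiniteDimensional k V] :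
    GrMod.Isomorphic ((irredundantPairingComplex μ).X 0) (freeGr k V W 0) :=
  freeGr_isomorphic (dualGenEquiv μ) 0

/-- The action of `V^*` on the generators of the module of a pairing. -/
def genAct (ξ : Module.Dual k V) : (pairingMod μ).gen 0 →ₗ[k] (pairingMod μ).gen 1 :=
  (pairingMod μ).generated.act 0 ξ

theorem dualPairing_eq_sum_sum {I : Type*} [Fintype I] (a : Module.Basis I k W) {n : ℕ}
    (b : Module.Basis (Fin n) k U) (ξ : Module.Dual k V) :
    dualPairing μ ξ = ∑ l, ∑ m, ξ (μ (a m) (b l)) • (a.coord m ⊗ₜ[k] b.coord l) := by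
  rw [dualPairing_eq_sum b]
  refine Finset.sum_congr rfl fun l _ => ?_
  have h : ξ ∘ₗ μ.flip (b l) = ∑ m, ξ (μ (a m) (b l)) • a.coord m :=
    (a.sum_dual_apply_smul_coord (ξ ∘ₗ μ.flip (b l))).symm
  rw [h, TensorProduct.sum_tmul]
  rfl

/-- An alternating matrix pairs to zero with a symmetric one. Vanishing of the diagonal is a
separate hypothesis, as antisymmetry does not imply it in characteristic 2. -/
theorem sum_smul_eq_zero_of_antisymm {N I : Type*} [AddCommGroup N] [Module k N] [Fintype I]
    {P : I → I → k} {c : I → I → N} (hP : ∀ m i, P m i = -P i m) (hP' : ∀ m, P m m = 0)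
    (hc : ∀ i m, c i m = c m i) : ∑ i, ∑ m, P m i • c i m = 0 := by
  rw [← Finset.sum_product', Finset.univ_product_univ]
  refine Finset.sum_involution (fun q _ => q.swap) ?_ ?_ (by simp) (by simp)
  · rintro ⟨i, m⟩ -
    dsimp only [Prod.swap]
    rw [hP i m, hc m i, neg_smul, add_neg_cancel]
  · rintro ⟨i, m⟩ - hne e
    obtain rfl : m = i := congrArg Prod.fst e
    exact hne (by dsimp only; rw [hP', zero_smul])

/-- An alternating form on `W^*` with values in the dual of `U^*` gives a linear syzygy. -/
theorem sum_eq_zero_of_alternating {N : Type*} [AddCommGroup N] [Module k N]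
    (B : W →ₗ[k] V →ₗ[k] N) (hB : ∀ a a' u, B a (μ a' u) = B a' (μ a u))
    (Φ : Module.Dual k W →ₗ[k] Module.Dual k W ⊗[k] Module.Dual k U →ₗ[k] k)
    (hΦ : ∀ α β, Φ α (α ⊗ₜ β) = 0) (y : Module.Dual k V → W)
    (hy : ∀ α ξ, α (y ξ) = Φ α (dualPairing μ ξ))
    {J : Type*} [Fintype J] (x : Module.Basis J k V) :
    ∑ j, B (y (x.coord j)) (x j) = 0 := by
  let a := Module.finBasis k W
  let b := Module.finBasis k U
  -- For each l an alternating matrix: the coordinates of an element of ∧²W ⊗ U. The sum becomes its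
  -- pairing with a_i · μ(a_m, b_l), which is symmetric in i and m.
  let P (l m i) : k := Φ (a.coord i) (a.coord m ⊗ₜ b.coord l)
  have hP (l m i) : P l m i = -P l i m := by
    have := hΦ (a.coord i + a.coord m) (b.coord l)
    rw [TensorProduct.add_tmul, map_add, map_add, LinearMap.add_apply, LinearMap.add_apply,
      hΦ, hΦ, zero_add, add_zero] at this
    exact eq_neg_of_add_eq_zero_right this
  have h4 (ξ : Module.Dual k V) :
      y ξ = ∑ i, ∑ l, ∑ m, (ξ (μ (a m) (b l)) * P l m i) • a i := by
    conv_lhs => rw [← a.sum_repr (y ξ)]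
    refine Finset.sum_congr rfl fun i _ => ?_
    have := hy (a.coord i) ξ
    rw [Module.Basis.coord_apply, dualPairing_eq_sum_sum μ a b] at this
    rw [this]
    simp only [map_sum, map_smul, smul_eq_mul, Finset.sum_smul, P]
  have h6 (i m l) : B (a i) (μ (a m) (b l)) =
      ∑ j, x.coord j (μ (a m) (b l)) • B (a i) (x j) := by
    conv_lhs => rw [← x.sum_repr (μ (a m) (b l)), map_sum]
    simp only [map_smul, Module.Basis.coord_apply]
  have h7 (j) : B (y (x.coord j)) (x j) =
      ∑ i, ∑ l, ∑ m, P l m i • x.coord j (μ (a m) (b l)) • B (a i) (x j) := by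
    rw [h4]
    simp only [map_sum, map_smul, LinearMap.sum_apply, LinearMap.smul_apply, smul_smul, mul_comm]
  have h8 : ∑ j, B (y (x.coord j)) (x j) =
      ∑ l, ∑ i, ∑ m, P l m i • B (a i) (μ (a m) (b l)) := by
    rw [Finset.sum_congr rfl fun j _ => h7 j, Finset.sum_comm,
      Finset.sum_comm (s := Finset.univ (α := Fin (Module.finrank k U)))]
    refine Finset.sum_congr rfl fun i _ => ?_
    rw [Finset.sum_comm]
    refine Finset.sum_congr rfl fun l _ => ?_
    rw [Finset.sum_comm]
    refine Finset.sum_congr rfl fun m _ => ?_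
    rw [h6, Finset.smul_sum]
  rw [h8]
  exact Finset.sum_eq_zero fun l _ => sum_smul_eq_zero_of_antisymm (hP l)
    (fun m => hΦ _ _) fun i m => hB _ _ _

/-- The linear syzygies given by the linear forms on the piece of degree `1`. -/
theorem sum_dualGenEquiv_eq_zero {N : Type*} [AddCommGroup N] [Module k N]
    (B : W →ₗ[k] V →ₗ[k] N) (hB : ∀ a a' u, B a (μ a' u) = B a' (μ a u))
    {J : Type*} [Fintype J] (x : Module.Basis J k V) (p : Module.Dual k ((pairingMod μ).gen 1)) :
    ∑ j, B (dualGenEquiv μ (p ∘ₗ genAct μ (x.coord j))) (x j) = 0 := by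
  -- The form is extended to all of ∧²W^* ⊗ Sym_1(U^*), where its alternating nature is visible.
  obtain ⟨q₀, hq⟩ := p.exists_extend
  let q : ⋀[k]^(0 + 1 + 1) (Module.Dual k W) ⊗[k] symDeg k (Module.Dual k U) (0 + 1) →ₗ[k] k := q₀
  let Φ : Module.Dual k W →ₗ[k] Module.Dual k W ⊗[k] Module.Dual k U →ₗ[k] k :=
    ((wedgeSym k (Module.Dual k W) (Module.Dual k U) 0).compr₂ q).flip ∘ₗ dualToPiece k W U
  refine sum_eq_zero_of_alternating μ B hB Φ (fun α β => ?_)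
    (fun ξ => dualGenEquiv μ (p ∘ₗ genAct μ ξ)) (fun α ξ => ?_) x
  · change q (wedgeSym k (Module.Dual k W) (Module.Dual k U) 0 (α ⊗ₜ β) (dualToPiece k W U α)) = 0
    rw [wedgeSym_tmul_dualToPiece, map_zero]
  · refine (apply_dualGenEquiv μ _ α).trans ?_
    exact (LinearMap.congr_fun hq (genAct μ ξ (dualGenZeroEquiv μ α))).symm

end Terms

/-! ### Multiplication of sections -/

section Sections

variable {X : Scheme.{u}}

/-- Locally a = c e and a' = c' e for a generator e of L, so both sides are c c' times the same
section. -/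
theorem mulSection_left_comm {L : X.Modules} (hL : IsLineBundle L) (N : X.Modules)
    (a a' : Γ(L, ⊤)) (s : Γ(N, ⊤)) :
    mulSection L (tensor L N) ⊤ a (mulSection L N ⊤ a' s) =
      mulSection L (tensor L N) ⊤ a' (mulSection L N ⊤ a s) := by
  refine section_ext _ _ _ fun x _ => ?_
  obtain ⟨U, hxU, e, H⟩ := hL x
  refine ⟨U, le_top, hxU, ?_⟩
  obtain ⟨c, hc⟩ := (H U le_rfl).2 (res L le_top a)
  obtain ⟨c', hc'⟩ := (H U le_rfl).2 (res L le_top a')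
  dsimp only at hc hc'
  rw [res_mul, res_mul, res_mul, res_mul, ← hc, ← hc']
  simp only [map_smul, LinearMap.smul_apply]
  rw [smul_comm]

variable {k : Type u} [Field k] (f : X ⟶ Spec (CommRingCat.of k))

theorem IsGeometricallyOneGeneric.seriesPairing {L N : X.Modules} {W : Submodule k (H0 f L)}
    {U : Submodule k (H0 f N)}
    (hgen : IsGeometricallyOneGeneric ((mulH0 f L N).domRestrict₁₂ W U))
    {V : Submodule k (H0 f (tensor L N))} (h : ∀ a ∈ W, ∀ b ∈ U, mulH0 f L N a b ∈ V) :
    IsGeometricallyOneGeneric (seriesPairing f h) := by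
  intro a b ha hb h0
  refine hgen a b ha hb ?_
  have h1 : TensorProduct.lift ((mulH0 f L N).domRestrict₁₂ W U) =
      V.subtype ∘ₗ TensorProduct.lift (LinSyz.seriesPairing f h) :=
    TensorProduct.ext' fun _ _ => rfl
  rw [h1, LinearMap.baseChange_comp, LinearMap.comp_apply, h0, map_zero]

/-- The generators W of the first term map to M_0. The linear relations carried by the second term
hold in M because multiplication by sections of L is commutative, so the general embedding theorem
for generated modules applies. -/
theorem irredundantPairingComplex_isDegreewiseSummand {L L' : X.Modules} (hL : IsLineBundle L)
    (hL' : IsLineBundle L') {W : Submodule k (H0 f L)} {U : Submodule k (H0 f L')}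
    [FiniteDimensional k W] [FiniteDimensional k U] {V : Submodule k (H0 f (tensor L L'))}
    [FiniteDimensional k V] (μ : W →ₗ[k] U →ₗ[k] V)
    (hμ : ∀ a u, (μ a u : H0 f (tensor L L')) = mulH0 f L L' a u)
    {M : Submodule (SymmetricAlgebra k V) (sectionModule f L hL hL' V)}
    (hWM : ∀ a ∈ W, DirectSum.lof k ℕ (fun n => H0 f (twist L (tensor L L') n)) 0 a ∈ M)
    {G : GrComplex.{u, v} k V} {ε : GrHom (G.X 0) (sectionModule f L hL hL' V)}
    (hG : IsMinimalFreeResolution M G ε) :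
    IsDegreewiseSummand (irredundantPairingComplex μ) G := by
  let φ : Module.Dual k ((pairingMod μ).gen 0) →ₗ[k] ⨁ n, H0 f (twist L (tensor L L') n) :=
    DirectSum.lof k ℕ (fun n => H0 f (twist L (tensor L L') n)) 0 ∘ₗ W.subtype ∘ₗ
      (dualGenEquiv μ).toLinearMap
  have hφ (p : Module.Dual k ((pairingMod μ).gen 1)) :
      ∑ j, sectionMul f L (tensor L L') V (Module.finBasis k V j)
        (φ (p ∘ₗ genAct μ ((Module.finBasis k V).coord j))) = 0 := by
    let B : W →ₗ[k] V →ₗ[k] H0 f (tensor L (tensor L L')) :=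
      (mulH0 f L (tensor L L')).domRestrict₁₂ W V
    have hB (a a' : W) (u : U) : B a (μ a' u) = B a' (μ a u) := by
      change mulH0 f L (tensor L L') a (μ a' u) = mulH0 f L (tensor L L') a' (μ a u)
      rw [hμ, hμ]
      exact mulSection_left_comm hL L' a.1 a'.1 u.1
    have h1 := sum_dualGenEquiv_eq_zero μ B hB (Module.finBasis k V) p
    have h2 := (congrArg (DirectSum.lof k ℕ (fun n => H0 f (twist L (tensor L L') n)) (0 + 1))
      h1).trans (LinearMap.map_zero _)
    refine Eq.trans ?_ h2
    refine Eq.trans ?_ (map_sum (DirectSum.lof k ℕ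
      (fun n => H0 f (twist L (tensor L L') n)) (0 + 1)) _ _).symm
    exact Finset.sum_congr rfl fun j _ => sectionMul_lof f L (tensor L L') V _ 0 _
  have hneg : ∀ n < 0, ∀ x ∈ (sectionModule f L hL hL' V).deg n, x ∈ M → x = 0 := by
    intro n hn x hx _
    have : sectionDeg f L (tensor L L') n = ⊥ := by
      rw [sectionDeg, iSup_eq_bot]
      intro m
      exact iSup_eq_bot.2 fun hm => absurd hm (by omega)
    change x ∈ sectionDeg f L (tensor L L') n at hx
    rw [this] at hx
    exact hx
  have hinj : Function.Injective φ :=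
    (DirectSum.of_injective (β := fun n => H0 f (twist L (tensor L L') n)) 0).comp
      (Subtype.val_injective.comp (dualGenEquiv μ).injective)
  have hdeg (p) : φ p ∈ sectionDeg f L (tensor L L') 0 :=
    Submodule.mem_iSup_of_mem 0 (Submodule.mem_iSup_of_mem rfl ⟨_, rfl⟩)
  exact (pairingMod μ).generated_isGenerated.isDegreewiseSummand hG hneg φ hinj hdeg
    (fun p => hWM _ (dualGenEquiv μ p).2) fun p => by
      refine Eq.trans (Finset.sum_congr rfl fun j _ => ?_) (hφ p)
      change symAction (sectionMul f L _ V) (sectionMul_comm f hL hL' L V)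
        (SymmetricAlgebra.ι k V _) _ = _
      rw [symAction_ι]
      rfl

end Sections

end LinSyz

end

/-! ### Assembly of the theorem. -/

theorem theorem3p3 {k : Type u} [Field k] {X : Scheme.{u}} (f : X ⟶ Spec (CommRingCat.of k))
    (L L' : X.Modules) (hL : IsLineBundle L) (hL' : IsLineBundle L')
    (W : Submodule k (H0 f L)) (U : Submodule k (H0 f L'))
    [FiniteDimensional k W] [FiniteDimensional k U] (hW : W ≠ ⊥) (hU : U ≠ ⊥)
    (hgen : IsGeometricallyOneGeneric ((mulH0 f L L').domRestrict₁₂ W U))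
    (V : Submodule k (H0 f (tensor L L'))) [FiniteDimensional k V]
    (hV : ∀ a ∈ W, ∀ b ∈ U, mulH0 f L L' a b ∈ V)
    (M : Submodule (SymmetricAlgebra k V) (sectionModule f L hL hL' V))
    (hM : (sectionModule f L hL hL' V).IsHomogeneous M) (hfg : M.FG)
    (hWM : ∀ a ∈ W, DirectSum.lof k ℕ (fun n => H0 f (twist L (tensor L L') n)) 0 a ∈ M) :
    IsMaximalIrredundantQuotient (pairingQuotient (seriesPairing f hV)) ∧
    GrMod.Isomorphic ((irredundantPairingComplex (seriesPairing f hV)).X 0) (freeGr k V W 0) ∧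
    Function.Bijective
      ((pairingQuotient (seriesPairing f hV)).app (Module.finrank k W - 1)).toLin ∧
    GrMod.Isomorphic
      ((irredundantPairingComplex (seriesPairing f hV)).X (Module.finrank k W - 1))
      (freeGr k V (⋀[k]^(Module.finrank k W) W ⊗[k] dividedPower k U (Module.finrank k W - 1))
        ((Module.finrank k W : ℤ) - 1)) ∧
    (∀ i, Module.finrank k W ≤ i →
      Subsingleton ((irredundantPairingComplex (seriesPairing f hV)).X i)) ∧
    ∀ (G : GrComplex.{u, v} k V) (ε : GrHom (G.X 0) (sectionModule f L hL hL' V)),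
      IsMinimalFreeResolution M G ε →
        IsDegreewiseSummand (irredundantPairingComplex (seriesPairing f hV)) G := by
  have hμ := hgen.seriesPairing f hV
  have hw : 0 < Module.finrank k W := Module.finrank_pos_iff.2 (Submodule.nontrivial_iff_ne_bot.2 hW)
  exact ⟨linQuotient_isMaximalIrredundantQuotient _,
    irredundantPairingComplex_X_zero_isomorphic _,
    linQuotient_bijective (gen_finrank_sub_one_eq_top hμ hw),
    irredundantPairingComplex_X_isomorphic hμ hw,
    fun _ hi => subsingleton_irredundantPairingComplex _ hi,
    fun _ _ hG => irredundantPairingComplex_isDegreewiseSummand f hL hL' _ (fun _ _ => rfl) hWM hG⟩
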